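/- **Setting.** Let $d\ge 1$. Let $\mathbb M^{d\times d}_{sym}$ be the space of real symmetric $d\times d$ matrices with scalar product $\xi:\eta=\sum_{ij}\xi_{ij}\eta_{ij}$ and norm $|\xi|=(\xi:\xi)^{1/2}$. For $d\ge2$ let $\mathbb M^{d\times d}_D$ be the subspace of trace-free symmetric matrices; for $d=1$ put $\mathbb M^{1\times1}_D=\mathbb R$. *Constraint set.* $K\subset\mathbb M^{d\times d}_D\times\mathbb R$ is closed and convex, there are constants $0<A\le B<\infty$ with $\{|\sigma|^2+|\zeta|^2\le A^2\}\subset K\subset\{|\sigma|^2+|\zeta|^2\le B^2\}$, and $(\sigma,\zeta)\in K$ implies $(0,\zeta)\in K$. Let $a_K,b_K>0$ be the constants such that the projection of $K$ on $\mathbb R$ is $[-a_K,b_K]$, and let $H(\xi,\theta)=\sup_{(\sigma,\zeta)\in K}(\sigma:\xi+\zeta\theta)$. *Elasticity tensor.* $\mathbb C:\mathbb M^{d\times d}_{sym}\to\mathbb M^{d\times d}_{sym}$ is linear, symmetric and positive definite, and leaves $\mathbb M^{d\times d}_D$ and $\mathbb R I$ invariant. *Softening potential.* $V:\mathbb R\to\mathbb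 R$ is of class $C^2$, and there is a constant $M\ge0$ with $-M\le V''\le 0$ on $\mathbb R$; moreover the limits $V'(\pm\infty)$ of $V'$ at $\pm\infty$ satisfy $-b_K<V'(+\infty)\le V'(-\infty)<a_K$. *Reference configuration.* One of the following two situations is considered. (DN) $\Omega\subset\mathbb R^d$ is a bounded connected open set with Lipschitz boundary, and $\Gamma_0\subset\partial\Omega$ is closed with $\mathcal H^{d-1}(\Gamma_0)>0$. For $w\in H^1(\Omega;\mathbb R^d)$, $A(w)$ is the set of all $(u,e,p)$ with $u\in H^1(\Omega;\mathbb R^d)$, $e\in L^2(\Omega;\mathbb M^{d\times d}_{sym})$, $p\in L^2(\Omega;\mathbb M^{d\times d}_D)$ such that $Eu=e+p$ a.e. in $\Omega$, where $Eu$ is the symmetric part of $\nabla u$, and $u=w$ $\mathcal H^{d-1}$-a.e. on $\Gamma_0$ in the sense of traces. (DP) $d\ge2$, $\Omega=(-\frac12,\frac12)^d$ and $\Gamma_0=\{x\in\partial\Omega:|x_1|=\frac12\}$. Here $w$ is assumed to be the restriction to $\Omega$ of a function in $H^1_{loc}(\mathbb R^d;\mathbb R^d)$ that is $1$-periodic in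 $x_2,\dots,x_d$, and $A(w)$ is defined as in (DN), with the further requirement that $u$ has the same property. For $e\in L^2(\Omega;\mathbb M^{d\times d}_{sym})$, $p\in L^2(\Omega;\mathbb M^{d\times d}_D)$ and $z\in L^2(\Omega)$ set $$\mathcal Q(e)=\tfrac12\int_\Omega \mathbb C e:e\,dx,\qquad \mathcal H(p,z)=\int_\Omega H(p(x),z(x))\,dx,\qquad \mathcal V(z)=\int_\Omega V(z(x))\,dx .$$ **Theorem.** In each of the situations (DN) and (DP), let $\varepsilon>0$ and $0<\tau<\varepsilon/M$ (with $\varepsilon/M=+\infty$ if $M=0$), let $w_1\in H^1(\Omega;\mathbb R^d)$ (periodic as above in the case (DP)), $p_0\in L^2(\Omega;\mathbb M^{d\times d}_D)$ and $z_0\in L^2(\Omega)$. Then the problem $$\min\Big\{\mathcal Q(e)+\mathcal H(p-p_0,z-z_0)+\mathcal V(z)+\tfrac{\varepsilon}{2\tau}\|p-p_0\|_2^2+\tfrac{\varepsilon}{2\tau}\|z-z_0\|_2^2\Big\}$$ over all $(u,e,p)\in A(w_1)$ and all $z\in L^2(\Omega)$ has a unique solution $(u,e,p,z)$. -/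

import Mathlib

open MeasureTheory Filter Topology
open scoped ContDiff

namespace SofteningPlasticity

noncomputable section

/-! ### Matrices -/

/-- The Euclidean space `ℝ^d`. -/
abbrev Vec (d : ℕ) : Type := EuclideanSpace ℝ (Fin d)

/-- Real `d × d` matrices with the Euclidean scalar product `∑ ξ_ij ζ_ij`. -/
abbrev Mat (d : ℕ) : Type := EuclideanSpace ℝ (Fin d × Fin d)

/-- The symmetric `d × d` matrices. -/
def symSubmodule (d : ℕ) : Submodule ℝ (Mat d) where
  carrier := {ξ | ∀ i j, ξ (i, j) = ξ (j, i)}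
  add_mem' := by
    intro a b ha hb i j
    simp [ha i j, hb i j]
  zero_mem' := by
    intro i j
    simp
  smul_mem' := by
    intro c a ha i j
    simp [ha i j]

/-- The deviatoric matrices: for `d ≥ 2` the symmetric matrices with zero trace; for `d = 1`, by
convention, all `1 × 1` matrices. -/
def devSubmodule (d : ℕ) : Submodule ℝ (Mat d) where
  carrier := {ξ | (∀ i j, ξ (i, j) = ξ (j, i)) ∧ (d ≠ 1 → ∑ i, ξ (i, i) = 0)}
  add_mem' := by
    rintro a b ⟨ha, ha'⟩ ⟨hb, hb'⟩
    refine ⟨fun i j => by simp [ha i j, hb i j], fun h => ?_⟩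
    simp [Finset.sum_add_distrib, ha' h, hb' h]
  zero_mem' := by
    refine ⟨fun i j => by simp, fun _ => by simp⟩
  smul_mem' := by
    rintro c a ⟨ha, ha'⟩
    refine ⟨fun i j => by simp [ha i j], fun h => ?_⟩
    simp [← Finset.mul_sum, ha' h]

/-- The Hilbert space of symmetric matrices. -/
abbrev MSym (d : ℕ) : Type := ↥(symSubmodule d)

/-- The Hilbert space of deviatoric matrices. -/
abbrev MDev (d : ℕ) : Type := ↥(devSubmodule d)

/-- The identity matrix. -/
def idSym (d : ℕ) : MSym d :=
  ⟨WithLp.toLp 2 fun ij : Fin d × Fin d => if ij.1 = ij.2 then (1 : ℝ) else 0, by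
    intro i j
    simp [eq_comm]⟩

/-- The symmetric part of a matrix. -/
def symPart {d : ℕ} (G : Mat d) : Mat d :=
  WithLp.toLp 2 fun ij : Fin d × Fin d => (G (ij.1, ij.2) + G (ij.2, ij.1)) / 2

/-! ### Sobolev functions and traces -/

/-- `L²(Ω; F)`, with Lebesgue measure on `Ω`. -/
abbrev L2 {d : ℕ} (Ω : Set (Vec d)) (F : Type) [NormedAddCommGroup F] : Type :=
  Lp F 2 (volume.restrict Ω)

/-- `G` is the distributional gradient of `u` on the open set `O`, with `G_ij = D_j u_i`
(`u` and `G` are locally integrable wherever this is used). -/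
def HasWeakGrad {d : ℕ} (O : Set (Vec d)) (u : Vec d → Vec d) (G : Vec d → Mat d) : Prop :=
  ∀ φ : Vec d → ℝ, ContDiff ℝ ∞ φ → HasCompactSupport φ → tsupport φ ⊆ O →
    ∀ i j : Fin d,
      ∫ x in O, u x i * fderiv ℝ φ x (EuclideanSpace.single j 1)
        = - ∫ x in O, G x (i, j) * φ x

/-- `u ∈ H¹(Ω; ℝ^d)`. -/
def MemH1 {d : ℕ} (Ω : Set (Vec d)) (u : L2 Ω (Vec d)) : Prop :=
  ∃ G : L2 Ω (Mat d), HasWeakGrad Ω u G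

/-- `U ∈ H¹_loc(ℝ^d; ℝ^d)`. -/
def MemH1loc {d : ℕ} (U : Vec d → Vec d) : Prop :=
  ∃ G : Vec d → Mat d,
    (∀ S : Set (Vec d), IsCompact S →
      MemLp U 2 (volume.restrict S) ∧ MemLp G 2 (volume.restrict S)) ∧
    HasWeakGrad Set.univ U G

/-- The gradient of a differentiable vector field. -/
def classicalGrad {d : ℕ} (φ : Vec d → Vec d) (x : Vec d) : Mat d :=
  WithLp.toLp 2 fun ij : Fin d × Fin d => (fderiv ℝ φ x (EuclideanSpace.single ij.2 1)) ij.1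

/-- The `(d-1)`-dimensional Hausdorff measure on `∂Ω`. -/
def bdryMeasure {d : ℕ} (Ω : Set (Vec d)) : Measure (Vec d) :=
  (Measure.hausdorffMeasure ((d : ℝ) - 1)).restrict (frontier Ω)

/-- `g ∈ L²(∂Ω, ℋ^{d-1}; ℝ^d)` is the trace of `u ∈ H¹(Ω; ℝ^d)`: the trace operator is the
continuous extension to `H¹(Ω)` of the restriction `φ ↦ φ|_{∂Ω}` of smooth functions. -/
def HasTrace {d : ℕ} (Ω : Set (Vec d)) (u : L2 Ω (Vec d)) (g : Lp (Vec d) 2 (bdryMeasure Ω)) :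
    Prop :=
  ∃ G : L2 Ω (Mat d), HasWeakGrad Ω u G ∧
    ∃ φ : ℕ → Vec d → Vec d, (∀ n, ContDiff ℝ ∞ (φ n)) ∧
      Tendsto (fun n => eLpNorm (fun x => φ n x - u x) 2 (volume.restrict Ω)) atTop (𝓝 0) ∧
      Tendsto (fun n => eLpNorm (fun x => classicalGrad (φ n) x - G x) 2 (volume.restrict Ω))
        atTop (𝓝 0) ∧
      Tendsto (fun n => eLpNorm (fun x => φ n x - g x) 2 (bdryMeasure Ω)) atTop (𝓝 0)

/-- `u = w` holds `ℋ^{d-1}`-a.e. on `Γ₀ ⊆ ∂Ω` in the sense of traces: the trace of `u - w`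
vanishes `ℋ^{d-1}`-a.e. on `Γ₀`. -/
def EqOnBdry {d : ℕ} (Ω Γ₀ : Set (Vec d)) (u w : L2 Ω (Vec d)) : Prop :=
  ∃ g : Lp (Vec d) 2 (bdryMeasure Ω), HasTrace Ω (u - w) g ∧
    ∀ᵐ x ∂((Measure.hausdorffMeasure ((d : ℝ) - 1) : Measure (Vec d)).restrict Γ₀), g x = 0

/-! ### The reference configuration -/

/-- `Ω` has Lipschitz boundary: near every boundary point, after a choice of a vertical direction
`ν`, it is the strict subgraph of a Lipschitz function of the component of `x` orthogonal
to `ν`. -/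
def HasLipschitzBoundary {d : ℕ} (Ω : Set (Vec d)) : Prop :=
  ∀ x₀ ∈ frontier Ω, ∃ ν : Vec d, ‖ν‖ = 1 ∧ ∃ (L : NNReal) (γ : Vec d → ℝ), LipschitzWith L γ ∧
    ∃ r : ℝ, 0 < r ∧ ∀ x ∈ Metric.ball x₀ r,
      (x ∈ Ω ↔ inner ℝ ν x < γ (x - inner ℝ ν x • ν))

/-- The Dirichlet–Neumann setting: a bounded Lipschitz domain `Ω` with Dirichlet part `Γ₀`; the
Neumann part is the rest of the boundary. -/
structure IsReferenceConfiguration {d : ℕ} (Ω Γ₀ : Set (Vec d)) : Prop where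
  isOpen : IsOpen Ω
  isConnected : IsConnected Ω
  isBounded : Bornology.IsBounded Ω
  lipschitz : HasLipschitzBoundary Ω
  dirichlet_subset : Γ₀ ⊆ frontier Ω
  dirichlet_closed : IsClosed Γ₀
  dirichlet_pos : 0 < (Measure.hausdorffMeasure ((d : ℝ) - 1) : Measure (Vec d)) Γ₀

/-- The open cube `(-1/2, 1/2)^d`. -/
def cube (d : ℕ) : Set (Vec d) := {x | ∀ i, |x i| < 1 / 2}

/-- The two faces of the cube orthogonal to the first coordinate direction (whose index
in `Fin d` is `0`). -/
def cubeFaces (d : ℕ) : Set (Vec d) :=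
  {x | x ∈ frontier (cube d) ∧ ∀ i : Fin d, i.val = 0 → |x i| = 1 / 2}

/-- `u` is the restriction to the cube of a function in `H¹_loc(ℝ^d; ℝ^d)` which is `1`-periodic
in every coordinate except the first one. -/
def IsPeriodicRestriction {d : ℕ} (u : L2 (cube d) (Vec d)) : Prop :=
  ∃ U : Vec d → Vec d, MemH1loc U ∧
    (∀ i : Fin d, i.val ≠ 0 → ∀ᵐ x : Vec d, U (x + EuclideanSpace.single i 1) = U x) ∧
    ∀ᵐ x ∂(volume.restrict (cube d)), u x = U x

/-! ### Kinematic admissibility -/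

/-- The set `A(w)` of admissible displacements and strains `(u, e, p)` (Dirichlet–Neumann case). -/
def admissible {d : ℕ} (Ω Γ₀ : Set (Vec d)) (w : L2 Ω (Vec d)) :
    Set (L2 Ω (Vec d) × L2 Ω (MSym d) × L2 Ω (MDev d)) :=
  {a | (∃ G : L2 Ω (Mat d), HasWeakGrad Ω a.1 G ∧
      ∀ᵐ x ∂(volume.restrict Ω), symPart (G x) = (a.2.1 x : Mat d) + (a.2.2 x : Mat d)) ∧
    EqOnBdry Ω Γ₀ a.1 w}

/-- The set `A(w)` in the Dirichlet–Periodic case. -/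
def admissiblePer {d : ℕ} (w : L2 (cube d) (Vec d)) :
    Set (L2 (cube d) (Vec d) × L2 (cube d) (MSym d) × L2 (cube d) (MDev d)) :=
  {a | a ∈ admissible (cube d) (cubeFaces d) w ∧ IsPeriodicRestriction a.1}

/-! ### Constitutive data -/

/-- The assumptions on the constraint set `K` of pairs `(σ, ζ)`. -/
structure IsConstraintSet {d : ℕ} (K : Set (MDev d × ℝ)) : Prop where
  isClosed : IsClosed K
  convex : Convex ℝ K
  bounds : ∃ A B : ℝ, 0 < A ∧ A ≤ B ∧
    (∀ (σ : MDev d) (ζ : ℝ), ‖σ‖ ^ 2 + |ζ| ^ 2 ≤ A ^ 2 → (σ, ζ) ∈ K) ∧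
    (∀ (σ : MDev d) (ζ : ℝ), (σ, ζ) ∈ K → ‖σ‖ ^ 2 + |ζ| ^ 2 ≤ B ^ 2)
  zero_mem : ∀ (σ : MDev d) (ζ : ℝ), (σ, ζ) ∈ K → ((0 : MDev d), ζ) ∈ K

/-- The constant `a_K` in `π_ℝ(K) = [-a_K, b_K]`. -/
def aK {d : ℕ} (K : Set (MDev d × ℝ)) : ℝ := -sInf (Prod.snd '' K)

/-- The constant `b_K` in `π_ℝ(K) = [-a_K, b_K]`. -/
def bK {d : ℕ} (K : Set (MDev d × ℝ)) : ℝ := sSup (Prod.snd '' K)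

/-- The support function `H(ξ, θ) = sup_{(σ, ζ) ∈ K} (σ : ξ + ζ θ)`. -/
def supportFn {d : ℕ} (K : Set (MDev d × ℝ)) (ξ : MDev d) (θ : ℝ) : ℝ :=
  sSup ((fun q : MDev d × ℝ => inner ℝ q.1 ξ + q.2 * θ) '' K)

/-- The assumptions on the elasticity tensor: symmetric, positive definite, leaving the deviatoric
matrices and the multiples of the identity invariant. -/
structure IsElasticityTensor {d : ℕ} (C : MSym d →ₗ[ℝ] MSym d) : Prop where
  symmetric : ∀ ξ η : MSym d, inner ℝ (C ξ) η = inner ℝ ξ (C η)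
  posDef : ∀ ξ : MSym d, ξ ≠ 0 → 0 < inner ℝ (C ξ) ξ
  dev_invariant : ∀ ξ : MSym d, (ξ : Mat d) ∈ devSubmodule d → (C ξ : Mat d) ∈ devSubmodule d
  id_invariant : ∃ c : ℝ, C (idSym d) = c • idSym d

/-- The assumptions on the softening potential `V`, with the bound `M` on `|V''|`. The last field
is `-b_K < V'(+∞) ≤ V'(-∞) < a_K`. -/
structure IsSofteningPotential {d : ℕ} (K : Set (MDev d × ℝ)) (V : ℝ → ℝ) (M : ℝ) : Prop where
  contDiff : ContDiff ℝ 2 V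
  nonneg : 0 ≤ M
  second_deriv : ∀ θ : ℝ, -M ≤ deriv (deriv V) θ ∧ deriv (deriv V) θ ≤ 0
  limits : ∃ vp vm : ℝ, Tendsto (deriv V) atTop (𝓝 vp) ∧ Tendsto (deriv V) atBot (𝓝 vm) ∧
    -bK K < vp ∧ vp ≤ vm ∧ vm < aK K

/-! ### Energies -/

/-- The stored elastic energy `𝒬(e) = ½ ∫_Ω ℂe : e dx`. -/
def elasticEnergy {d : ℕ} {Ω : Set (Vec d)} (C : MSym d →ₗ[ℝ] MSym d) (e : L2 Ω (MSym d)) : ℝ :=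
  ∫ x in Ω, (1 / 2 : ℝ) * inner ℝ (C (e x)) (e x)

/-- The dissipation functional `ℋ(p, z) = ∫_Ω H(p, z) dx` on `L²` functions. -/
def dissipation {d : ℕ} {Ω : Set (Vec d)} (K : Set (MDev d × ℝ)) (p : L2 Ω (MDev d))
    (z : L2 Ω ℝ) : ℝ :=
  ∫ x in Ω, supportFn K (p x) (z x)

/-- The softening energy `𝒱(z) = ∫_Ω V(z) dx`. -/
def softeningEnergy {d : ℕ} {Ω : Set (Vec d)} (V : ℝ → ℝ) (z : L2 Ω ℝ) : ℝ :=
  ∫ x in Ω, V (z x)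

/-- The configurations `(u, e, p, z)`. -/
abbrev Config {d : ℕ} (Ω : Set (Vec d)) : Type :=
  L2 Ω (Vec d) × L2 Ω (MSym d) × L2 Ω (MDev d) × L2 Ω ℝ

/-- The functional of the incremental minimum problem at `(u, e, p, z)`. -/
def incrementalEnergy {d : ℕ} {Ω : Set (Vec d)} (C : MSym d →ₗ[ℝ] MSym d)
    (K : Set (MDev d × ℝ)) (V : ℝ → ℝ) (ε τ : ℝ) (p₀ : L2 Ω (MDev d)) (z₀ : L2 Ω ℝ)
    (c : Config Ω) : ℝ :=
  elasticEnergy C c.2.1 + dissipation K (c.2.2.1 - p₀) (c.2.2.2 - z₀)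
    + softeningEnergy V c.2.2.2
    + ε / (2 * τ) * ‖c.2.2.1 - p₀‖ ^ 2 + ε / (2 * τ) * ‖c.2.2.2 - z₀‖ ^ 2

/-- The configurations `(u, e, p, z)` with `(u, e, p)` in a given set and `z ∈ L²(Ω)` arbitrary. -/
def competitors {d : ℕ} {Ω : Set (Vec d)}
    (A : Set (L2 Ω (Vec d) × L2 Ω (MSym d) × L2 Ω (MDev d))) : Set (Config Ω) :=
  {c | (c.1, c.2.1, c.2.2.1) ∈ A}

end

end SofteningPlasticity

open SofteningPlasticity

/-!
The minimisation problem is convex in disguise. The viscous term `ε/(2τ) ‖z - z₀‖²` is uniformly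
convex with modulus `ε/τ`, and `ε/τ > M` dominates the concavity of `V`; the elastic energy is
coercive in `e` and the viscous term is uniformly convex in `p`, while the dissipation is convex.
Hence the functional is continuous, bounded below and strongly midpoint convex in `(e, p, z)`
(`exists_incrementalEnergy_bounds`), and on a closed convex set of triples its minimising sequences
are Cauchy and converge to the only minimiser (`existsUnique_isMinOn_of_midpoint`).

The functional does not see the displacement `u`. What has to be proved about `u` is that
`Eu = e + p` with `u ∈ w + N` is a closed condition on `(e, p)`, and that it determines `u`. Both
follow from a Korn inequality `‖t‖ ≤ C ‖Eu‖` on the closed space `N` of all triples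
`t = (u, ∇u, trace of u)` with zero trace on the Dirichlet part, since an operator bounded below on
a complete space is injective with closed range (`existsUnique_constrained_min`). The trace of
`HasTrace` is defined through approximation by smooth fields on the whole space, so that Korn's
inequality is needed for smooth fields only, provided that it controls the trace in `L²(∂Ω)` as
well (`exists_korn_dirichlet`); it then passes to the closure (`exists_korn_trace`).

Korn's inequality for smooth fields on a Lipschitz domain is proved as follows.

* For compactly supported fields it is an integration by parts
  (`lintegral_classicalGrad_le_strain`). On a ball, testing the differences
  `(u(x) - u(y)) · (x - y)`, which involve only the strain, with the derivatives of a bump function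
  shows that `u` is close in `L²` to a rigid displacement, and a cut-off gives the gradient
  (`exists_rigid_ball`). Gluing balls covers every compact subset of a connected open set
  (`exists_isKornSet_of_isCompact`).
* Near the boundary, the domain lies below a Lipschitz graph. Let `x ↦ x̂` be the map that scales
  the depth below the graph by a fixed factor `θ > 1`. On a Whitney ball both `∇u(x)` and `∇u(x̂)`
  are close to the same skew matrix, which bounds `∇u(x) - ∇u(x̂)` in `L²` by the strain
  (`exists_lintegral_sub_stretch_le`). As the stretching expands volumes by `θ`, the gradient near
  the boundary is absorbed up to its values in a layer inside the domain
  (`lintegral_classicalGrad_slab_le`). The field and its trace are recovered by integration along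
  the vertical lines (`exists_boundary_estimate`).
* Together this gives Korn's inequality modulo rigid displacements, with the trace
  (`exists_rigid_domain`). A rigid displacement that does not vanish identically vanishes only on a
  set of dimension at most `d - 2`, so that its trace on the Dirichlet part controls it.

In the periodic case `N` consists of the fields that are moreover restrictions of periodic
`H¹_loc` fields. This space is closed because periodicity can be expressed by integrals over the
cube alone (`isPeriodicRestriction_iff_isUnfoldedGrad`). A field with zero trace on the two faces
orthogonal to the first direction is extended periodically to the strip `|x₁| < 1/2` and by zero
outside; the weak formulation of its gradient, unfolded cell by cell, is a family of continuous
linear conditions. Conversely a periodic `H¹_loc` field satisfies them: in the first direction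
because the trace on the faces vanishes, in the others because a cut-off that depends on the first
coordinate only is not differentiated.
-/


namespace SofteningPlasticity

open scoped ENNReal

noncomputable section

/-! ### Gradients and strains of smooth fields -/

/-- The linearised strain `Eφ` of a differentiable vector field. -/
def strain {d : ℕ} (φ : Vec d → Vec d) (x : Vec d) : Mat d := symPart (classicalGrad φ x)

theorem enorm_add_sq_le {F : Type*} [NormedAddCommGroup F] (a b : F) :
    ‖a + b‖ₑ ^ 2 ≤ 2 * ‖a‖ₑ ^ 2 + 2 * ‖b‖ₑ ^ 2 := by
  have h : ‖a + b‖ ^ 2 ≤ 2 * ‖a‖ ^ 2 + 2 * ‖b‖ ^ 2 := by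
    have := norm_add_le a b
    nlinarith [sq_nonneg (‖a‖ - ‖b‖), norm_nonneg (a + b), norm_nonneg a, norm_nonneg b]
  have h' := ENNReal.ofReal_le_ofReal h
  rw [ENNReal.ofReal_add (by positivity) (by positivity), ENNReal.ofReal_mul (by norm_num),
    ENNReal.ofReal_mul (by norm_num), ENNReal.ofReal_pow (norm_nonneg _),
    ENNReal.ofReal_pow (norm_nonneg _), ENNReal.ofReal_pow (norm_nonneg _)] at h'
  simpa [ofReal_norm] using h'

theorem enorm_sub_sq_le {F : Type*} [NormedAddCommGroup F] (a b : F) :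
    ‖a - b‖ₑ ^ 2 ≤ 2 * ‖a‖ₑ ^ 2 + 2 * ‖b‖ₑ ^ 2 := by
  simpa [sub_eq_add_neg] using enorm_add_sq_le a (-b)

/-- A pointwise bound between squared norms, transferred to extended norms. -/
theorem enorm_sq_le_of_norm_sq_le {F F' : Type*} [NormedAddCommGroup F] [NormedAddCommGroup F']
    {a : F} {b : F'} {c : ℝ} (hc : 0 ≤ c) (h : ‖a‖ ^ 2 ≤ c * ‖b‖ ^ 2) :
    ‖a‖ₑ ^ 2 ≤ ENNReal.ofReal c * ‖b‖ₑ ^ 2 := by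
  have h' := ENNReal.ofReal_le_ofReal h
  rw [ENNReal.ofReal_mul hc, ENNReal.ofReal_pow (norm_nonneg _),
    ENNReal.ofReal_pow (norm_nonneg _)] at h'
  simpa [ofReal_norm] using h'

theorem ofReal_norm_sq {F : Type*} [NormedAddCommGroup F] (a : F) :
    ENNReal.ofReal (‖a‖ ^ 2) = ‖a‖ₑ ^ 2 := by
  rw [ENNReal.ofReal_pow (norm_nonneg _), ofReal_norm]

section Fields

variable {d : ℕ}

theorem symPart_apply (G : Mat d) (i j : Fin d) : symPart G (i, j) = (G (i, j) + G (j, i)) / 2 :=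
  rfl

theorem classicalGrad_apply (φ : Vec d → Vec d) (x : Vec d) (i j : Fin d) :
    classicalGrad φ x (i, j) = fderiv ℝ φ x (EuclideanSpace.single j 1) i := rfl

theorem strain_apply (φ : Vec d → Vec d) (x : Vec d) (i j : Fin d) :
    strain φ x (i, j) = (classicalGrad φ x (i, j) + classicalGrad φ x (j, i)) / 2 := rfl

theorem symPart_add (G G' : Mat d) : symPart (G + G') = symPart G + symPart G' := by
  ext ij; obtain ⟨i, j⟩ := ij; simp [symPart_apply]; ring

theorem symPart_sub (G G' : Mat d) : symPart (G - G') = symPart G - symPart G' := by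
  ext ij; obtain ⟨i, j⟩ := ij; simp [symPart_apply]; ring

theorem symPart_smul (c : ℝ) (G : Mat d) : symPart (c • G) = c • symPart G := by
  ext ij; obtain ⟨i, j⟩ := ij; simp [symPart_apply]; ring

theorem Mat.norm_sq_eq (G : Mat d) : ‖G‖ ^ 2 = ∑ i, ∑ j, G (i, j) ^ 2 := by
  rw [EuclideanSpace.norm_sq_eq, Fintype.sum_prod_type]
  simp

theorem Vec.norm_sq_eq (v : Vec d) : ‖v‖ ^ 2 = ∑ i, v i ^ 2 := by
  rw [EuclideanSpace.norm_sq_eq]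
  simp

theorem abs_apply_le_norm {ι : Type*} [Fintype ι] (v : EuclideanSpace ℝ ι) (i : ι) :
    |v i| ≤ ‖v‖ := by
  simpa using PiLp.norm_apply_le v i

theorem norm_symPart_le (G : Mat d) : ‖symPart G‖ ≤ ‖G‖ := by
  refine le_of_sq_le_sq ?_ (norm_nonneg _)
  rw [Mat.norm_sq_eq, Mat.norm_sq_eq]
  have h1 : ∑ i, ∑ j, (symPart G (i, j)) ^ 2
      ≤ ∑ i, ∑ j, ((G (i, j)) ^ 2 / 2 + (G (j, i)) ^ 2 / 2) :=
    Finset.sum_le_sum fun i _ => Finset.sum_le_sum fun j _ => by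
      rw [symPart_apply]; nlinarith [sq_nonneg (G (i, j) - G (j, i))]
  refine h1.trans (le_of_eq ?_)
  simp only [Finset.sum_add_distrib]
  rw [Finset.sum_comm (f := fun i j => (G (j, i)) ^ 2 / 2)]
  simp only [← Finset.sum_add_distrib, add_halves]

theorem continuous_symPart : Continuous (symPart : Mat d → Mat d) := by
  refine (PiLp.continuous_toLp 2 _).comp (continuous_pi fun ij => ?_)
  fun_prop

theorem fderiv_apply_coord {φ : Vec d → Vec d} (x v : Vec d) (i : Fin d) :
    fderiv ℝ φ x v i = ∑ j, classicalGrad φ x (i, j) * v j := by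
  have hv : v = ∑ j, v j • EuclideanSpace.single j (1 : ℝ) := by
    ext k
    simp [Finset.sum_apply, Pi.single_apply]
  conv_lhs => rw [hv]
  simp [map_sum, classicalGrad_apply, mul_comm]

theorem norm_fderiv_apply_le (φ : Vec d → Vec d) (x v : Vec d) :
    ‖fderiv ℝ φ x v‖ ≤ ‖classicalGrad φ x‖ * ‖v‖ := by
  refine le_of_sq_le_sq ?_ (by positivity)
  rw [mul_pow, Vec.norm_sq_eq, Mat.norm_sq_eq, Vec.norm_sq_eq, Finset.sum_mul]
  refine Finset.sum_le_sum fun i _ => ?_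
  rw [fderiv_apply_coord]
  exact Finset.sum_mul_sq_le_sq_mul_sq _ _ _

theorem abs_inner_fderiv_le (φ : Vec d → Vec d) (x v : Vec d) :
    |inner ℝ (fderiv ℝ φ x v) v| ≤ ‖strain φ x‖ * ‖v‖ ^ 2 := by
  have h1 : inner ℝ (fderiv ℝ φ x v) v = ∑ i, ∑ j, strain φ x (i, j) * (v i * v j) := by
    have e1 : inner ℝ (fderiv ℝ φ x v) v = ∑ i, ∑ j, classicalGrad φ x (i, j) * (v i * v j) := by
      simp only [PiLp.inner_apply, fderiv_apply_coord, RCLike.inner_apply, conj_trivial,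
        Finset.mul_sum]
      exact Finset.sum_congr rfl fun i _ => Finset.sum_congr rfl fun j _ => by ring
    have e2 : inner ℝ (fderiv ℝ φ x v) v = ∑ i, ∑ j, classicalGrad φ x (j, i) * (v i * v j) := by
      rw [e1, Finset.sum_comm]
      exact Finset.sum_congr rfl fun i _ => Finset.sum_congr rfl fun j _ => by ring
    have : inner ℝ (fderiv ℝ φ x v) v
        = (inner ℝ (fderiv ℝ φ x v) v + inner ℝ (fderiv ℝ φ x v) v) / 2 := by ring
    rw [this]
    nth_rewrite 1 [e1]
    rw [e2, ← Finset.sum_add_distrib, Finset.sum_div]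
    refine Finset.sum_congr rfl fun i _ => ?_
    rw [← Finset.sum_add_distrib, Finset.sum_div]
    exact Finset.sum_congr rfl fun j _ => by rw [strain_apply]; ring
  rw [h1]
  refine abs_le_of_sq_le_sq ?_ (by positivity)
  rw [mul_pow, Mat.norm_sq_eq, ← pow_mul]
  have h2 := Finset.sum_mul_sq_le_sq_mul_sq (Finset.univ : Finset (Fin d × Fin d))
    (fun ij => strain φ x ij) (fun ij => v ij.1 * v ij.2)
  rw [Fintype.sum_prod_type, Fintype.sum_prod_type, Fintype.sum_prod_type] at h2
  refine h2.trans (le_of_eq ?_)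
  congr 1
  rw [show 2 * 2 = 2 + 2 by norm_num, pow_add, Vec.norm_sq_eq, Finset.sum_mul_sum]
  simp only [mul_pow]

theorem continuous_classicalGrad {φ : Vec d → Vec d} (hφ : ContDiff ℝ ∞ φ) :
    Continuous (classicalGrad φ) := by
  have h := hφ.continuous_fderiv (by simp)
  refine (PiLp.continuous_toLp 2 _).comp (continuous_pi fun ij => ?_)
  exact (EuclideanSpace.proj ij.1 : Vec d →L[ℝ] ℝ).continuous.comp (h.clm_apply continuous_const)

theorem continuous_strain {φ : Vec d → Vec d} (hφ : ContDiff ℝ ∞ φ) : Continuous (strain φ) :=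
  continuous_symPart.comp (continuous_classicalGrad hφ)

theorem classicalGrad_sub {φ ψ : Vec d → Vec d} (hφ : ContDiff ℝ ∞ φ) (hψ : ContDiff ℝ ∞ ψ)
    (x : Vec d) : classicalGrad (fun x => φ x - ψ x) x = classicalGrad φ x - classicalGrad ψ x := by
  ext ij
  obtain ⟨i, j⟩ := ij
  rw [classicalGrad_apply, fderiv_fun_sub (hφ.differentiable (by simp) x)
    (hψ.differentiable (by simp) x)]
  simp [classicalGrad_apply]

theorem strain_sub {φ ψ : Vec d → Vec d} (hφ : ContDiff ℝ ∞ φ) (hψ : ContDiff ℝ ∞ ψ)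
    (x : Vec d) : strain (fun x => φ x - ψ x) x = strain φ x - strain ψ x := by
  rw [strain, classicalGrad_sub hφ hψ, symPart_sub]; rfl

theorem fderiv_coord {φ : Vec d → Vec d} (hφ : ContDiff ℝ ∞ φ) (x v : Vec d) (i : Fin d) :
    fderiv ℝ (fun x => φ x i) x v = fderiv ℝ φ x v i := by
  have h := (EuclideanSpace.proj i : Vec d →L[ℝ] ℝ).hasFDerivAt.comp x
    (hφ.differentiable (by simp) x).hasFDerivAt
  rw [show (fun x => φ x i) = (EuclideanSpace.proj i : Vec d →L[ℝ] ℝ) ∘ φ from rfl, h.fderiv]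
  rfl

theorem contDiff_coord {φ : Vec d → Vec d} (hφ : ContDiff ℝ ∞ φ) (i : Fin d) :
    ContDiff ℝ ∞ (fun x => φ x i) :=
  (EuclideanSpace.proj i : Vec d →L[ℝ] ℝ).contDiff.comp hφ

/-- Two integrations by parts exchange the directions of differentiation. -/
theorem integral_fderiv_mul_fderiv_swap {f g : Vec d → ℝ} (hf : ContDiff ℝ ∞ f)
    (hg : ContDiff ℝ ∞ g) (hfc : HasCompactSupport f) (v w : Vec d) :
    ∫ x, fderiv ℝ f x v * fderiv ℝ g x w = ∫ x, fderiv ℝ f x w * fderiv ℝ g x v := by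
  have smooth : ∀ {k : Vec d → ℝ} (_ : ContDiff ℝ ∞ k) (u : Vec d),
      ContDiff ℝ ∞ (fun x => fderiv ℝ k x u) := fun {k} hk u =>
    (hk.fderiv_right (m := ∞) (by simp)).clm_apply contDiff_const
  have supp : ∀ {k : Vec d → ℝ} (_ : HasCompactSupport k) (u : Vec d),
      HasCompactSupport (fun x => fderiv ℝ k x u) := fun {k} hk u =>
    hk.fderiv_apply (𝕜 := ℝ) u
  have int : ∀ {k l : Vec d → ℝ} (_ : ContDiff ℝ ∞ k) (_ : ContDiff ℝ ∞ l)
      (_ : HasCompactSupport k), Integrable (fun x => k x * l x) := fun {k l} hk hl hkc =>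
    (hk.continuous.mul hl.continuous).integrable_of_hasCompactSupport hkc.mul_right
  have parts : ∀ u u' : Vec d, ∫ x, f x * fderiv ℝ (fun y => fderiv ℝ g y u) x u'
      = - ∫ x, fderiv ℝ f x u' * fderiv ℝ g x u := fun u u' =>
    integral_mul_fderiv_eq_neg_fderiv_mul_of_integrable
      (int (smooth hf u') (smooth hg u) (supp hfc u'))
      (int hf (smooth (smooth hg u) u') hfc) (int hf (smooth hg u) hfc)
      (fun x _ => hf.differentiable (by simp) x)
      (fun x _ => (smooth hg u).differentiable (by simp) x)
  have symm : ∀ x, fderiv ℝ (fun y => fderiv ℝ g y w) x v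
      = fderiv ℝ (fun y => fderiv ℝ g y v) x w := by
    intro x
    have hd : DifferentiableAt ℝ (fderiv ℝ g) x :=
      (hg.fderiv_right (m := ∞) (by simp)).differentiable (by simp) x
    have hs : IsSymmSndFDerivAt ℝ g x :=
      (hg.contDiffAt).isSymmSndFDerivAt (by
        rw [minSmoothness_of_isRCLikeNormedField]
        exact WithTop.coe_le_coe.2 le_top)
    rw [fderiv_clm_apply hd (differentiableAt_const _),
      fderiv_clm_apply hd (differentiableAt_const _)]
    simpa using hs v w
  have h1 := parts w v
  have h2 := parts v w
  simp only [symm] at h1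
  rw [h1] at h2
  exact neg_injective h2

theorem hasCompactSupport_classicalGrad {φ : Vec d → Vec d} (hc : HasCompactSupport φ) :
    HasCompactSupport (classicalGrad φ) := by
  refine (hc.fderiv (𝕜 := ℝ)).mono fun x hx => ?_
  contrapose! hx
  simp only [Function.mem_support, not_not] at hx ⊢
  ext ij
  obtain ⟨i, j⟩ := ij
  rw [classicalGrad_apply, hx]
  rfl

theorem hasCompactSupport_strain {φ : Vec d → Vec d} (hc : HasCompactSupport φ) :
    HasCompactSupport (strain φ) := by
  refine (hasCompactSupport_classicalGrad hc).mono fun x hx => ?_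
  contrapose! hx
  simp only [Function.mem_support, not_not] at hx ⊢
  ext ij
  obtain ⟨i, j⟩ := ij
  rw [strain_apply, hx]
  simp

theorem two_mul_norm_strain_sq_sub (φ : Vec d → Vec d) (x : Vec d) :
    2 * ‖strain φ x‖ ^ 2 - ‖classicalGrad φ x‖ ^ 2
      = ∑ i, ∑ j, classicalGrad φ x (i, j) * classicalGrad φ x (j, i) := by
  have hsw : ∑ i, ∑ j, classicalGrad φ x (i, j) ^ 2 = ∑ i, ∑ j, classicalGrad φ x (j, i) ^ 2 :=
    Finset.sum_comm
  have : 2 * ‖strain φ x‖ ^ 2 - ‖classicalGrad φ x‖ ^ 2 = 2 * ‖strain φ x‖ ^ 2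
      - (∑ i, ∑ j, classicalGrad φ x (i, j) ^ 2) / 2
      - (∑ i, ∑ j, classicalGrad φ x (j, i) ^ 2) / 2 := by
    rw [← hsw, Mat.norm_sq_eq (classicalGrad φ x)]; ring
  rw [this, Mat.norm_sq_eq]
  simp only [Finset.mul_sum, Finset.sum_div, ← Finset.sum_sub_distrib]
  exact Finset.sum_congr rfl fun i _ => Finset.sum_congr rfl fun j _ => by
    rw [strain_apply]; ring

theorem continuous_classicalGrad_coord {φ : Vec d → Vec d} (hφ : ContDiff ℝ ∞ φ) (i j : Fin d) :
    Continuous (fun x => classicalGrad φ x (i, j)) :=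
  (EuclideanSpace.proj (i, j) : Mat d →L[ℝ] ℝ).continuous.comp (continuous_classicalGrad hφ)

theorem integral_sum_classicalGrad_mul {φ : Vec d → Vec d} (hφ : ContDiff ℝ ∞ φ)
    (hc : HasCompactSupport φ) :
    ∫ x, ∑ i, ∑ j, classicalGrad φ x (i, j) * classicalGrad φ x (j, i)
      = ∫ x, (∑ i, classicalGrad φ x (i, i)) ^ 2 := by
  have hGc := hasCompactSupport_classicalGrad hc
  have hci : ∀ i, HasCompactSupport (fun x => φ x i) := fun i =>
    hc.comp_left (g := fun v : Vec d => v i) rfl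
  have hGci : ∀ i j, HasCompactSupport (fun x => classicalGrad φ x (i, j)) := fun i j =>
    hGc.comp_left (g := fun v : Mat d => v (i, j)) rfl
  have iP : ∀ i j k l : Fin d,
      Integrable (fun x => classicalGrad φ x (i, j) * classicalGrad φ x (k, l)) := fun i j k l =>
    ((continuous_classicalGrad_coord hφ i j).mul
      (continuous_classicalGrad_coord hφ k l)).integrable_of_hasCompactSupport (hGci i j).mul_right
  have e : ∀ x, (∑ i, classicalGrad φ x (i, i)) ^ 2
      = ∑ i, ∑ j, classicalGrad φ x (i, i) * classicalGrad φ x (j, j) := fun x => by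
    rw [sq, Finset.sum_mul_sum]
  have exch : ∀ F : Fin d → Fin d → Vec d → ℝ, (∀ i j, Integrable (F i j)) →
      ∫ x, ∑ i, ∑ j, F i j x = ∑ i, ∑ j, ∫ x, F i j x := fun F hF => by
    rw [integral_finsetSum _ fun i _ => integrable_finsetSum _ fun j _ => hF i j]
    exact Finset.sum_congr rfl fun i _ => integral_finsetSum _ fun j _ => hF i j
  simp only [e]
  rw [exch _ fun i j => iP i j j i, exch _ fun i j => iP i i j j]
  refine Finset.sum_congr rfl fun i _ => Finset.sum_congr rfl fun j _ => ?_
  have := integral_fderiv_mul_fderiv_swap (contDiff_coord hφ i) (contDiff_coord hφ j) (hci i)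
    (EuclideanSpace.single j 1) (EuclideanSpace.single i 1)
  simpa only [fderiv_coord hφ, ← classicalGrad_apply] using this

/-- **Korn's first inequality**: for compactly supported smooth fields the strain controls the
whole gradient. Two integrations by parts give `∫ ∑ ∂_jφ_i ∂_iφ_j = ∫ (div φ)² ≥ 0`. -/
theorem lintegral_classicalGrad_le_strain {φ : Vec d → Vec d} (hφ : ContDiff ℝ ∞ φ)
    (hc : HasCompactSupport φ) :
    ∫⁻ x, ‖classicalGrad φ x‖ₑ ^ 2 ≤ 2 * ∫⁻ x, ‖strain φ x‖ₑ ^ 2 := by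
  have iG : Integrable (fun x => ‖classicalGrad φ x‖ ^ 2) := by
    simp only [sq]
    exact ((continuous_classicalGrad hφ).norm.mul
      (continuous_classicalGrad hφ).norm).integrable_of_hasCompactSupport
      (hasCompactSupport_classicalGrad hc).norm.mul_right
  have iE : Integrable (fun x => ‖strain φ x‖ ^ 2) := by
    simp only [sq]
    exact ((continuous_strain hφ).norm.mul
      (continuous_strain hφ).norm).integrable_of_hasCompactSupport
      (hasCompactSupport_strain hc).norm.mul_right
  have hreal : ∫ x, ‖classicalGrad φ x‖ ^ 2 ≤ 2 * ∫ x, ‖strain φ x‖ ^ 2 := by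
    have h0 : 0 ≤ ∫ x, (2 * ‖strain φ x‖ ^ 2 - ‖classicalGrad φ x‖ ^ 2) := by
      simp only [two_mul_norm_strain_sq_sub]
      rw [integral_sum_classicalGrad_mul hφ hc]
      exact integral_nonneg fun x => sq_nonneg _
    rw [integral_sub (iE.const_mul 2) iG, integral_const_mul] at h0
    linarith
  have h := ENNReal.ofReal_le_ofReal hreal
  rw [ENNReal.ofReal_mul (by norm_num), ofReal_integral_eq_lintegral_ofReal iG
    (ae_of_all _ fun x => by positivity), ofReal_integral_eq_lintegral_ofReal iE
    (ae_of_all _ fun x => by positivity)] at h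
  simpa only [ofReal_norm_sq, ENNReal.ofReal_ofNat] using h

end Fields

/-! ### Korn's inequality on balls -/

/-- The Cauchy–Schwarz inequality against the constant function `1`. -/
theorem lintegral_sq_le {α : Type*} [MeasurableSpace α] {μ : Measure α} {f : α → ℝ≥0∞}
    (hf : AEMeasurable f μ) : (∫⁻ x, f x ∂μ) ^ 2 ≤ μ Set.univ * ∫⁻ x, f x ^ 2 ∂μ := by
  have h := ENNReal.lintegral_mul_le_Lp_mul_Lq μ (Real.HolderConjugate.two_two) hf
    (aemeasurable_const (b := (1 : ℝ≥0∞)))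
  simp only [Pi.mul_apply, mul_one, ENNReal.one_rpow, lintegral_const, one_mul] at h
  have h2 := pow_le_pow_left' h 2
  refine h2.trans (le_of_eq ?_)
  rw [mul_pow, ← ENNReal.rpow_natCast, ← ENNReal.rpow_natCast, ← ENNReal.rpow_mul,
    ← ENNReal.rpow_mul]
  norm_num [mul_comm]

/-- Tonelli's theorem for three variables, the last variable moved to the front. -/
theorem lintegral_rotate {α β γ : Type*} [MeasurableSpace α] [MeasurableSpace β]
    [MeasurableSpace γ] {μ : Measure α} {ν : Measure β} {ρ : Measure γ} [SFinite μ] [SFinite ν]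
    [SFinite ρ] {f : (α × β) × γ → ℝ≥0∞} (hf : Measurable f) :
    ∫⁻ x, ∫⁻ y, ∫⁻ s, f ((x, y), s) ∂ρ ∂ν ∂μ = ∫⁻ s, ∫⁻ x, ∫⁻ y, f ((x, y), s) ∂ν ∂μ ∂ρ := by
  have h1 : ∀ x, ∫⁻ y, ∫⁻ s, f ((x, y), s) ∂ρ ∂ν = ∫⁻ s, ∫⁻ y, f ((x, y), s) ∂ν ∂ρ := fun x =>
    lintegral_lintegral_swap
      (hf.comp (by fun_prop : Measurable fun p : β × γ => ((x, p.1), p.2))).aemeasurable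
  simp only [h1]
  refine lintegral_lintegral_swap (Measurable.aemeasurable ?_)
  exact (hf.comp (by fun_prop :
    Measurable fun p : (α × γ) × β => ((p.1.1, p.2), p.1.2))).lintegral_prod_right' (ν := ν)

theorem lintegral_const_mul_three {α β γ : Type*} [MeasurableSpace α] [MeasurableSpace β]
    [MeasurableSpace γ] {μ : Measure α} {ν : Measure β} {ρ : Measure γ} [SFinite μ] [SFinite ν]
    [SFinite ρ] {f : (α × β) × γ → ℝ≥0∞} (hf : Measurable f) (c : ℝ≥0∞) :
    ∫⁻ x, ∫⁻ y, c * ∫⁻ s, f ((x, y), s) ∂ρ ∂ν ∂μ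
      = c * ∫⁻ x, ∫⁻ y, ∫⁻ s, f ((x, y), s) ∂ρ ∂ν ∂μ := by
  have m0 : Measurable fun p : α × β => ∫⁻ s, f (p, s) ∂ρ := hf.lintegral_prod_right' (ν := ρ)
  have m1 : ∀ x, Measurable fun y => ∫⁻ s, f ((x, y), s) ∂ρ := fun x =>
    m0.comp measurable_prodMk_left
  have m2 : Measurable fun x => ∫⁻ y, ∫⁻ s, f ((x, y), s) ∂ρ ∂ν :=
    m0.lintegral_prod_right' (ν := ν)
  simp only [lintegral_const_mul _ (m1 _)]
  rw [lintegral_const_mul _ m2]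

section Rigid

variable {d : ℕ}

/-- Skew-symmetric matrices. -/
def IsSkew (A : Mat d) : Prop := ∀ i j, A (i, j) = - A (j, i)

/-- The affine field `x ↦ A x + b`; it is an infinitesimal rigid displacement when `A` is skew. -/
def rigid (A : Mat d) (b : Vec d) (x : Vec d) : Vec d :=
  WithLp.toLp 2 fun i => ∑ j, A (i, j) * x j + b i

theorem rigid_apply (A : Mat d) (b x : Vec d) (i : Fin d) :
    rigid A b x i = ∑ j, A (i, j) * x j + b i := rfl

theorem contDiff_rigid (A : Mat d) (b : Vec d) : ContDiff ℝ ∞ (rigid A b) := by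
  rw [contDiff_euclidean]
  intro i
  simp only [rigid_apply]
  refine (ContDiff.sum fun j _ => contDiff_const.mul ?_).add contDiff_const
  exact (EuclideanSpace.proj j : Vec d →L[ℝ] ℝ).contDiff

theorem classicalGrad_rigid (A : Mat d) (b x : Vec d) : classicalGrad (rigid A b) x = A := by
  ext ij
  obtain ⟨i, j⟩ := ij
  rw [classicalGrad_apply, ← fderiv_coord (contDiff_rigid A b)]
  have hL : HasFDerivAt (fun x : Vec d => rigid A b x i)
      (∑ j, A (i, j) • (EuclideanSpace.proj j : Vec d →L[ℝ] ℝ)) x := by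
    simp only [rigid_apply]
    refine (HasFDerivAt.fun_sum fun j _ => ?_).add_const _
    exact ((EuclideanSpace.proj j : Vec d →L[ℝ] ℝ).hasFDerivAt).const_mul _
  rw [hL.fderiv]
  simp

theorem strain_sub_rigid {φ : Vec d → Vec d} (hφ : ContDiff ℝ ∞ φ) {A : Mat d} (hA : IsSkew A)
    (b x : Vec d) : strain (fun x => φ x - rigid A b x) x = strain φ x := by
  rw [strain_sub hφ (contDiff_rigid A b)]
  have : strain (rigid A b) x = 0 := by
    ext ij
    obtain ⟨i, j⟩ := ij
    rw [strain_apply, classicalGrad_rigid, hA i j]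
    simp
  rw [this, sub_zero]

theorem norm_rigid_le (A : Mat d) (b x : Vec d) : ‖rigid A b x‖ ≤ ‖A‖ * ‖x‖ + ‖b‖ := by
  have e : rigid A b x = rigid A 0 x + b := by
    ext i; simp [rigid_apply]
  rw [e]
  refine (norm_add_le _ _).trans (add_le_add_left ?_ _)
  refine le_of_sq_le_sq ?_ (by positivity)
  rw [mul_pow, Vec.norm_sq_eq, Mat.norm_sq_eq, Vec.norm_sq_eq, Finset.sum_mul]
  refine Finset.sum_le_sum fun i _ => ?_
  rw [rigid_apply]
  simpa using Finset.sum_mul_sq_le_sq_mul_sq Finset.univ (fun j => A (i, j)) (fun j => x j)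

end Rigid

section Ball

variable {d : ℕ}

theorem Vec.enorm_sq_eq (v : Vec d) : ‖v‖ₑ ^ 2 = ∑ i, ‖v i‖ₑ ^ 2 := by
  rw [← ofReal_norm_sq, EuclideanSpace.norm_sq_eq,
    ENNReal.ofReal_sum_of_nonneg fun i _ => by positivity]
  simp only [ofReal_norm_sq]

theorem enorm_apply_le_enorm {ι : Type*} [Fintype ι] (v : EuclideanSpace ℝ ι) (i : ι) :
    ‖v i‖ₑ ≤ ‖v‖ₑ := by
  rw [← ofReal_norm, ← ofReal_norm]
  exact ENNReal.ofReal_le_ofReal (PiLp.norm_apply_le v i)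

theorem lintegral_comp_affine {F : Vec d → ℝ≥0∞} (hF : Measurable F) (a : Vec d) {s : ℝ}
    (hs : s ≠ 0) :
    ∫⁻ x, F (a + s • x) = ENNReal.ofReal |(s ^ d)⁻¹| * ∫⁻ x, F x := by
  have h1 : ∫⁻ x, F (a + s • x) =
      ∫⁻ x, F (a + x) ∂(Measure.map (s • ·) (volume : Measure (Vec d))) :=
    (lintegral_map (hF.comp (measurable_const_add a)) (measurable_const_smul s)).symm
  rw [h1, Measure.map_addHaar_smul _ hs, lintegral_smul_measure, lintegral_add_left_eq_self]
  simp

theorem setLIntegral_comp_affine {F : Vec d → ℝ≥0∞} (hF : Measurable F) (a : Vec d) {s : ℝ}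
    (hs : s ≠ 0) {S T : Set (Vec d)} (hS : MeasurableSet S) (hT : MeasurableSet T)
    (h : ∀ x, x ∈ S ↔ a + s • x ∈ T) :
    ∫⁻ x in S, F (a + s • x) = ENNReal.ofReal |(s ^ d)⁻¹| * ∫⁻ x in T, F x := by
  rw [← lintegral_indicator hS, ← lintegral_indicator hT,
    ← lintegral_comp_affine (hF.indicator hT) a hs]
  refine lintegral_congr fun x => ?_
  by_cases hx : x ∈ S
  · rw [Set.indicator_of_mem hx, Set.indicator_of_mem ((h x).1 hx)]
  · rw [Set.indicator_of_notMem hx, Set.indicator_of_notMem (mt (h x).2 hx)]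

theorem setLIntegral_comp_affine_le {F : Vec d → ℝ≥0∞} (hF : Measurable F) (a : Vec d) {s : ℝ}
    (hs : s ≠ 0) {S T : Set (Vec d)} (hS : MeasurableSet S) (hT : MeasurableSet T)
    (h : ∀ x ∈ S, a + s • x ∈ T) :
    ∫⁻ x in S, F (a + s • x) ≤ ENNReal.ofReal |(s ^ d)⁻¹| * ∫⁻ x in T, F x := by
  rw [← lintegral_indicator hS, ← lintegral_indicator hT,
    ← lintegral_comp_affine (hF.indicator hT) a hs]
  refine lintegral_mono fun x => ?_
  by_cases hx : x ∈ S
  · rw [Set.indicator_of_mem hx, Set.indicator_of_mem (h x hx)]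
  · rw [Set.indicator_of_notMem hx]; exact zero_le

/-- The longitudinal difference of a field between two points. -/
def longDiff (u : Vec d → Vec d) (x y : Vec d) : ℝ := inner ℝ (u x - u y) (x - y)

theorem continuous_longDiff {u : Vec d → Vec d} (hu : Continuous u) :
    Continuous (fun p : Vec d × Vec d => longDiff u p.1 p.2) := by
  unfold longDiff; fun_prop

/-- The longitudinal difference only sees the strain along the segment. -/
theorem enorm_longDiff_sq_le {u : Vec d → Vec d} (hu : ContDiff ℝ ∞ u) (x y : Vec d) :
    ‖longDiff u x y‖ₑ ^ 2
      ≤ ‖x - y‖ₑ ^ 4 * ∫⁻ s in Set.Ioc (0 : ℝ) 1, ‖strain u (y + s • (x - y))‖ₑ ^ 2 := by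
  have hpath : ∀ s : ℝ, HasDerivAt (fun s : ℝ => inner ℝ (u (y + s • (x - y))) (x - y))
      (inner ℝ (fderiv ℝ u (y + s • (x - y)) (x - y)) (x - y)) s := by
    intro s
    have h1 : HasDerivAt (fun s : ℝ => y + s • (x - y)) (x - y) s := by
      simpa using ((hasDerivAt_id s).smul_const (x - y)).const_add y
    have h2 := (hu.differentiable (by simp) (y + s • (x - y))).hasFDerivAt.comp_hasDerivAt s h1
    simpa using h2.inner ℝ (hasDerivAt_const s (x - y))
  have hcont : Continuous fun s : ℝ =>
      (inner ℝ (fderiv ℝ u (y + s • (x - y)) (x - y)) (x - y) : ℝ) := by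
    have hc : Continuous fun s : ℝ => fderiv ℝ u (y + s • (x - y)) :=
      (hu.continuous_fderiv (by simp)).comp (by fun_prop)
    exact (hc.clm_apply continuous_const).inner continuous_const
  have hcE : Continuous fun s : ℝ => strain u (y + s • (x - y)) :=
    (continuous_strain hu).comp (by fun_prop)
  have ftc : longDiff u x y
      = ∫ s in Set.Ioc (0 : ℝ) 1, inner ℝ (fderiv ℝ u (y + s • (x - y)) (x - y)) (x - y) := by
    rw [← intervalIntegral.integral_of_le zero_le_one,
      intervalIntegral.integral_eq_sub_of_hasDerivAt (fun s _ => hpath s)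
        (hcont.intervalIntegrable _ _)]
    simp [longDiff, inner_sub_left]
  have hle : ‖longDiff u x y‖ₑ
      ≤ ‖x - y‖ₑ ^ 2 * ∫⁻ s in Set.Ioc (0 : ℝ) 1, ‖strain u (y + s • (x - y))‖ₑ := by
    rw [ftc, ← lintegral_const_mul _ hcE.enorm.measurable]
    refine (enorm_integral_le_lintegral_enorm _).trans (lintegral_mono fun s => ?_)
    have := ENNReal.ofReal_le_ofReal (abs_inner_fderiv_le u (y + s • (x - y)) (x - y))
    rw [ENNReal.ofReal_mul (norm_nonneg _), ofReal_norm, ofReal_norm_sq, mul_comm] at this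
    rwa [← ofReal_norm]
  calc ‖longDiff u x y‖ₑ ^ 2
      ≤ (‖x - y‖ₑ ^ 2 * ∫⁻ s in Set.Ioc (0 : ℝ) 1, ‖strain u (y + s • (x - y))‖ₑ) ^ 2 :=
        pow_le_pow_left' hle 2
    _ ≤ _ := by
        rw [mul_pow, ← pow_mul]
        refine mul_le_mul_right ?_ _
        refine (lintegral_sq_le hcE.enorm.measurable.aemeasurable).trans (le_of_eq ?_)
        simp

/-- On the unit ball the longitudinal differences are controlled in `L²` by the strain: this
averages `enorm_longDiff_sq_le` over all pairs of points. -/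
theorem lintegral_longDiff_sq_le {u : Vec d → Vec d} (hu : ContDiff ℝ ∞ u) :
    ∫⁻ x in Metric.ball (0 : Vec d) 1, ∫⁻ y in Metric.ball (0 : Vec d) 1, ‖longDiff u x y‖ₑ ^ 2
      ≤ 16 * 2 ^ d * volume (Metric.ball (0 : Vec d) 1)
          * ∫⁻ z in Metric.ball (0 : Vec d) 1, ‖strain u z‖ₑ ^ 2 := by
  set B := Metric.ball (0 : Vec d) 1 with hB
  set F : Vec d → ℝ≥0∞ := fun z => ‖strain u z‖ₑ ^ 2 with hF
  have hBm : MeasurableSet B := Metric.isOpen_ball.measurableSet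
  have hFc : Continuous F := (ENNReal.continuous_pow 2).comp (continuous_strain hu).enorm
  have hconv : Convex ℝ B := convex_ball _ _
  have hmeas : Measurable (fun p : (Vec d × Vec d) × ℝ => F (p.1.2 + p.2 • (p.1.1 - p.1.2))) :=
    (hFc.comp (by fun_prop)).measurable
  -- for each parameter, one of the two endpoints can be used as the integration variable
  have slice : ∀ s ∈ Set.Ioc (0 : ℝ) 1,
      ∫⁻ x in B, ∫⁻ y in B, F (y + s • (x - y)) ≤ 2 ^ d * volume B * ∫⁻ z in B, F z := by
    intro s hs
    have hfac : ∀ r : ℝ, 1 / 2 ≤ r → ENNReal.ofReal |(r ^ d)⁻¹| ≤ 2 ^ d := by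
      intro r hr
      have hr0 : 0 < r := by linarith
      rw [abs_of_pos (by positivity), ← inv_pow, ENNReal.ofReal_pow (by positivity)]
      refine pow_le_pow_left' ?_ d
      rw [show (2 : ℝ≥0∞) = ENNReal.ofReal 2 by simp]
      refine ENNReal.ofReal_le_ofReal ?_
      rw [inv_le_comm₀ hr0 (by norm_num)]
      linarith
    rcases le_total s (1 / 2) with h | h
    · have : ∀ x ∈ B, ∫⁻ y in B, F (y + s • (x - y)) ≤ 2 ^ d * ∫⁻ z in B, F z := by
        intro x hx
        have e : ∀ y, y + s • (x - y) = s • x + (1 - s) • y := fun y => by module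
        simp only [e]
        refine (setLIntegral_comp_affine_le hFc.measurable (s • x) (by linarith) hBm hBm
          fun y hy => hconv hx hy hs.1.le (by linarith) (by ring)).trans ?_
        exact mul_le_mul_left (hfac _ (by linarith)) _
      refine (setLIntegral_mono' hBm this).trans (le_of_eq ?_)
      rw [setLIntegral_const]; ring
    · rw [lintegral_lintegral_swap (by
        refine Measurable.aemeasurable ?_
        exact (hFc.comp (by fun_prop :
          Continuous fun p : Vec d × Vec d => p.2 + s • (p.1 - p.2))).measurable)]
      have : ∀ y ∈ B, ∫⁻ x in B, F (y + s • (x - y)) ≤ 2 ^ d * ∫⁻ z in B, F z := by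
        intro y hy
        have e : ∀ x, y + s • (x - y) = (1 - s) • y + s • x := fun x => by module
        simp only [e]
        refine (setLIntegral_comp_affine_le hFc.measurable ((1 - s) • y) (by linarith) hBm hBm
          fun x hx => hconv hy hx (by linarith [hs.2]) hs.1.le (by ring)).trans ?_
        exact mul_le_mul_left (hfac _ h) _
      refine (setLIntegral_mono' hBm this).trans (le_of_eq ?_)
      rw [setLIntegral_const]; ring
  have hpt : ∀ x ∈ B, ∀ y ∈ B, ‖longDiff u x y‖ₑ ^ 2
      ≤ 16 * ∫⁻ s in Set.Ioc (0 : ℝ) 1, F (y + s • (x - y)) := by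
    intro x hx y hy
    refine (enorm_longDiff_sq_le hu x y).trans (mul_le_mul_left ?_ _)
    have h2 : ‖x - y‖ₑ ≤ 2 := by
      rw [← ofReal_norm]
      refine (ENNReal.ofReal_le_ofReal (q := 2) ((norm_sub_le _ _).trans ?_)).trans (by simp)
      have h1 := mem_ball_zero_iff.1 hx
      have h2 := mem_ball_zero_iff.1 hy
      linarith
    refine (pow_le_pow_left' h2 4).trans (by norm_num)
  calc ∫⁻ x in B, ∫⁻ y in B, ‖longDiff u x y‖ₑ ^ 2
      ≤ ∫⁻ x in B, ∫⁻ y in B, 16 * ∫⁻ s in Set.Ioc (0 : ℝ) 1, F (y + s • (x - y)) :=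
        setLIntegral_mono' hBm fun x hx => setLIntegral_mono' hBm fun y hy => hpt x hx y hy
    _ = 16 * ∫⁻ s in Set.Ioc (0 : ℝ) 1, ∫⁻ x in B, ∫⁻ y in B, F (y + s • (x - y)) := by
        rw [lintegral_const_mul_three hmeas, lintegral_rotate hmeas]
    _ ≤ 16 * ∫⁻ s in Set.Ioc (0 : ℝ) 1, 2 ^ d * volume B * ∫⁻ z in B, F z :=
        mul_le_mul_right (setLIntegral_mono' measurableSet_Ioc slice) _
    _ = _ := by
        rw [setLIntegral_const]
        simp
        ring

end Ball

section Representation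

variable {d : ℕ}

theorem integral_mul_fderiv_of_hasCompactSupport {f χ : Vec d → ℝ} (hf : ContDiff ℝ ∞ f)
    (hχ : ContDiff ℝ ∞ χ) (hχc : HasCompactSupport χ) (v : Vec d) :
    ∫ y, f y * fderiv ℝ χ y v = - ∫ y, fderiv ℝ f y v * χ y := by
  have c1 : Continuous fun y => fderiv ℝ f y v :=
    (hf.continuous_fderiv (by simp)).clm_apply continuous_const
  have c2 : Continuous fun y => fderiv ℝ χ y v :=
    (hχ.continuous_fderiv (by simp)).clm_apply continuous_const
  exact integral_mul_fderiv_eq_neg_fderiv_mul_of_integrable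
    ((c1.mul hχ.continuous).integrable_of_hasCompactSupport hχc.mul_left)
    ((hf.continuous.mul c2).integrable_of_hasCompactSupport (hχc.fderiv_apply (𝕜 := ℝ) v).mul_left)
    ((hf.continuous.mul hχ.continuous).integrable_of_hasCompactSupport hχc.mul_left)
    (fun x _ => hf.differentiable (by simp) x) (fun x _ => hχ.differentiable (by simp) x)

/-- Testing the longitudinal difference with the derivative of a bump function `χ` of integral
one recovers the field up to an affine map, whose linear part is the average of the gradient. -/
theorem integral_longDiff_mul_fderiv {u : Vec d → Vec d} (hu : ContDiff ℝ ∞ u) {χ : Vec d → ℝ}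
    (hχ : ContDiff ℝ ∞ χ) (hχc : HasCompactSupport χ) (hχ1 : ∫ y, χ y = 1) (x : Vec d)
    (k : Fin d) :
    ∫ y, longDiff u x y * fderiv ℝ χ y (EuclideanSpace.single k 1)
      = u x k + ∑ l, x l * (∫ y, classicalGrad u y (l, k) * χ y)
        + ∑ l, ∫ y, (u y l * y l) * fderiv ℝ χ y (EuclideanSpace.single k 1) := by
  have wt : ∀ {f : Vec d → ℝ}, ContDiff ℝ ∞ f →
      Integrable fun y => f y * fderiv ℝ χ y (EuclideanSpace.single k 1) := fun {f} hf =>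
    (hf.continuous.mul ((hχ.continuous_fderiv (by simp)).clm_apply
      continuous_const)).integrable_of_hasCompactSupport (hχc.fderiv_apply (𝕜 := ℝ) _).mul_left
  have hcoord : ∀ l : Fin d, ContDiff ℝ ∞ fun y : Vec d => y l := fun l =>
    (EuclideanSpace.proj l : Vec d →L[ℝ] ℝ).contDiff
  have ul : ∀ l, ContDiff ℝ ∞ fun y => u y l := contDiff_coord hu
  -- the three moments of `∂_k χ`
  have m0 : ∫ y, fderiv ℝ χ y (EuclideanSpace.single k 1) = 0 := by
    have := integral_mul_fderiv_of_hasCompactSupport (contDiff_const (c := (1 : ℝ))) hχ hχc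
      (EuclideanSpace.single k 1)
    simpa using this
  have m1 : ∀ l : Fin d, ∫ y : Vec d, y l * fderiv ℝ χ y (EuclideanSpace.single k 1)
      = - if l = k then 1 else 0 := by
    intro l
    rw [integral_mul_fderiv_of_hasCompactSupport (hcoord l) hχ hχc]
    have : ∀ y : Vec d, fderiv ℝ (fun y : Vec d => y l) y (EuclideanSpace.single k 1)
        = if l = k then 1 else 0 := by
      intro y
      have h : HasFDerivAt (fun y : Vec d => y l) (EuclideanSpace.proj l : Vec d →L[ℝ] ℝ) y :=
        (EuclideanSpace.proj l : Vec d →L[ℝ] ℝ).hasFDerivAt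
      rw [h.fderiv]
      simp
    simp only [this]
    rw [integral_const_mul, hχ1, mul_one]
  have m2 : ∀ l : Fin d, ∫ y, u y l * fderiv ℝ χ y (EuclideanSpace.single k 1)
      = - ∫ y, classicalGrad u y (l, k) * χ y := by
    intro l
    rw [integral_mul_fderiv_of_hasCompactSupport (ul l) hχ hχc]
    simp only [fderiv_coord hu, ← classicalGrad_apply]
  have expand : ∀ y, longDiff u x y * fderiv ℝ χ y (EuclideanSpace.single k 1)
      = ∑ l, ((u x l * x l) * (1 * fderiv ℝ χ y (EuclideanSpace.single k 1))
          - u x l * (y l * fderiv ℝ χ y (EuclideanSpace.single k 1))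
          - x l * (u y l * fderiv ℝ χ y (EuclideanSpace.single k 1))
          + (u y l * y l) * fderiv ℝ χ y (EuclideanSpace.single k 1)) := by
    intro y
    rw [longDiff, PiLp.inner_apply, Finset.sum_mul]
    exact Finset.sum_congr rfl fun l _ => by simp; ring
  have i0 := wt (contDiff_const (c := (1 : ℝ)))
  simp only [expand]
  obtain ⟨δ, hδ⟩ : ∃ δ : Vec d → ℝ, ∀ y, fderiv ℝ χ y (EuclideanSpace.single k 1) = δ y :=
    ⟨_, fun _ => rfl⟩
  simp only [hδ] at wt m0 m1 m2 i0 ⊢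
  have j1 : ∀ l : Fin d, Integrable fun y : Vec d =>
      (u x l * x l) * (1 * δ y) - u x l * (y l * δ y) := fun l =>
    (i0.const_mul _).sub ((wt (hcoord l)).const_mul _)
  have j2 : ∀ l : Fin d, Integrable fun y : Vec d =>
      (u x l * x l) * (1 * δ y) - u x l * (y l * δ y) - x l * (u y l * δ y) := fun l =>
    (j1 l).sub ((wt (ul l)).const_mul _)
  have j3 : ∀ l : Fin d, Integrable fun y : Vec d => (u y l * y l) * δ y := fun l =>
    wt ((ul l).mul (hcoord l))
  have j4 : ∀ l : Fin d, Integrable fun y : Vec d => (u x l * x l) * (1 * δ y)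
      - u x l * (y l * δ y) - x l * (u y l * δ y) + (u y l * y l) * δ y := fun l =>
    (j2 l).add (j3 l)
  rw [integral_finsetSum _ fun l _ => j4 l]
  have each : ∀ l : Fin d, ∫ y, ((u x l * x l) * (1 * δ y)
          - u x l * (y l * δ y)
          - x l * (u y l * δ y)
          + (u y l * y l) * δ y)
      = (if l = k then u x l else 0) + x l * (∫ y, classicalGrad u y (l, k) * χ y)
        + ∫ y, (u y l * y l) * δ y := by
    intro l
    rw [integral_add (j2 l) (j3 l), integral_sub (j1 l) ((wt (ul l)).const_mul _),
      integral_sub (i0.const_mul _) ((wt (hcoord l)).const_mul _), integral_const_mul,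
      integral_const_mul,
      integral_const_mul, integral_const_mul, m1, m2]
    simp only [one_mul, m0]
    split_ifs <;> ring
  simp only [each, Finset.sum_add_distrib]
  simp

/-- A bounded weight supported in a set of finite measure. -/
theorem enorm_integral_mul_sq_le {f wt : Vec d → ℝ} (hf : Continuous f) (B : Set (Vec d))
    (hB : MeasurableSet B) {κ : ℝ≥0∞} (hκ : ∀ y, ‖wt y‖ₑ ≤ κ) (hwt : ∀ y ∉ B, wt y = 0) :
    ‖∫ y, f y * wt y‖ₑ ^ 2 ≤ κ ^ 2 * volume B * ∫⁻ y in B, ‖f y‖ₑ ^ 2 := by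
  have h1 : ‖∫ y, f y * wt y‖ₑ ≤ κ * ∫⁻ y in B, ‖f y‖ₑ := by
    refine (enorm_integral_le_lintegral_enorm _).trans ?_
    rw [← lintegral_const_mul _ hf.enorm.measurable, ← lintegral_indicator hB]
    refine lintegral_mono fun y => ?_
    by_cases hy : y ∈ B
    · rw [Set.indicator_of_mem hy, enorm_mul, mul_comm]
      exact mul_le_mul_left (hκ y) _
    · rw [hwt y hy]; simp
  calc ‖∫ y, f y * wt y‖ₑ ^ 2 ≤ (κ * ∫⁻ y in B, ‖f y‖ₑ) ^ 2 := pow_le_pow_left' h1 2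
    _ ≤ κ ^ 2 * (volume B * ∫⁻ y in B, ‖f y‖ₑ ^ 2) := by
        rw [mul_pow]
        refine mul_le_mul_right ((lintegral_sq_le hf.enorm.measurable.aemeasurable).trans
          (le_of_eq ?_)) _
        simp
    _ = _ := by ring

/-- On the unit ball every field is close in `L²` to a rigid displacement. -/
theorem exists_rigid_lintegral_sub_le (d : ℕ) : ∃ C : ℝ≥0∞, C ≠ ⊤ ∧
    ∀ u : Vec d → Vec d, ContDiff ℝ ∞ u → ∃ (A : Mat d) (b : Vec d), IsSkew A ∧
      ∫⁻ x in Metric.ball (0 : Vec d) 1, ‖u x - rigid A b x‖ₑ ^ 2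
        ≤ C * ∫⁻ x in Metric.ball (0 : Vec d) 1, ‖strain u x‖ₑ ^ 2 := by
  set B := Metric.ball (0 : Vec d) 1 with hB
  have hBm : MeasurableSet B := Metric.isOpen_ball.measurableSet
  -- `χ` is a bump function of integral one; `N` and `S` below are the averages of the gradient and
  -- of the strain against `χ`, and the rigid displacement has the skew part of `N` as linear part
  let bump : ContDiffBump (0 : Vec d) := ⟨1 / 4, 1 / 2, by norm_num, by norm_num⟩
  set χ : Vec d → ℝ := bump.normed volume with hχdef
  have hχ : ContDiff ℝ ∞ χ := bump.contDiff_normed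
  have hχc : HasCompactSupport χ := bump.hasCompactSupport_normed
  have hχ1 : ∫ y, χ y = 1 := bump.integral_normed
  have hts : tsupport χ ⊆ B := by
    rw [hχdef, bump.tsupport_normed_eq]
    exact Metric.closedBall_subset_ball (by norm_num [bump])
  obtain ⟨κ₀, hκ₀⟩ := hχc.exists_bound_of_continuous hχ.continuous
  obtain ⟨κ₁, hκ₁⟩ := (hχc.fderiv (𝕜 := ℝ)).exists_bound_of_continuous
    (hχ.continuous_fderiv (by simp))
  set κ : ℝ≥0∞ := ENNReal.ofReal (max κ₀ κ₁) with hκ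
  have b0 : ∀ y, ‖χ y‖ₑ ≤ κ := fun y => by
    rw [← ofReal_norm]
    exact ENNReal.ofReal_le_ofReal ((hκ₀ y).trans (le_max_left _ _))
  have b1 : ∀ (k : Fin d) y, ‖fderiv ℝ χ y (EuclideanSpace.single k 1)‖ₑ ≤ κ := fun k y => by
    rw [← ofReal_norm]
    refine ENNReal.ofReal_le_ofReal (((fderiv ℝ χ y).le_opNorm _).trans ?_)
    simpa using Or.inr (hκ₁ y)
  have z0 : ∀ y ∉ B, χ y = 0 := fun y hy => image_eq_zero_of_notMem_tsupport (mt (@hts y) hy)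
  have z1 : ∀ (k : Fin d), ∀ y ∉ B, fderiv ℝ χ y (EuclideanSpace.single k 1) = 0 :=
    fun k y hy => by
      have : fderiv ℝ χ y = 0 := image_eq_zero_of_notMem_tsupport
        (fun h => hy (hts (tsupport_fderiv_subset ℝ h)))
      rw [this]; rfl
  have hvB : volume B ≠ ⊤ := measure_ball_lt_top.ne
  set P : ℝ≥0∞ := κ ^ 2 * volume B with hP
  have hPt : P ≠ ⊤ := ENNReal.mul_ne_top (by simp [hκ]) hvB
  refine ⟨d * (2 * (P * (16 * 2 ^ d * volume B)) + 2 * (d * (d * P) * volume B)), ?_, ?_⟩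
  · have : (16 * 2 ^ d * volume B : ℝ≥0∞) ≠ ⊤ :=
      ENNReal.mul_ne_top (ENNReal.mul_ne_top (by simp) (by simp)) hvB
    refine ENNReal.mul_ne_top (by simp) (ENNReal.add_ne_top.2 ⟨?_, ?_⟩)
    · exact ENNReal.mul_ne_top (by simp) (ENNReal.mul_ne_top hPt this)
    · exact ENNReal.mul_ne_top (by simp) (ENNReal.mul_ne_top (ENNReal.mul_ne_top (by simp)
        (ENNReal.mul_ne_top (by simp) hPt)) hvB)
  intro u hu
  set N : Fin d → Fin d → ℝ := fun l k => ∫ y, classicalGrad u y (l, k) * χ y with hN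
  set S : Fin d → Fin d → ℝ := fun l k => ∫ y, strain u y (l, k) * χ y with hS
  have iN : ∀ l k, Integrable fun y => classicalGrad u y (l, k) * χ y := fun l k =>
    ((continuous_classicalGrad_coord hu l k).mul hχ.continuous).integrable_of_hasCompactSupport
      hχc.mul_left
  have hSN : ∀ l k, S l k = (N l k + N k l) / 2 := by
    intro l k
    simp only [hS, hN]
    rw [← integral_add (iN l k) (iN k l), ← integral_div]
    exact integral_congr_ae (ae_of_all _ fun y => by simp only [strain_apply]; ring)
  set A : Mat d := WithLp.toLp 2 fun kl : Fin d × Fin d => (N kl.1 kl.2 - N kl.2 kl.1) / 2 with hA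
  set b : Vec d := WithLp.toLp 2 fun k =>
    - ∑ l, ∫ y, (u y l * y l) * fderiv ℝ χ y (EuclideanSpace.single k 1) with hb
  have hAapp : ∀ k l, A (k, l) = (N k l - N l k) / 2 := fun k l => rfl
  have hEc : Continuous (strain u) := continuous_strain hu
  refine ⟨A, b, fun i j => by rw [hAapp, hAapp]; ring, ?_⟩
  set IE := ∫⁻ x in B, ‖strain u x‖ₑ ^ 2 with hIE
  -- the distance to the rigid displacement involves only longitudinal differences and the strain
  have rep : ∀ x k, (u x - rigid A b x) k
      = (∫ y, longDiff u x y * fderiv ℝ χ y (EuclideanSpace.single k 1)) - ∑ l, x l * S l k := by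
    intro x k
    rw [integral_longDiff_mul_fderiv hu hχ hχc hχ1 x k, PiLp.sub_apply, rigid_apply]
    have : b k = - ∑ l, ∫ y, (u y l * y l) * fderiv ℝ χ y (EuclideanSpace.single k 1) := rfl
    rw [this]
    have h2 : ∑ l, x l * S l k = ∑ l, x l * N l k + ∑ l, A (k, l) * x l := by
      rw [← Finset.sum_add_distrib]
      exact Finset.sum_congr rfl fun l _ => by rw [hSN, hAapp]; ring
    rw [h2]
    ring
  have hSb : ∀ l k, ‖S l k‖ₑ ^ 2 ≤ P * IE := by
    intro l k
    refine (enorm_integral_mul_sq_le ((EuclideanSpace.proj (l, k) :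
      Mat d →L[ℝ] ℝ).continuous.comp hEc) B hBm b0 z0).trans ?_
    refine mul_le_mul_right (lintegral_mono fun y => ?_) _
    exact pow_le_pow_left' (enorm_apply_le_enorm _ _) 2
  have hpt : ∀ x ∈ B, ‖u x - rigid A b x‖ₑ ^ 2
      ≤ d * (2 * (P * ∫⁻ y in B, ‖longDiff u x y‖ₑ ^ 2) + 2 * (d * (d * P) * IE)) := by
    intro x hx
    rw [Vec.enorm_sq_eq]
    refine (Finset.sum_le_card_nsmul _ _ _ fun k _ => ?_).trans (le_of_eq (by
      rw [Finset.card_univ, Fintype.card_fin, nsmul_eq_mul]))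
    rw [rep]
    refine (enorm_sub_sq_le _ _).trans (add_le_add (mul_le_mul_right ?_ _)
      (mul_le_mul_right ?_ _))
    · exact enorm_integral_mul_sq_le ((continuous_longDiff hu.continuous).comp
        (Continuous.prodMk_right x)) B hBm (b1 k) (z1 k)
    · have h1 : ‖∑ l, x l * S l k‖ₑ ≤ ∑ l, ‖S l k‖ₑ := by
        refine (enorm_sum_le _ _).trans (Finset.sum_le_sum fun l _ => ?_)
        rw [enorm_mul]
        refine mul_le_of_le_one_left zero_le ?_
        refine (enorm_apply_le_enorm x l).trans ?_
        rw [← ofReal_norm]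
        exact ENNReal.ofReal_le_one.2 (mem_ball_zero_iff.1 hx).le
      calc ‖∑ l, x l * S l k‖ₑ ^ 2 ≤ (∑ l, ‖S l k‖ₑ) ^ 2 := pow_le_pow_left' h1 2
        _ ≤ d * ∑ l, ‖S l k‖ₑ ^ 2 := by
            simpa [lintegral_count, tsum_fintype] using
              lintegral_sq_le (μ := Measure.count) (f := fun l => ‖S l k‖ₑ) (by fun_prop)
        _ ≤ d * (d * (P * IE)) := by
            refine mul_le_mul_right ((Finset.sum_le_card_nsmul _ _ _ fun l _ => hSb l k).trans
              (le_of_eq (by rw [Finset.card_univ, Fintype.card_fin, nsmul_eq_mul]))) _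
        _ = d * (d * P) * IE := by ring
  have hmeas : Measurable fun x => ∫⁻ y in B, ‖longDiff u x y‖ₑ ^ 2 :=
    (((ENNReal.continuous_pow 2).comp
      (continuous_longDiff hu.continuous).enorm).measurable).lintegral_prod_right'
      (ν := volume.restrict B)
  calc ∫⁻ x in B, ‖u x - rigid A b x‖ₑ ^ 2
      ≤ ∫⁻ x in B, d * (2 * (P * ∫⁻ y in B, ‖longDiff u x y‖ₑ ^ 2) + 2 * (d * (d * P) * IE)) :=
        setLIntegral_mono' hBm hpt
    _ = d * (2 * (P * ∫⁻ x in B, ∫⁻ y in B, ‖longDiff u x y‖ₑ ^ 2)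
          + 2 * (d * (d * P) * IE) * volume B) := by
        rw [lintegral_const_mul _ (by fun_prop), lintegral_add_right _ measurable_const,
          lintegral_const_mul _ (by fun_prop), lintegral_const_mul _ hmeas, setLIntegral_const]
    _ ≤ d * (2 * (P * (16 * 2 ^ d * volume B * IE)) + 2 * (d * (d * P) * IE) * volume B) := by
        gcongr
        exact lintegral_longDiff_sq_le hu
    _ = _ := by ring

end Representation

section BallKorn

variable {d : ℕ}

theorem classicalGrad_smul {η : Vec d → ℝ} {ψ : Vec d → Vec d} (hη : ContDiff ℝ ∞ η)
    (hψ : ContDiff ℝ ∞ ψ) (x : Vec d) (i j : Fin d) :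
    classicalGrad (fun x => η x • ψ x) x (i, j)
      = η x * classicalGrad ψ x (i, j) + ψ x i * fderiv ℝ η x (EuclideanSpace.single j 1) := by
  rw [classicalGrad_apply, fderiv_fun_smul (hη.differentiable (by simp) x)
    (hψ.differentiable (by simp) x)]
  simp [classicalGrad_apply, mul_comm]

/-- The strain of a field multiplied by a cut-off function `η` with `|∇η| ≤ κ`. -/
theorem enorm_strain_smul_sq_le {η : Vec d → ℝ} {ψ : Vec d → Vec d} (hη : ContDiff ℝ ∞ η)
    (hψ : ContDiff ℝ ∞ ψ) {κ : ℝ} (hκ : ∀ x, ‖fderiv ℝ η x‖ ≤ κ) (hη1 : ∀ x, |η x| ≤ 1)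
    (x : Vec d) :
    ‖strain (fun x => η x • ψ x) x‖ₑ ^ 2
      ≤ 2 * ‖strain ψ x‖ₑ ^ 2 + 2 * (ENNReal.ofReal (d * κ ^ 2) * ‖ψ x‖ₑ ^ 2) := by
  set P : Mat d := WithLp.toLp 2 fun ij : Fin d × Fin d =>
    ψ x ij.1 * fderiv ℝ η x (EuclideanSpace.single ij.2 1) with hP
  have hPa : ∀ i j, P (i, j) = ψ x i * fderiv ℝ η x (EuclideanSpace.single j 1) :=
    fun _ _ => rfl
  have hdec : strain (fun x => η x • ψ x) x = η x • strain ψ x + symPart P := by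
    ext ij
    obtain ⟨i, j⟩ := ij
    rw [strain_apply, classicalGrad_smul hη hψ, classicalGrad_smul hη hψ, PiLp.add_apply,
      PiLp.smul_apply, strain_apply, symPart_apply, hPa, hPa, smul_eq_mul]
    ring
  have hPn : ‖P‖ ^ 2 ≤ (d * κ ^ 2) * ‖ψ x‖ ^ 2 := by
    rw [Mat.norm_sq_eq, Vec.norm_sq_eq, Finset.mul_sum]
    refine Finset.sum_le_sum fun i _ => ?_
    have : ∀ j ∈ (Finset.univ : Finset (Fin d)), P (i, j) ^ 2 ≤ κ ^ 2 * ψ x i ^ 2 := by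
      intro j _
      rw [hPa, mul_pow, mul_comm]
      refine mul_le_mul_of_nonneg_right ?_ (sq_nonneg _)
      have h1 : |fderiv ℝ η x (EuclideanSpace.single j 1)| ≤ κ := by
        have := ((fderiv ℝ η x).le_opNorm (EuclideanSpace.single j 1))
        simp only [PiLp.norm_single, norm_one, mul_one, Real.norm_eq_abs] at this
        exact this.trans (hκ x)
      exact sq_le_sq' (abs_le.1 h1).1 (abs_le.1 h1).2
    refine (Finset.sum_le_card_nsmul _ _ _ this).trans (le_of_eq ?_)
    rw [Finset.card_univ, Fintype.card_fin, nsmul_eq_mul]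
    ring
  rw [hdec]
  refine (enorm_add_sq_le _ _).trans (add_le_add (mul_le_mul_right ?_ _) (mul_le_mul_right ?_ _))
  · rw [enorm_smul]
    refine pow_le_pow_left' (mul_le_of_le_one_left zero_le ?_) 2
    rw [← ofReal_norm]
    exact ENNReal.ofReal_le_one.2 (hη1 x)
  · refine enorm_sq_le_of_norm_sq_le (by positivity) (le_trans ?_ hPn)
    exact pow_le_pow_left₀ (norm_nonneg _) (norm_symPart_le P) 2

/-- Interior form of Korn's inequality: a cut-off reduces it to compactly supported fields. -/
theorem exists_lintegral_classicalGrad_halfBall_le (d : ℕ) : ∃ C : ℝ≥0∞, C ≠ ⊤ ∧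
    ∀ ψ : Vec d → Vec d, ContDiff ℝ ∞ ψ →
      ∫⁻ x in Metric.ball (0 : Vec d) (1 / 2), ‖classicalGrad ψ x‖ₑ ^ 2
        ≤ C * ((∫⁻ x in Metric.ball (0 : Vec d) 1, ‖strain ψ x‖ₑ ^ 2)
            + ∫⁻ x in Metric.ball (0 : Vec d) 1, ‖ψ x‖ₑ ^ 2) := by
  let η : ContDiffBump (0 : Vec d) := ⟨1 / 2, 3 / 4, by norm_num, by norm_num⟩
  have hη : ContDiff ℝ ∞ η := η.contDiff
  have hηc : HasCompactSupport η := η.hasCompactSupport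
  have hη1 : ∀ x, |η x| ≤ 1 := fun x => by rw [abs_of_nonneg η.nonneg]; exact η.le_one
  have hts : tsupport η ⊆ Metric.ball (0 : Vec d) 1 := by
    rw [η.tsupport_eq]
    exact Metric.closedBall_subset_ball (by norm_num [η])
  obtain ⟨κ, hκ⟩ := (hηc.fderiv (𝕜 := ℝ)).exists_bound_of_continuous
    (hη.continuous_fderiv (by simp))
  set c : ℝ≥0∞ := ENNReal.ofReal (d * κ ^ 2) with hc
  refine ⟨4 * (1 + c), ENNReal.mul_ne_top (by simp)
    (ENNReal.add_ne_top.2 ⟨by simp, ENNReal.ofReal_ne_top⟩), ?_⟩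
  intro ψ hψ
  have hprod : ContDiff ℝ ∞ fun x => η x • ψ x := hη.smul hψ
  have hprodc : HasCompactSupport fun x => η x • ψ x := hηc.smul_right
  have hsupp : ∀ x ∉ Metric.ball (0 : Vec d) 1, strain (fun x => η x • ψ x) x = 0 := by
    intro x hx
    have hx' : x ∉ tsupport η := mt (@hts x) hx
    have e1 : η x = 0 := image_eq_zero_of_notMem_tsupport hx'
    have e2 : fderiv ℝ η x = 0 :=
      image_eq_zero_of_notMem_tsupport fun h => hx' (tsupport_fderiv_subset ℝ h)
    ext ij
    obtain ⟨i, j⟩ := ij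
    rw [strain_apply, classicalGrad_smul hη hψ, classicalGrad_smul hη hψ, e1, e2]
    simp
  have hin : ∀ x ∈ Metric.ball (0 : Vec d) (1 / 2),
      classicalGrad (fun x => η x • ψ x) x = classicalGrad ψ x := by
    intro x hx
    have : (fun x => η x • ψ x) =ᶠ[𝓝 x] ψ := by
      filter_upwards [Metric.isOpen_ball.mem_nhds hx] with y hy
      rw [η.one_of_mem_closedBall (Metric.ball_subset_closedBall hy), one_smul]
    ext ij
    obtain ⟨i, j⟩ := ij
    rw [classicalGrad_apply, classicalGrad_apply, this.fderiv_eq]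
  have mE : Measurable fun x => ‖strain ψ x‖ₑ ^ 2 :=
    (continuous_strain hψ).enorm.measurable.pow_const 2
  have mψ : Measurable fun x => ‖ψ x‖ₑ ^ 2 := hψ.continuous.enorm.measurable.pow_const 2
  calc ∫⁻ x in Metric.ball (0 : Vec d) (1 / 2), ‖classicalGrad ψ x‖ₑ ^ 2
      = ∫⁻ x in Metric.ball (0 : Vec d) (1 / 2), ‖classicalGrad (fun x => η x • ψ x) x‖ₑ ^ 2 :=
        setLIntegral_congr_fun Metric.isOpen_ball.measurableSet fun x hx => by
          simp only [hin x hx]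
    _ ≤ ∫⁻ x, ‖classicalGrad (fun x => η x • ψ x) x‖ₑ ^ 2 := setLIntegral_le_lintegral _ _
    _ ≤ 2 * ∫⁻ x, ‖strain (fun x => η x • ψ x) x‖ₑ ^ 2 :=
        lintegral_classicalGrad_le_strain hprod hprodc
    _ = 2 * ∫⁻ x in Metric.ball (0 : Vec d) 1, ‖strain (fun x => η x • ψ x) x‖ₑ ^ 2 := by
        rw [setLIntegral_eq_of_support_subset]
        intro x hx
        by_contra h
        exact hx (by simp [hsupp x h])
    _ ≤ 2 * ∫⁻ x in Metric.ball (0 : Vec d) 1,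
          (2 * ‖strain ψ x‖ₑ ^ 2 + 2 * (c * ‖ψ x‖ₑ ^ 2)) :=
        mul_le_mul_right (lintegral_mono fun x => enorm_strain_smul_sq_le hη hψ hκ hη1 x) _
    _ = 4 * ((∫⁻ x in Metric.ball (0 : Vec d) 1, ‖strain ψ x‖ₑ ^ 2)
          + c * ∫⁻ x in Metric.ball (0 : Vec d) 1, ‖ψ x‖ₑ ^ 2) := by
        rw [lintegral_add_left (mE.const_mul 2), lintegral_const_mul _ mE,
          lintegral_const_mul _ (mψ.const_mul c), lintegral_const_mul _ mψ]
        ring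
    _ ≤ _ := by
        rw [mul_assoc]
        refine mul_le_mul_right ?_ _
        rw [mul_add]
        refine add_le_add (le_mul_of_one_le_left zero_le le_self_add) ?_
        exact mul_le_mul_left le_add_self _

/-- Korn's inequality on the unit ball, modulo rigid displacements. -/
theorem exists_rigid_unitBall (d : ℕ) : ∃ C : ℝ≥0∞, C ≠ ⊤ ∧
    ∀ u : Vec d → Vec d, ContDiff ℝ ∞ u → ∃ (A : Mat d) (b : Vec d), IsSkew A ∧
      (∫⁻ x in Metric.ball (0 : Vec d) (1 / 2), ‖u x - rigid A b x‖ₑ ^ 2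
        ≤ C * ∫⁻ x in Metric.ball (0 : Vec d) 1, ‖strain u x‖ₑ ^ 2) ∧
      ∫⁻ x in Metric.ball (0 : Vec d) (1 / 2), ‖classicalGrad u x - A‖ₑ ^ 2
        ≤ C * ∫⁻ x in Metric.ball (0 : Vec d) 1, ‖strain u x‖ₑ ^ 2 := by
  obtain ⟨C₁, hC₁, h₁⟩ := exists_rigid_lintegral_sub_le d
  obtain ⟨C₂, hC₂, h₂⟩ := exists_lintegral_classicalGrad_halfBall_le d
  refine ⟨C₁ + C₂ * (1 + C₁), ENNReal.add_ne_top.2 ⟨hC₁, ENNReal.mul_ne_top hC₂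
    (ENNReal.add_ne_top.2 ⟨by simp, hC₁⟩)⟩, fun u hu => ?_⟩
  obtain ⟨A, b, hA, hAb⟩ := h₁ u hu
  refine ⟨A, b, hA, ?_, ?_⟩
  · calc _ ≤ ∫⁻ x in Metric.ball (0 : Vec d) 1, ‖u x - rigid A b x‖ₑ ^ 2 :=
        lintegral_mono_set (Metric.ball_subset_ball (by norm_num))
      _ ≤ _ := hAb.trans (mul_le_mul_left le_self_add _)
  · have h := h₂ (fun x => u x - rigid A b x) (hu.sub (contDiff_rigid A b))
    simp only [classicalGrad_sub hu (contDiff_rigid A b), classicalGrad_rigid,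
      strain_sub_rigid hu hA] at h
    refine h.trans ?_
    calc _ ≤ C₂ * ((∫⁻ x in Metric.ball (0 : Vec d) 1, ‖strain u x‖ₑ ^ 2)
          + C₁ * ∫⁻ x in Metric.ball (0 : Vec d) 1, ‖strain u x‖ₑ ^ 2) := by gcongr
      _ = C₂ * (1 + C₁) * ∫⁻ x in Metric.ball (0 : Vec d) 1, ‖strain u x‖ₑ ^ 2 := by ring
      _ ≤ _ := mul_le_mul_left le_add_self _

theorem classicalGrad_comp_affine {u : Vec d → Vec d} (hu : ContDiff ℝ ∞ u) (a : Vec d) (r : ℝ)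
    (x : Vec d) : classicalGrad (fun z => u (a + r • z)) x = r • classicalGrad u (a + r • x) := by
  have h1 : HasFDerivAt (fun z : Vec d => a + r • z) (r • ContinuousLinearMap.id ℝ (Vec d)) x :=
    ((hasFDerivAt_id x).const_smul r).const_add a
  have h2 := (hu.differentiable (by simp) (a + r • x)).hasFDerivAt.comp x h1
  ext ij
  obtain ⟨i, j⟩ := ij
  rw [classicalGrad_apply, show (fun z => u (a + r • z)) = u ∘ (fun z => a + r • z) from rfl,
    h2.fderiv]
  simp [classicalGrad_apply]

/-- Rescaling of a rigid displacement: the right-hand side in the variable `z`, written in the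
variable `a + r z`. -/
theorem rigid_comp_affine (A : Mat d) (b a : Vec d) {r : ℝ} (hr : r ≠ 0) (z : Vec d) :
    rigid (r⁻¹ • A) (rigid (-(r⁻¹ • A)) b a) (a + r • z) = rigid A b z := by
  ext i
  simp only [rigid_apply, PiLp.add_apply, PiLp.smul_apply, PiLp.neg_apply, smul_eq_mul]
  rw [← add_assoc, ← Finset.sum_add_distrib]
  congr 1
  refine Finset.sum_congr rfl fun j _ => ?_
  field_simp
  ring

/-- Korn's inequality on balls, modulo rigid displacements. The gradient estimate is scale
invariant: its constant depends on the dimension only. -/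
theorem exists_rigid_ball (d : ℕ) : ∃ C : ℝ≥0∞, C ≠ ⊤ ∧
    ∀ u : Vec d → Vec d, ContDiff ℝ ∞ u → ∀ (a : Vec d) (r : ℝ), 0 < r →
      ∃ (A : Mat d) (b : Vec d), IsSkew A ∧
      (∫⁻ x in Metric.ball a (r / 2), ‖u x - rigid A b x‖ₑ ^ 2
        ≤ C * ENNReal.ofReal r ^ 2 * ∫⁻ x in Metric.ball a r, ‖strain u x‖ₑ ^ 2) ∧
      ∫⁻ x in Metric.ball a (r / 2), ‖classicalGrad u x - A‖ₑ ^ 2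
        ≤ C * ∫⁻ x in Metric.ball a r, ‖strain u x‖ₑ ^ 2 := by
  obtain ⟨C, hC, h⟩ := exists_rigid_unitBall d
  refine ⟨C, hC, fun u hu a r hr => ?_⟩
  have haff : ContDiff ℝ ∞ fun z : Vec d => a + r • z :=
    contDiff_const.add (contDiff_id.const_smul r)
  obtain ⟨A, b, hA, h₁, h₂⟩ := h (fun z => u (a + r • z)) (hu.comp haff)
  have hr0 : r ≠ 0 := hr.ne'
  have hball : ∀ (s : ℝ) (z : Vec d), z ∈ Metric.ball (0 : Vec d) s
      ↔ a + r • z ∈ Metric.ball a (r * s) := by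
    intro s z
    rw [mem_ball_zero_iff, mem_ball_iff_norm, add_sub_cancel_left, norm_smul,
      Real.norm_of_nonneg hr.le]
    exact (mul_lt_mul_iff_right₀ hr).symm
  set J : ℝ≥0∞ := ENNReal.ofReal |(r ^ d)⁻¹| with hJ
  have hJ0 : J ≠ 0 := by
    rw [hJ, ne_eq, ENNReal.ofReal_eq_zero, not_le]; positivity
  have hJt : J ≠ ⊤ := ENNReal.ofReal_ne_top
  have cov : ∀ (F : Vec d → ℝ≥0∞) (s : ℝ), Measurable F →
      ∫⁻ z in Metric.ball (0 : Vec d) s, F (a + r • z) = J * ∫⁻ x in Metric.ball a (r * s), F x :=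
    fun F s hF => setLIntegral_comp_affine hF a hr0 Metric.isOpen_ball.measurableSet
      Metric.isOpen_ball.measurableSet (hball s)
  have mG : Continuous (classicalGrad u) := continuous_classicalGrad hu
  have eS : ∀ z, strain (fun z => u (a + r • z)) z = r • strain u (a + r • z) := fun z => by
    rw [strain, classicalGrad_comp_affine hu, symPart_smul]; rfl
  set ρ : ℝ≥0∞ := ‖r‖ₑ ^ 2 with hρ
  have hρ0 : ρ ≠ 0 := by simp [hρ, hr0]
  have hρt : ρ ≠ ⊤ := by simp [hρ]
  have hρr : ENNReal.ofReal r ^ 2 = ρ := by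
    rw [hρ, Real.enorm_of_nonneg hr.le]
  have rhs : ∫⁻ z in Metric.ball (0 : Vec d) 1, ‖strain (fun z => u (a + r • z)) z‖ₑ ^ 2
      = J * (ρ * ∫⁻ x in Metric.ball a r, ‖strain u x‖ₑ ^ 2) := by
    have m : Measurable fun x => ‖strain u x‖ₑ ^ 2 :=
      (continuous_strain hu).enorm.measurable.pow_const 2
    rw [← lintegral_const_mul _ m]
    have := cov (fun x => ρ * ‖strain u x‖ₑ ^ 2) 1 (m.const_mul _)
    rw [mul_one] at this
    rw [← this]
    exact lintegral_congr fun z => by rw [eS, enorm_smul, mul_pow]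
  rw [rhs] at h₁ h₂
  refine ⟨r⁻¹ • A, rigid (-(r⁻¹ • A)) b a, fun i j => by
    rw [PiLp.smul_apply, PiLp.smul_apply, hA i j, smul_neg], ?_, ?_⟩
  · set R := rigid (r⁻¹ • A) (rigid (-(r⁻¹ • A)) b a) with hR
    have m : Measurable fun x => ‖u x - R x‖ₑ ^ 2 :=
      (hu.continuous.sub (contDiff_rigid _ _).continuous).enorm.measurable.pow_const 2
    have := cov (fun x => ‖u x - R x‖ₑ ^ 2) (1 / 2) m
    simp only [hR, rigid_comp_affine A b a hr0] at this
    rw [this] at h₁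
    rw [show r / 2 = r * (1 / 2) by ring, hρr]
    refine (ENNReal.mul_le_mul_iff_right hJ0 hJt).1 (h₁.trans (le_of_eq ?_))
    ring
  · have m' : Measurable fun x => ‖classicalGrad u x - r⁻¹ • A‖ₑ ^ 2 :=
      (mG.sub continuous_const).enorm.measurable.pow_const 2
    have m : Measurable fun x => ρ * ‖classicalGrad u x - r⁻¹ • A‖ₑ ^ 2 := m'.const_mul _
    have e : ∀ z, ‖classicalGrad (fun z => u (a + r • z)) z - A‖ₑ ^ 2
        = ρ * ‖classicalGrad u (a + r • z) - r⁻¹ • A‖ₑ ^ 2 := fun z => by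
      rw [classicalGrad_comp_affine hu, hρ, ← mul_pow, ← enorm_smul, smul_sub, smul_smul,
        mul_inv_cancel₀ hr0, one_smul]
    simp only [e] at h₂
    rw [cov _ _ m, lintegral_const_mul _
      m'] at h₂
    rw [show r / 2 = r * (1 / 2) by ring]
    refine (ENNReal.mul_le_mul_iff_right hρ0 hρt).1
      ((ENNReal.mul_le_mul_iff_right hJ0 hJt).1 (h₂.trans (le_of_eq ?_)))
    ring

end BallKorn

/-! ### Graph coordinates -/

section Coordinates

variable {d : ℕ}

/-- The component of `x` orthogonal to the unit vector `ν`. -/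
def base (ν x : Vec d) : Vec d := x - inner ℝ ν x • ν

/-- The height of the graph of `γ` over the point `x`, measured in the direction `ν`; the subgraph
is where it is positive. -/
def depth (ν : Vec d) (γ : Vec d → ℝ) (x : Vec d) : ℝ := γ (base ν x) - inner ℝ ν x

/-- The point with base point `y` and depth `t` below the graph of `γ`. -/
def graphPoint (ν : Vec d) (γ : Vec d → ℝ) (y : Vec d) (t : ℝ) : Vec d := y + (γ y - t) • ν

variable {ν : Vec d} {γ : Vec d → ℝ}

theorem inner_self_of_norm_one (hν : ‖ν‖ = 1) : inner ℝ ν ν = (1 : ℝ) := by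
  rw [real_inner_self_eq_norm_sq, hν]; norm_num

theorem inner_base (hν : ‖ν‖ = 1) (x : Vec d) : inner ℝ ν (base ν x) = (0 : ℝ) := by
  rw [base, inner_sub_right, inner_smul_right, inner_self_of_norm_one hν]; ring

theorem base_mem (hν : ‖ν‖ = 1) (x : Vec d) : base ν x ∈ (ℝ ∙ ν)ᗮ :=
  Submodule.mem_orthogonal_singleton_iff_inner_right.2 (inner_base hν x)

theorem base_graphPoint (hν : ‖ν‖ = 1) {y : Vec d} (hy : inner ℝ ν y = (0 : ℝ)) (t : ℝ) :
    base ν (graphPoint ν γ y t) = y := by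
  rw [base, graphPoint, inner_add_right, inner_smul_right, inner_self_of_norm_one hν, hy]
  module

theorem depth_graphPoint (hν : ‖ν‖ = 1) {y : Vec d} (hy : inner ℝ ν y = (0 : ℝ)) (t : ℝ) :
    depth ν γ (graphPoint ν γ y t) = t := by
  rw [depth, base_graphPoint hν hy, graphPoint, inner_add_right, inner_smul_right,
    inner_self_of_norm_one hν, hy]
  ring

theorem graphPoint_base_depth (x : Vec d) : graphPoint ν γ (base ν x) (depth ν γ x) = x := by
  rw [graphPoint, depth, base]
  module

theorem norm_base_le (hν : ‖ν‖ = 1) (x : Vec d) : ‖base ν x‖ ≤ ‖x‖ := by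
  have h : ‖x‖ ^ 2 = ‖base ν x‖ ^ 2 + (inner ℝ ν x) ^ 2 := by
    have e : x = base ν x + inner ℝ ν x • ν := by rw [base]; module
    conv_lhs => rw [e]
    have h0 : inner ℝ (base ν x) ν = (0 : ℝ) := by rw [real_inner_comm]; exact inner_base hν x
    rw [norm_add_sq_real, real_inner_smul_right, h0, norm_smul, hν]
    simp
  refine le_of_sq_le_sq ?_ (norm_nonneg _)
  nlinarith [sq_nonneg (inner ℝ ν x : ℝ)]

theorem base_sub (x x' : Vec d) : base ν (x - x') = base ν x - base ν x' := by
  simp only [base, inner_sub_right]; module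

theorem continuous_base : Continuous (base ν) := by unfold base; fun_prop

theorem continuous_depth (hγ : Continuous γ) : Continuous (depth ν γ) := by
  have := hγ.comp (continuous_base (ν := ν))
  unfold depth
  exact this.sub (by fun_prop)

/-- The depth is Lipschitz. -/
theorem abs_depth_sub_le (hν : ‖ν‖ = 1) {L : NNReal} (hγ : LipschitzWith L γ) (x x' : Vec d) :
    |depth ν γ x - depth ν γ x'| ≤ (L + 1) * ‖x - x'‖ := by
  have h1 : |γ (base ν x) - γ (base ν x')| ≤ L * ‖x - x'‖ := by
    have := hγ.dist_le_mul (base ν x) (base ν x')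
    rw [Real.dist_eq, dist_eq_norm, ← base_sub] at this
    exact this.trans (mul_le_mul_of_nonneg_left (norm_base_le hν _) L.2)
  have h2 : |(inner ℝ ν x : ℝ) - inner ℝ ν x'| ≤ ‖x - x'‖ := by
    rw [← inner_sub_right]
    simpa [hν] using abs_real_inner_le_norm ν (x - x')
  have e : depth ν γ x - depth ν γ x'
      = (γ (base ν x) - γ (base ν x')) - ((inner ℝ ν x : ℝ) - inner ℝ ν x') := by
    simp only [depth]; ring
  rw [e]
  refine (abs_sub _ _).trans ?_
  linarith

theorem inner_coe_orthogonal (y : (ℝ ∙ ν)ᗮ) : inner ℝ ν (y : Vec d) = (0 : ℝ) :=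
  Submodule.mem_orthogonal_singleton_iff_inner_right.1 y.2

/-- The splitting of the space into the hyperplane orthogonal to `ν` and the line of `ν`. -/
def orthogonalEquiv (hν : ‖ν‖ = 1) : ((ℝ ∙ ν)ᗮ × ℝ) ≃ₗ[ℝ] Vec d where
  toFun p := (p.1 : Vec d) + p.2 • ν
  map_add' p q := by
    simp only [Prod.fst_add, Prod.snd_add, Submodule.coe_add]
    module
  map_smul' c p := by
    simp only [Prod.smul_fst, Prod.smul_snd, Submodule.coe_smul, RingHom.id_apply, smul_eq_mul]
    module
  invFun x := (⟨base ν x, base_mem hν x⟩, inner ℝ ν x)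
  left_inv p := by
    have h : (inner ℝ ν ((p.1 : Vec d) + p.2 • ν) : ℝ) = p.2 := by
      rw [inner_add_right, inner_smul_right, inner_self_of_norm_one hν, inner_coe_orthogonal]; ring
    ext1
    · ext1
      simp only [base, h]
      module
    · exact h
  right_inv x := by simp only [base]; module

/-- The surface measure on the hyperplane orthogonal to `ν`. -/
abbrev hyperplaneMeasure (ν : Vec d) : Measure ((ℝ ∙ ν)ᗮ : Submodule ℝ (Vec d)) :=
  Measure.hausdorffMeasure ((d : ℝ) - 1)

theorem isAddHaarMeasure_hyperplaneMeasure (hν : ‖ν‖ = 1) :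
    (hyperplaneMeasure ν).IsAddHaarMeasure := by
  have hν0 : ν ≠ 0 := by rintro rfl; simp at hν
  have hf : Module.finrank ℝ (ℝ ∙ ν) + Module.finrank ℝ (ℝ ∙ ν)ᗮ = d := by
    simpa using (ℝ ∙ ν).finrank_add_finrank_orthogonal
  rw [finrank_span_singleton hν0] at hf
  have e : (d : ℝ) - 1 = (Module.finrank ℝ (ℝ ∙ ν)ᗮ : ℝ) := by
    rw [sub_eq_iff_eq_add']
    exact_mod_cast hf.symm
  unfold hyperplaneMeasure
  rw [e]
  exact isAddHaarMeasure_hausdorffMeasure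

/-- Integration in graph coordinates. -/
theorem exists_lintegral_eq_graph (hν : ‖ν‖ = 1) : ∃ c : ℝ≥0∞, c ≠ 0 ∧ c ≠ ⊤ ∧
    ∀ γ : Vec d → ℝ, Continuous γ → ∀ F : Vec d → ℝ≥0∞, Measurable F →
      ∫⁻ x, F x = c * ∫⁻ y : (ℝ ∙ ν)ᗮ, (∫⁻ t : ℝ, F (graphPoint ν γ y t))
        ∂(hyperplaneMeasure ν) := by
  have := isAddHaarMeasure_hyperplaneMeasure hν
  set m : Measure ((ℝ ∙ ν)ᗮ × ℝ) := (hyperplaneMeasure ν).prod volume with hm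
  let e : ((ℝ ∙ ν)ᗮ × ℝ) ≃L[ℝ] Vec d := (orthogonalEquiv hν).toContinuousLinearEquiv
  have he : ∀ p, e p = (p.1 : Vec d) + p.2 • ν := fun p => rfl
  have hmap : (m.map e).IsAddHaarMeasure := e.isAddHaarMeasure_map m
  refine ⟨(volume : Measure (Vec d)).addHaarScalarFactor (m.map e), ?_, ENNReal.coe_ne_top, ?_⟩
  · exact ENNReal.coe_ne_zero.2 (Measure.addHaarScalarFactor_pos_of_isAddHaarMeasure _ _).ne'
  intro γ hγ F hF
  have h1 : ∫⁻ x, F x = (volume : Measure (Vec d)).addHaarScalarFactor (m.map e)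
      * ∫⁻ x, F x ∂(m.map e) := by
    conv_lhs => rw [Measure.isAddLeftInvariant_eq_smul (volume : Measure (Vec d)) (m.map e)]
    rw [lintegral_smul_measure]
    rfl
  rw [h1, lintegral_map hF e.continuous.measurable]
  congr 1
  have hFe : Measurable fun p => F (e p) := hF.comp e.continuous.measurable
  rw [hm, lintegral_prod _ hFe.aemeasurable]
  refine lintegral_congr fun y => ?_
  simp only [he, graphPoint]
  exact (lintegral_sub_left_eq_self (fun s : ℝ => F ((y : Vec d) + s • ν)) (γ y)).symm

/-- The points with base point in `U` and depth in `I`. -/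
def slab (ν : Vec d) (γ : Vec d → ℝ) (U : Set (Vec d)) (I : Set ℝ) : Set (Vec d) :=
  {x | base ν x ∈ U ∧ depth ν γ x ∈ I}

theorem measurableSet_slab (hγ : Continuous γ) {U : Set (Vec d)} (hU : MeasurableSet U)
    {I : Set ℝ} (hI : MeasurableSet I) : MeasurableSet (slab ν γ U I) :=
  (continuous_base.measurable hU).inter ((continuous_depth hγ).measurable hI)

/-- Integration over a slab in graph coordinates. -/
theorem setLIntegral_slab (hν : ‖ν‖ = 1) {c : ℝ≥0∞}
    (hc : ∀ γ : Vec d → ℝ, Continuous γ → ∀ F : Vec d → ℝ≥0∞, Measurable F →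
      ∫⁻ x, F x = c * ∫⁻ y : (ℝ ∙ ν)ᗮ, (∫⁻ t : ℝ, F (graphPoint ν γ y t))
        ∂(hyperplaneMeasure ν))
    (hγ : Continuous γ) {U : Set (Vec d)} (hU : MeasurableSet U) {I : Set ℝ}
    (hI : MeasurableSet I) {F : Vec d → ℝ≥0∞} (hF : Measurable F) :
    ∫⁻ x in slab ν γ U I, F x = c * ∫⁻ y in ((↑) : (ℝ ∙ ν)ᗮ → Vec d) ⁻¹' U,
      (∫⁻ t in I, F (graphPoint ν γ y t)) ∂(hyperplaneMeasure ν) := by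
  have hS := measurableSet_slab (ν := ν) hγ hU hI
  rw [← lintegral_indicator hS, hc γ hγ _ (hF.indicator hS),
    ← lintegral_indicator (measurable_subtype_coe hU)]
  congr 1
  refine lintegral_congr fun y => ?_
  by_cases hy : (y : Vec d) ∈ U
  · rw [Set.indicator_of_mem (by exact hy), ← lintegral_indicator hI]
    refine lintegral_congr fun t => ?_
    by_cases ht : t ∈ I
    · rw [Set.indicator_of_mem ht, Set.indicator_of_mem]
      refine ⟨?_, ?_⟩
      · rwa [base_graphPoint hν (inner_coe_orthogonal y)]
      · rwa [depth_graphPoint hν (inner_coe_orthogonal y)]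
    · rw [Set.indicator_of_notMem ht, Set.indicator_of_notMem]
      rintro ⟨-, h⟩
      rw [depth_graphPoint hν (inner_coe_orthogonal y)] at h
      exact ht h
  · rw [Set.indicator_of_notMem (by exact hy)]
    have : ∀ t, (slab ν γ U I).indicator F (graphPoint ν γ y t) = 0 := fun t => by
      refine Set.indicator_of_notMem ?_ _
      rintro ⟨h, -⟩
      rw [base_graphPoint hν (inner_coe_orthogonal y)] at h
      exact hy h
    simp only [this, lintegral_zero]

/-- The map multiplying the depth by `θ` along the lines of direction `ν`. -/
def stretch (ν : Vec d) (γ : Vec d → ℝ) (θ : ℝ) (x : Vec d) : Vec d :=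
  x - ((θ - 1) * depth ν γ x) • ν

theorem stretch_graphPoint (hν : ‖ν‖ = 1) {y : Vec d} (hy : inner ℝ ν y = (0 : ℝ)) (θ t : ℝ) :
    stretch ν γ θ (graphPoint ν γ y t) = graphPoint ν γ y (θ * t) := by
  rw [stretch, depth_graphPoint hν hy, graphPoint, graphPoint]
  module

theorem continuous_stretch (hγ : Continuous γ) (θ : ℝ) : Continuous (stretch ν γ θ) := by
  have := continuous_depth (ν := ν) hγ
  unfold stretch
  fun_prop

theorem base_stretch (hν : ‖ν‖ = 1) (θ : ℝ) (x : Vec d) : base ν (stretch ν γ θ x) = base ν x := by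
  conv_lhs => rw [← graphPoint_base_depth (ν := ν) (γ := γ) x,
    stretch_graphPoint hν (inner_base hν x)]
  rw [base_graphPoint hν (inner_base hν x)]

theorem depth_stretch (hν : ‖ν‖ = 1) (θ : ℝ) (x : Vec d) :
    depth ν γ (stretch ν γ θ x) = θ * depth ν γ x := by
  conv_lhs => rw [← graphPoint_base_depth (ν := ν) (γ := γ) x,
    stretch_graphPoint hν (inner_base hν x)]
  rw [depth_graphPoint hν (inner_base hν x)]

theorem lintegral_comp_mul_left_real {F : ℝ → ℝ≥0∞} (hF : Measurable F) {θ : ℝ} (hθ : 0 < θ) :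
    ∫⁻ t, F (θ * t) = ENNReal.ofReal θ⁻¹ * ∫⁻ t, F t := by
  have h1 : ∫⁻ t, F (θ * t) = ∫⁻ t, F t ∂(Measure.map (θ * ·) volume) :=
    (lintegral_map hF (measurable_const_mul θ)).symm
  rw [h1, Real.map_volume_mul_left hθ.ne', lintegral_smul_measure, abs_of_pos (inv_pos.2 hθ)]
  rfl

/-- The stretching map multiplies volumes by `θ`. -/
theorem lintegral_comp_stretch (hν : ‖ν‖ = 1) (hγ : Continuous γ) {θ : ℝ} (hθ : 0 < θ)
    {F : Vec d → ℝ≥0∞} (hF : Measurable F) :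
    ∫⁻ x, F (stretch ν γ θ x) = ENNReal.ofReal θ⁻¹ * ∫⁻ x, F x := by
  obtain ⟨c, -, -, hc⟩ := exists_lintegral_eq_graph hν
  have h1 := hc γ hγ _ (hF.comp (continuous_stretch (ν := ν) hγ θ).measurable)
  simp only [Function.comp_apply] at h1
  rw [h1, hc γ hγ F hF]
  have hcont : Continuous fun p : (ℝ ∙ ν)ᗮ × ℝ => graphPoint ν γ (p.1 : Vec d) p.2 := by
    unfold graphPoint
    have : Continuous fun p : (ℝ ∙ ν)ᗮ × ℝ => γ (p.1 : Vec d) := hγ.comp (by fun_prop)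
    fun_prop
  have := isAddHaarMeasure_hyperplaneMeasure hν
  have hm : Measurable fun y : (ℝ ∙ ν)ᗮ => ∫⁻ t : ℝ, F (graphPoint ν γ (y : Vec d) t) :=
    (hF.comp hcont.measurable).lintegral_prod_right'
  rw [mul_left_comm, ← lintegral_const_mul _ hm]
  congr 1
  refine lintegral_congr fun y => ?_
  simp only [stretch_graphPoint hν (inner_coe_orthogonal y)]
  exact lintegral_comp_mul_left_real
    (hF.comp (hcont.measurable.comp measurable_prodMk_left)) hθ

theorem setLIntegral_comp_stretch_le (hν : ‖ν‖ = 1) (hγ : Continuous γ) {θ : ℝ} (hθ : 0 < θ)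
    {F : Vec d → ℝ≥0∞} (hF : Measurable F) {S T : Set (Vec d)} (hS : MeasurableSet S)
    (hT : MeasurableSet T) (h : ∀ x ∈ S, stretch ν γ θ x ∈ T) :
    ∫⁻ x in S, F (stretch ν γ θ x) ≤ ENNReal.ofReal θ⁻¹ * ∫⁻ x in T, F x := by
  rw [← lintegral_indicator hS, ← lintegral_indicator hT,
    ← lintegral_comp_stretch hν hγ hθ (hF.indicator hT)]
  refine lintegral_mono fun x => ?_
  by_cases hx : x ∈ S
  · rw [Set.indicator_of_mem hx, Set.indicator_of_mem (h x hx)]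
  · rw [Set.indicator_of_notMem hx]; exact zero_le

end Coordinates

section Whitney

variable {d : ℕ} {ν : Vec d} {γ : Vec d → ℝ}

/-- The weight of the Whitney ball `B(w, a · depth w)`, normalised by the volume of that ball up to
a constant; it vanishes at `x` outside this ball, in particular if `w` has no positive depth. -/
def whitneyKernel (ν : Vec d) (γ : Vec d → ℝ) (a : ℝ) (x w : Vec d) : ℝ≥0∞ :=
  Set.indicator {p : Vec d × Vec d | dist p.1 p.2 < a * depth ν γ p.2}
    (fun p => ENNReal.ofReal ((depth ν γ p.2 ^ d)⁻¹)) (x, w)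

theorem measurable_whitneyKernel (hγ : Continuous γ) (a : ℝ) :
    Measurable fun p : Vec d × Vec d => whitneyKernel ν γ a p.1 p.2 := by
  have hd := continuous_depth (ν := ν) hγ
  refine Measurable.indicator ?_ ?_
  · exact ENNReal.measurable_ofReal.comp
      (((hd.measurable.comp measurable_snd).pow_const d).inv)
  · exact measurableSet_lt (by fun_prop) ((hd.comp continuous_snd).const_smul a).measurable

theorem volume_ball_eq (x : Vec d) {r : ℝ} (hr : 0 < r) :
    volume (Metric.ball x r) = ENNReal.ofReal (r ^ d) * volume (Metric.ball (0 : Vec d) 1) := by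
  have h := Measure.addHaar_ball_of_pos (volume : Measure (Vec d)) x hr
  rwa [finrank_euclideanSpace_fin] at h

/-- A point of positive depth lies in Whitney balls of total weight at least a constant, as the ball
`B(w, a · depth w)` contains `x` for all `w` close to `x`. -/
theorem le_lintegral_whitneyKernel (hν : ‖ν‖ = 1) {L : NNReal} (hγ : LipschitzWith L γ) {a : ℝ}
    (ha : 0 < a) (haL : a * (L + 1) ≤ 1 / 8) {x : Vec d} (hx : 0 < depth ν γ x) :
    ENNReal.ofReal ((a / 4) ^ d) * volume (Metric.ball (0 : Vec d) 1)
      ≤ ∫⁻ w, whitneyKernel ν γ a x w := by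
  set τ := depth ν γ x with hτ
  have hr : 0 < a * τ / 2 := by positivity
  have hpt : ∀ w ∈ Metric.ball x (a * τ / 2),
      ENNReal.ofReal (((2 * τ) ^ d)⁻¹) ≤ whitneyKernel ν γ a x w := by
    intro w hw
    rw [mem_ball_iff_norm] at hw
    have h1 := abs_depth_sub_le (ν := ν) hν hγ w x
    have h2 : (L + 1 : ℝ) * ‖w - x‖ ≤ τ / 16 := by
      have : (L + 1 : ℝ) * ‖w - x‖ ≤ (L + 1) * (a * τ / 2) :=
        mul_le_mul_of_nonneg_left hw.le (by positivity)
      nlinarith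
    have h3 := abs_le.1 (h1.trans h2)
    rw [← hτ] at h3
    have hw0 : 0 < depth ν γ w := by linarith [h3.1]
    rw [whitneyKernel, Set.indicator_of_mem]
    · refine ENNReal.ofReal_le_ofReal ?_
      gcongr
      linarith [h3.2]
    · show dist x w < a * depth ν γ w
      rw [dist_comm, dist_eq_norm]
      nlinarith [h3.1]
  calc ENNReal.ofReal ((a / 4) ^ d) * volume (Metric.ball (0 : Vec d) 1)
      = ENNReal.ofReal (((2 * τ) ^ d)⁻¹) * volume (Metric.ball x (a * τ / 2)) := by
        rw [volume_ball_eq x hr, ← mul_assoc, ← ENNReal.ofReal_mul (by positivity), ← inv_pow,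
          ← mul_pow]
        congr 3
        field_simp
        norm_num
    _ = ∫⁻ _ in Metric.ball x (a * τ / 2), ENNReal.ofReal (((2 * τ) ^ d)⁻¹) := by
        rw [setLIntegral_const]
    _ ≤ ∫⁻ w in Metric.ball x (a * τ / 2), whitneyKernel ν γ a x w :=
        setLIntegral_mono' Metric.isOpen_ball.measurableSet hpt
    _ ≤ _ := setLIntegral_le_lintegral _ _

/-- The Whitney balls have bounded overlap: their total weight at any point is at most a constant,
because the depth of the centre is comparable to the depth of the point. -/
theorem lintegral_whitneyKernel_le (hν : ‖ν‖ = 1) {L : NNReal} (hγ : LipschitzWith L γ) {a : ℝ}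
    (ha : 0 < a) (haL : a * (L + 1) ≤ 1 / 2) (z : Vec d) :
    ∫⁻ w, whitneyKernel ν γ a z w
      ≤ ENNReal.ofReal ((3 * a) ^ d) * volume (Metric.ball (0 : Vec d) 1) := by
  set τ := depth ν γ z with hτ
  have key : ∀ w, dist z w < a * depth ν γ w →
      0 < depth ν γ w ∧ depth ν γ w ≤ 2 * τ ∧ 2 / 3 * τ ≤ depth ν γ w := by
    intro w hw
    have hw0 : 0 < depth ν γ w := by
      have := dist_nonneg.trans_lt hw
      exact pos_of_mul_pos_right this ha.le
    have h1 := abs_depth_sub_le (ν := ν) hν hγ w z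
    have h2 : (L + 1 : ℝ) * ‖w - z‖ ≤ depth ν γ w / 2 := by
      have : (L + 1 : ℝ) * ‖w - z‖ ≤ (L + 1) * (a * depth ν γ w) := by
        refine mul_le_mul_of_nonneg_left ?_ (by positivity)
        rw [← dist_eq_norm, dist_comm]
        exact hw.le
      nlinarith
    have h3 := abs_le.1 (h1.trans h2)
    rw [← hτ] at h3
    exact ⟨hw0, by linarith [h3.2], by linarith [h3.1]⟩
  rcases le_or_gt τ 0 with hτ0 | hτ0
  · have : ∀ w, whitneyKernel ν γ a z w = 0 := fun w => by
      refine Set.indicator_of_notMem (fun h => ?_) _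
      have := key w h
      linarith
    simp only [this, lintegral_zero, zero_le]
  · have hpt : ∀ w, whitneyKernel ν γ a z w ≤ (Metric.ball z (2 * a * τ)).indicator
        (fun _ => ENNReal.ofReal (((2 / 3 * τ) ^ d)⁻¹)) w := by
      intro w
      by_cases h : dist z w < a * depth ν γ w
      · obtain ⟨h0, h1, h2⟩ := key w h
        rw [whitneyKernel, Set.indicator_of_mem (by exact h), Set.indicator_of_mem]
        · refine ENNReal.ofReal_le_ofReal ?_
          gcongr
        · rw [Metric.mem_ball, dist_comm]
          nlinarith
      · rw [whitneyKernel, Set.indicator_of_notMem (by exact h)]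
        exact zero_le
    refine (lintegral_mono hpt).trans (le_of_eq ?_)
    rw [lintegral_indicator Metric.isOpen_ball.measurableSet, setLIntegral_const,
      volume_ball_eq z (by positivity), ← mul_assoc,
      ← ENNReal.ofReal_mul (by positivity), ← inv_pow,
      ← mul_pow]
    congr 3
    field_simp

/-- Comparison of the gradient at a point and at the stretched point. By Korn's inequality both are
close, on each Whitney ball, to the same skew matrix; averaging over all Whitney balls gives the
estimate. -/
theorem exists_lintegral_sub_stretch_le (hν : ‖ν‖ = 1) {L : NNReal} (hγ : LipschitzWith L γ)
    {a : ℝ} (ha : 0 < a) (haL : a * (L + 1) ≤ 1 / 8) : ∃ C : ℝ≥0∞, C ≠ ⊤ ∧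
    ∀ (Ω S : Set (Vec d)), MeasurableSet Ω → MeasurableSet S → (∀ x ∈ S, 0 < depth ν γ x) →
      (∀ x ∈ S, ∀ w, dist x w < a * depth ν γ w → Metric.ball w (4 * a * depth ν γ w) ⊆ Ω) →
      ∀ u : Vec d → Vec d, ContDiff ℝ ∞ u →
        ∫⁻ x in S, ‖classicalGrad u x - classicalGrad u (stretch ν γ (1 + a / 2) x)‖ₑ ^ 2
          ≤ C * ∫⁻ x in Ω, ‖strain u x‖ₑ ^ 2 := by
  obtain ⟨C, hC, hkorn⟩ := exists_rigid_ball d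
  set θ : ℝ := 1 + a / 2 with hθ
  have hθ0 : 0 < θ := by positivity
  set m := ENNReal.ofReal ((a / 4) ^ d) * volume (Metric.ball (0 : Vec d) 1) with hm
  set M := ENNReal.ofReal ((3 * (4 * a)) ^ d) * volume (Metric.ball (0 : Vec d) 1) with hM
  have hvol0 : volume (Metric.ball (0 : Vec d) 1) ≠ 0 := (Metric.measure_ball_pos _ _ one_pos).ne'
  have hm0 : m ≠ 0 := mul_ne_zero (by
    rw [ne_eq, ENNReal.ofReal_eq_zero, not_le]; positivity) hvol0
  have hmt : m ≠ ⊤ := ENNReal.mul_ne_top ENNReal.ofReal_ne_top measure_ball_lt_top.ne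
  have hMt : M ≠ ⊤ := ENNReal.mul_ne_top ENNReal.ofReal_ne_top measure_ball_lt_top.ne
  refine ⟨m⁻¹ * (4 * C * M), ENNReal.mul_ne_top (ENNReal.inv_ne_top.2 hm0)
    (ENNReal.mul_ne_top (ENNReal.mul_ne_top (by simp) hC) hMt), ?_⟩
  intro Ω S hΩ hS hpos hball u hu
  set G : Vec d → ℝ≥0∞ := fun x => ‖classicalGrad u x - classicalGrad u (stretch ν γ θ x)‖ₑ ^ 2
    with hG
  set E : Vec d → ℝ≥0∞ := fun x => ‖strain u x‖ₑ ^ 2 with hE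
  have hcG : Continuous (classicalGrad u) := continuous_classicalGrad hu
  have hcs : Continuous (stretch ν γ θ) := continuous_stretch hγ.continuous θ
  have mG : Measurable G := (hcG.sub (hcG.comp hcs)).enorm.measurable.pow_const 2
  have mE : Measurable E := (continuous_strain hu).enorm.measurable.pow_const 2
  have hdm : Measurable (depth ν γ) := (continuous_depth hγ.continuous).measurable
  -- the estimate on one Whitney ball
  have local_est : ∀ w, ∫⁻ x in S ∩ Metric.ball w (a * depth ν γ w), G x
      ≤ 4 * C * ∫⁻ z in Ω ∩ Metric.ball w (4 * a * depth ν γ w), E z := by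
    intro w
    rcases (S ∩ Metric.ball w (a * depth ν γ w)).eq_empty_or_nonempty with hemp | ⟨x₁, hx₁, hx₁w⟩
    · rw [hemp]; simp
    have hw0 : 0 < depth ν γ w := by
      have := dist_nonneg.trans_lt (Metric.mem_ball.1 hx₁w)
      exact pos_of_mul_pos_right this ha.le
    set t := depth ν γ w with ht
    have hsub := hball x₁ hx₁ w (Metric.mem_ball.1 hx₁w)
    obtain ⟨A, b, -, -, hA⟩ := hkorn u hu w (4 * a * t) (by positivity)
    rw [show 4 * a * t / 2 = 2 * a * t by ring] at hA
    set D : Vec d → ℝ≥0∞ := fun x => ‖classicalGrad u x - A‖ₑ ^ 2 with hD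
    have mD : Measurable D := (hcG.sub continuous_const).enorm.measurable.pow_const 2
    -- stretching moves a point of the Whitney ball by at most `a` times the depth of the centre
    have hmaps : ∀ x ∈ Metric.ball w (a * t), stretch ν γ θ x ∈ Metric.ball w (2 * a * t) := by
      intro x hx
      rw [mem_ball_iff_norm] at hx ⊢
      have h1 := abs_depth_sub_le (ν := ν) hν hγ x w
      have h2 : (L + 1 : ℝ) * ‖x - w‖ ≤ t / 8 := by
        have : (L + 1 : ℝ) * ‖x - w‖ ≤ (L + 1) * (a * t) :=
          mul_le_mul_of_nonneg_left hx.le (by positivity)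
        nlinarith
      have h3 := abs_le.1 (h1.trans h2)
      rw [← ht] at h3
      have e : stretch ν γ θ x - w = (x - w) - ((θ - 1) * depth ν γ x) • ν := by
        rw [stretch]; abel
      have h4 : ‖((θ - 1) * depth ν γ x) • ν‖ ≤ a * t := by
        rw [norm_smul, hν, mul_one, Real.norm_eq_abs, hθ, abs_of_nonneg (by
          have : 0 ≤ depth ν γ x := by linarith [h3.1]
          have : (0 : ℝ) ≤ 1 + a / 2 - 1 := by linarith
          positivity)]
        nlinarith [h3.2]
      rw [e]
      refine (norm_sub_le _ _).trans_lt ?_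
      linarith
    have hinv : ENNReal.ofReal θ⁻¹ ≤ 1 :=
      ENNReal.ofReal_le_one.2 (inv_le_one_of_one_le₀ (by rw [hθ]; linarith))
    have mDs : Measurable fun x => D (stretch ν γ θ x) := mD.comp hcs.measurable
    calc ∫⁻ x in S ∩ Metric.ball w (a * t), G x
        ≤ ∫⁻ x in Metric.ball w (a * t), G x := lintegral_mono_set Set.inter_subset_right
      _ ≤ ∫⁻ x in Metric.ball w (a * t), (2 * D x + 2 * D (stretch ν γ θ x)) := by
          refine lintegral_mono fun x => ?_
          have := enorm_sub_sq_le (classicalGrad u x - A) (classicalGrad u (stretch ν γ θ x) - A)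
          rwa [sub_sub_sub_cancel_right] at this
      _ = 2 * (∫⁻ x in Metric.ball w (a * t), D x)
          + 2 * ∫⁻ x in Metric.ball w (a * t), D (stretch ν γ θ x) := by
          rw [lintegral_add_left (mD.const_mul 2), lintegral_const_mul _ mD,
            lintegral_const_mul _ mDs]
      _ ≤ 2 * (∫⁻ x in Metric.ball w (2 * a * t), D x)
          + 2 * ∫⁻ x in Metric.ball w (2 * a * t), D x := by
          refine add_le_add (mul_le_mul_right ?_ _) (mul_le_mul_right ?_ _)
          · exact lintegral_mono_set (Metric.ball_subset_ball (by nlinarith))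
          · refine (setLIntegral_comp_stretch_le hν hγ.continuous hθ0 mD
              Metric.isOpen_ball.measurableSet Metric.isOpen_ball.measurableSet hmaps).trans ?_
            exact mul_le_of_le_one_left zero_le hinv
      _ = 4 * ∫⁻ x in Metric.ball w (2 * a * t), D x := by ring
      _ ≤ 4 * (C * ∫⁻ x in Metric.ball w (4 * a * t), E x) := mul_le_mul_right hA _
      _ = 4 * C * ∫⁻ z in Ω ∩ Metric.ball w (4 * a * t), E z := by
          rw [Set.inter_eq_right.2 hsub, ← mul_assoc]
  set K : Vec d → ℝ≥0∞ := fun w => ENNReal.ofReal ((depth ν γ w ^ d)⁻¹) with hK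
  have mK : Measurable K := ENNReal.measurable_ofReal.comp ((hdm.pow_const d).inv)
  -- integrating a function against the kernel means integrating it over the Whitney ball
  have unfold_kernel : ∀ (b : ℝ) (T : Set (Vec d)) (F : Vec d → ℝ≥0∞), MeasurableSet T →
      Measurable F → ∫⁻ x in T, F x * ∫⁻ w, whitneyKernel ν γ b x w
        = ∫⁻ w, K w * ∫⁻ x in T ∩ Metric.ball w (b * depth ν γ w), F x := by
    intro b T F hT hF
    have mk := measurable_whitneyKernel (ν := ν) hγ.continuous b
    have e1 : ∀ x, F x * ∫⁻ w, whitneyKernel ν γ b x w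
        = ∫⁻ w, F x * whitneyKernel ν γ b x w := fun x =>
      (lintegral_const_mul _ (mk.comp measurable_prodMk_left)).symm
    simp only [e1]
    rw [lintegral_lintegral_swap (((hF.comp measurable_fst).mul mk).aemeasurable)]
    refine lintegral_congr fun w => ?_
    rw [← lintegral_const_mul _ hF, Set.inter_comm, ← Measure.restrict_restrict
      Metric.isOpen_ball.measurableSet, ← lintegral_indicator Metric.isOpen_ball.measurableSet]
    refine lintegral_congr fun x => ?_
    by_cases h : dist x w < b * depth ν γ w
    · rw [Set.indicator_of_mem (by exact h), whitneyKernel, Set.indicator_of_mem (by exact h),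
        mul_comm]
    · rw [Set.indicator_of_notMem (by exact h), whitneyKernel,
        Set.indicator_of_notMem (by exact h), mul_zero]
  have main : m * ∫⁻ x in S, G x ≤ 4 * C * M * ∫⁻ x in Ω, E x := by
    calc m * ∫⁻ x in S, G x = ∫⁻ x in S, G x * m := by
          rw [lintegral_mul_const _ mG, mul_comm]
      _ ≤ ∫⁻ x in S, G x * ∫⁻ w, whitneyKernel ν γ a x w :=
          setLIntegral_mono' hS fun x hx =>
            mul_le_mul_right (le_lintegral_whitneyKernel hν hγ ha haL (hpos x hx)) _
      _ = ∫⁻ w, K w * ∫⁻ x in S ∩ Metric.ball w (a * depth ν γ w), G x :=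
          unfold_kernel a S G hS mG
      _ ≤ ∫⁻ w, 4 * C * (K w * ∫⁻ z in Ω ∩ Metric.ball w (4 * a * depth ν γ w), E z) := by
          refine lintegral_mono fun w => ?_
          rw [mul_left_comm]
          exact mul_le_mul_right (local_est w) _
      _ = 4 * C * ∫⁻ w, K w * ∫⁻ z in Ω ∩ Metric.ball w (4 * a * depth ν γ w), E z :=
          lintegral_const_mul' _ _ (ENNReal.mul_ne_top (by simp) hC)
      _ = 4 * C * ∫⁻ z in Ω, E z * ∫⁻ w, whitneyKernel ν γ (4 * a) z w := by
          rw [unfold_kernel (4 * a) Ω E hΩ mE]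
      _ ≤ 4 * C * ∫⁻ z in Ω, E z * M := by
          refine mul_le_mul_right (lintegral_mono fun z => mul_le_mul_right ?_ _) _
          exact lintegral_whitneyKernel_le hν hγ (by positivity) (by linarith) z
      _ = 4 * C * M * ∫⁻ x in Ω, E x := by
          rw [lintegral_mul_const _ mE]; ring
  calc ∫⁻ x in S, G x = m⁻¹ * (m * ∫⁻ x in S, G x) := by
        rw [← mul_assoc, ENNReal.inv_mul_cancel hm0 hmt, one_mul]
    _ ≤ m⁻¹ * (4 * C * M * ∫⁻ x in Ω, E x) := mul_le_mul_right main _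
    _ = _ := by ring

end Whitney

/-! ### Estimates near the boundary -/

section Chart

variable {d : ℕ} {ν : Vec d} {γ : Vec d → ℝ}

/-- A finite quantity that appears on the right with a factor below one can be absorbed. -/
theorem le_of_le_add_mul {N X : ℝ≥0∞} {q : ℝ} (hq0 : 0 ≤ q) (hq : q < 1) (hN : N ≠ ⊤)
    (h : N ≤ X + ENNReal.ofReal q * N) : N ≤ ENNReal.ofReal (1 - q)⁻¹ * X := by
  have hpos : 0 < (1 - q)⁻¹ := inv_pos.2 (by linarith)
  rcases eq_or_ne X ⊤ with rfl | hX
  · rw [ENNReal.mul_top (by simpa using hpos)]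
    exact le_top
  lift N to NNReal using hN
  lift X to NNReal using hX
  have h' : (N : ℝ) ≤ X + q * N := by
    rw [← ENNReal.ofReal_coe_nnreal, ← ENNReal.ofReal_coe_nnreal (p := X),
      ← ENNReal.ofReal_mul hq0, ← ENNReal.ofReal_add X.coe_nonneg (by positivity)] at h
    exact (ENNReal.ofReal_le_ofReal_iff (by positivity)).1 h
  rw [← ENNReal.ofReal_coe_nnreal, ← ENNReal.ofReal_coe_nnreal (p := X),
    ← ENNReal.ofReal_mul hpos.le]
  refine ENNReal.ofReal_le_ofReal ?_
  rw [inv_mul_eq_div, le_div_iff₀ (by linarith)]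
  linarith

theorem enorm_sq_le_young {F : Type*} [NormedAddCommGroup F] (a b : F) {δ : ℝ} (hδ : 0 < δ) :
    ‖a‖ₑ ^ 2 ≤ ENNReal.ofReal (1 + δ⁻¹) * ‖a - b‖ₑ ^ 2 + ENNReal.ofReal (1 + δ) * ‖b‖ₑ ^ 2 := by
  have h : ‖a‖ ^ 2 ≤ (1 + δ⁻¹) * ‖a - b‖ ^ 2 + (1 + δ) * ‖b‖ ^ 2 := by
    have h1 : ‖a‖ ≤ ‖a - b‖ + ‖b‖ := by simpa using norm_add_le (a - b) b
    have h2 : ‖a‖ ^ 2 ≤ (‖a - b‖ + ‖b‖) ^ 2 := pow_le_pow_left₀ (norm_nonneg _) h1 2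
    have h3 : (1 + δ⁻¹) * ‖a - b‖ ^ 2 + (1 + δ) * ‖b‖ ^ 2 - (‖a - b‖ + ‖b‖) ^ 2
        = δ⁻¹ * (‖a - b‖ - δ * ‖b‖) ^ 2 := by
      field_simp
      ring
    have h4 : 0 ≤ δ⁻¹ * (‖a - b‖ - δ * ‖b‖) ^ 2 := by positivity
    linarith
  have h' := ENNReal.ofReal_le_ofReal h
  rwa [ENNReal.ofReal_add (by positivity) (by positivity), ENNReal.ofReal_mul (by positivity),
    ENNReal.ofReal_mul (by positivity), ofReal_norm_sq, ofReal_norm_sq, ofReal_norm_sq] at h'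

theorem lintegral_enorm_sq_ne_top {F : Type*} [NormedAddCommGroup F] {f : Vec d → F}
    (hf : Continuous f) {S : Set (Vec d)} (hS : Bornology.IsBounded S) :
    ∫⁻ x in S, ‖f x‖ₑ ^ 2 ≠ ⊤ := by
  obtain ⟨R, hR⟩ := hS.subset_closedBall (0 : Vec d)
  obtain ⟨K, hK⟩ := (isCompact_closedBall (0 : Vec d) R).exists_bound_of_continuousOn
    hf.continuousOn
  refine ne_top_of_le_ne_top (b := ∫⁻ _ in Metric.closedBall (0 : Vec d) R, ENNReal.ofReal K ^ 2)
    ?_ ((lintegral_mono_set hR).trans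
      (setLIntegral_mono' Metric.isClosed_closedBall.measurableSet fun x hx => ?_))
  · rw [setLIntegral_const]
    exact ENNReal.mul_ne_top (by simp) measure_closedBall_lt_top.ne
  · rw [← ofReal_norm]
    exact pow_le_pow_left' (ENNReal.ofReal_le_ofReal (hK x hx)) 2

/-- Hardy-type absorption: along the lines of direction `ν` the gradient near the graph is
controlled by its values in a layer away from the graph and by its increments under stretching. -/
theorem lintegral_classicalGrad_slab_le (hν : ‖ν‖ = 1) (hγ : Continuous γ) {a h : ℝ}
    (ha : 0 < a) {U : Set (Vec d)} (hU : MeasurableSet U)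
    (hb : Bornology.IsBounded (slab ν γ U (Set.Ioo 0 h))) {u : Vec d → Vec d}
    (hu : ContDiff ℝ ∞ u) :
    ∫⁻ x in slab ν γ U (Set.Ioo 0 h), ‖classicalGrad u x‖ₑ ^ 2
      ≤ ENNReal.ofReal (1 - (1 + a / 4) * (1 + a / 2)⁻¹)⁻¹ *
        (ENNReal.ofReal (1 + (a / 4)⁻¹) * (∫⁻ x in slab ν γ U (Set.Ioo 0 h),
            ‖classicalGrad u x - classicalGrad u (stretch ν γ (1 + a / 2) x)‖ₑ ^ 2)
          + ∫⁻ x in slab ν γ U (Set.Ico h ((1 + a / 2) * h)), ‖classicalGrad u x‖ₑ ^ 2) := by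
  set θ : ℝ := 1 + a / 2 with hθ
  have hθ0 : 0 < θ := by positivity
  set q : ℝ := (1 + a / 4) * θ⁻¹ with hq
  have hq0 : 0 ≤ q := by positivity
  have hq1 : q < 1 := by
    rw [hq, ← div_eq_mul_inv, div_lt_one hθ0]; linarith
  have hcG : Continuous (classicalGrad u) := continuous_classicalGrad hu
  have hcs : Continuous (stretch ν γ θ) := continuous_stretch hγ θ
  set G : Vec d → ℝ≥0∞ := fun x => ‖classicalGrad u x‖ₑ ^ 2 with hG
  have mG : Measurable G := hcG.enorm.measurable.pow_const 2
  have mGs : Measurable fun x => G (stretch ν γ θ x) := mG.comp hcs.measurable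
  have mD : Measurable fun x => ‖classicalGrad u x - classicalGrad u (stretch ν γ θ x)‖ₑ ^ 2 :=
    (hcG.sub (hcG.comp hcs)).enorm.measurable.pow_const 2
  set S := slab ν γ U (Set.Ioo 0 h) with hS
  have mS : MeasurableSet S := measurableSet_slab hγ hU measurableSet_Ioo
  set T := slab ν γ U (Set.Ico h (θ * h)) with hT
  have mT : MeasurableSet T := measurableSet_slab hγ hU measurableSet_Ico
  refine le_of_le_add_mul hq0 hq1 (lintegral_enorm_sq_ne_top hcG hb) ?_
  have hmaps : ∀ x ∈ S, stretch ν γ θ x ∈ S ∪ T := by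
    rintro x ⟨hxU, hx0, hxh⟩
    have e1 : base ν (stretch ν γ θ x) ∈ U := by rwa [base_stretch hν]
    have e2 : depth ν γ (stretch ν γ θ x) = θ * depth ν γ x := depth_stretch hν θ x
    rcases lt_or_ge (θ * depth ν γ x) h with hlt | hge
    · exact Or.inl ⟨e1, by rw [e2]; exact ⟨by positivity, hlt⟩⟩
    · exact Or.inr ⟨e1, by rw [e2]; exact ⟨hge, mul_lt_mul_of_pos_left hxh hθ0⟩⟩
  -- the Jacobian `θ` of the stretching yields a factor below one even after Young's inequality
  have hst : ∫⁻ x in S, G (stretch ν γ θ x)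
      ≤ ENNReal.ofReal θ⁻¹ * ((∫⁻ x in S, G x) + ∫⁻ x in T, G x) :=
    (setLIntegral_comp_stretch_le hν hγ hθ0 mG mS (mS.union mT) hmaps).trans
      (mul_le_mul_right (lintegral_union_le _ _ _) _)
  calc ∫⁻ x in S, G x
      ≤ ∫⁻ x in S, (ENNReal.ofReal (1 + (a / 4)⁻¹)
            * ‖classicalGrad u x - classicalGrad u (stretch ν γ θ x)‖ₑ ^ 2
          + ENNReal.ofReal (1 + a / 4) * G (stretch ν γ θ x)) :=
        lintegral_mono fun x => enorm_sq_le_young _ _ (by positivity)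
    _ = ENNReal.ofReal (1 + (a / 4)⁻¹)
          * (∫⁻ x in S, ‖classicalGrad u x - classicalGrad u (stretch ν γ θ x)‖ₑ ^ 2)
        + ENNReal.ofReal (1 + a / 4) * ∫⁻ x in S, G (stretch ν γ θ x) := by
        rw [lintegral_add_left (mD.const_mul _), lintegral_const_mul _ mD,
          lintegral_const_mul _ mGs]
    _ ≤ ENNReal.ofReal (1 + (a / 4)⁻¹)
          * (∫⁻ x in S, ‖classicalGrad u x - classicalGrad u (stretch ν γ θ x)‖ₑ ^ 2)
        + ENNReal.ofReal q * ((∫⁻ x in S, G x) + ∫⁻ x in T, G x) := by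
        refine add_le_add_right ((mul_le_mul_right hst _).trans (le_of_eq ?_)) _
        rw [← mul_assoc, ← ENNReal.ofReal_mul (by positivity)]
    _ ≤ _ := by
        rw [mul_add, ← add_assoc, add_right_comm]
        refine add_le_add_left (add_le_add_right ?_ _) _
        exact mul_le_of_le_one_left zero_le (ENNReal.ofReal_le_one.2 hq1.le)

/-- The value of a field at a point of depth at most `h` is controlled by its values in the layer of
depths between `h` and `2h` on the same line, and by its gradient. -/
theorem enorm_graphPoint_sq_le (hν : ‖ν‖ = 1) {u : Vec d → Vec d} (hu : ContDiff ℝ ∞ u) {h : ℝ}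
    (hh : 0 < h) (y : Vec d) {s₀ : ℝ} (hs₀ : s₀ ∈ Set.Icc 0 h) :
    ‖u (graphPoint ν γ y s₀)‖ₑ ^ 2 ≤ (2 * ENNReal.ofReal h⁻¹ + 4 * ENNReal.ofReal h) *
      ((∫⁻ t in Set.Icc h (2 * h), ‖u (graphPoint ν γ y t)‖ₑ ^ 2)
        + ∫⁻ t in Set.Ioc 0 (2 * h), ‖classicalGrad u (graphPoint ν γ y t)‖ₑ ^ 2) := by
  have hcp : Continuous fun t : ℝ => graphPoint ν γ y t := by unfold graphPoint; fun_prop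
  have hder : ∀ t : ℝ, HasDerivAt (fun t => u (graphPoint ν γ y t))
      (fderiv ℝ u (graphPoint ν γ y t) (-ν)) t := by
    intro t
    have h1 : HasDerivAt (fun t : ℝ => graphPoint ν γ y t) (-ν) t := by
      unfold graphPoint
      simpa using (((hasDerivAt_id t).const_sub (γ y)).smul_const ν).const_add y
    exact (hu.differentiable (by simp) _).hasFDerivAt.comp_hasDerivAt t h1
  have hcd : Continuous fun t : ℝ => fderiv ℝ u (graphPoint ν γ y t) (-ν) :=
    ((hu.continuous_fderiv (by simp)).comp hcp).clm_apply continuous_const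
  have hcG : Continuous fun t : ℝ => classicalGrad u (graphPoint ν γ y t) :=
    (continuous_classicalGrad hu).comp hcp
  set I1 := ∫⁻ t in Set.Icc h (2 * h), ‖u (graphPoint ν γ y t)‖ₑ ^ 2 with hI1
  set I2 := ∫⁻ t in Set.Ioc 0 (2 * h), ‖classicalGrad u (graphPoint ν γ y t)‖ₑ ^ 2 with hI2
  -- this bound is averaged over the layer of depths between `h` and `2h`
  have step : ∀ s ∈ Set.Icc h (2 * h), ‖u (graphPoint ν γ y s₀)‖ₑ ^ 2
      ≤ 2 * ‖u (graphPoint ν γ y s)‖ₑ ^ 2 + 4 * ENNReal.ofReal h * I2 := by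
    intro s hs
    have hle : s₀ ≤ s := hs₀.2.trans hs.1
    have ftc : u (graphPoint ν γ y s) - u (graphPoint ν γ y s₀)
        = ∫ t in Set.Ioc s₀ s, fderiv ℝ u (graphPoint ν γ y t) (-ν) := by
      rw [← intervalIntegral.integral_of_le hle, intervalIntegral.integral_eq_sub_of_hasDerivAt
        (fun t _ => hder t) (hcd.intervalIntegrable _ _)]
    have hb : ‖u (graphPoint ν γ y s) - u (graphPoint ν γ y s₀)‖ₑ
        ≤ ∫⁻ t in Set.Ioc 0 (2 * h), ‖classicalGrad u (graphPoint ν γ y t)‖ₑ := by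
      rw [ftc]
      refine (enorm_integral_le_lintegral_enorm _).trans
        ((lintegral_mono_set (Set.Ioc_subset_Ioc hs₀.1 hs.2)).trans (lintegral_mono fun t => ?_))
      rw [← ofReal_norm, ← ofReal_norm]
      refine ENNReal.ofReal_le_ofReal ((norm_fderiv_apply_le u _ _).trans (le_of_eq ?_))
      rw [norm_neg, hν, mul_one]
    have hb2 : ‖u (graphPoint ν γ y s) - u (graphPoint ν γ y s₀)‖ₑ ^ 2
        ≤ ENNReal.ofReal (2 * h) * I2 := by
      refine (pow_le_pow_left' hb 2).trans
        ((lintegral_sq_le hcG.enorm.measurable.aemeasurable).trans (le_of_eq ?_))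
      simp [hI2]
    have h3 := enorm_sub_sq_le (u (graphPoint ν γ y s))
      (u (graphPoint ν γ y s) - u (graphPoint ν γ y s₀))
    rw [sub_sub_cancel] at h3
    refine h3.trans (add_le_add_right ((mul_le_mul_right hb2 _).trans (le_of_eq ?_)) _)
    rw [ENNReal.ofReal_mul (by norm_num), ENNReal.ofReal_ofNat]
    ring
  have mu : Measurable fun t => ‖u (graphPoint ν γ y t)‖ₑ ^ 2 :=
    (hu.continuous.comp hcp).enorm.measurable.pow_const 2
  have hvol : volume (Set.Icc h (2 * h)) = ENNReal.ofReal h := by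
    rw [Real.volume_Icc]; congr 1; ring
  have avg : ENNReal.ofReal h * ‖u (graphPoint ν γ y s₀)‖ₑ ^ 2
      ≤ 2 * I1 + 4 * ENNReal.ofReal h * I2 * ENNReal.ofReal h := by
    calc ENNReal.ofReal h * ‖u (graphPoint ν γ y s₀)‖ₑ ^ 2
        = ∫⁻ _ in Set.Icc h (2 * h), ‖u (graphPoint ν γ y s₀)‖ₑ ^ 2 := by
          rw [setLIntegral_const, hvol, mul_comm]
      _ ≤ ∫⁻ s in Set.Icc h (2 * h),
            (2 * ‖u (graphPoint ν γ y s)‖ₑ ^ 2 + 4 * ENNReal.ofReal h * I2) :=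
          setLIntegral_mono' measurableSet_Icc step
      _ = _ := by
          rw [lintegral_add_right _ measurable_const, lintegral_const_mul _ mu, setLIntegral_const,
            hvol]
  have hinv : ENNReal.ofReal h⁻¹ * ENNReal.ofReal h = 1 := by
    rw [← ENNReal.ofReal_mul (by positivity), inv_mul_cancel₀ hh.ne', ENNReal.ofReal_one]
  calc ‖u (graphPoint ν γ y s₀)‖ₑ ^ 2
      = ENNReal.ofReal h⁻¹ * (ENNReal.ofReal h * ‖u (graphPoint ν γ y s₀)‖ₑ ^ 2) := by
        rw [← mul_assoc, hinv, one_mul]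
    _ ≤ ENNReal.ofReal h⁻¹ * (2 * I1 + 4 * ENNReal.ofReal h * I2 * ENNReal.ofReal h) :=
        mul_le_mul_right avg _
    _ = 2 * ENNReal.ofReal h⁻¹ * I1
        + 4 * ENNReal.ofReal h * I2 * (ENNReal.ofReal h⁻¹ * ENNReal.ofReal h) := by ring
    _ = 2 * ENNReal.ofReal h⁻¹ * I1 + 4 * ENNReal.ofReal h * I2 := by rw [hinv, mul_one]
    _ ≤ _ := by
        rw [mul_add]
        exact add_le_add (mul_le_mul_left le_self_add _) (mul_le_mul_left le_add_self _)

/-- The surface measure of a piece of the boundary lying on the graph of a Lipschitz function is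
controlled by the surface measure of its projection. -/
theorem setLIntegral_bdryMeasure_le (hd : 1 ≤ d) (hν : ‖ν‖ = 1) {L : NNReal}
    (hγ : LipschitzWith L γ) {Ω U V : Set (Vec d)} (hV : MeasurableSet V)
    (hUV : ∀ x ∈ V, base ν x ∈ U) (hVd : ∀ x ∈ V, x ∈ frontier Ω → depth ν γ x = 0)
    (hU : MeasurableSet U) {F : Vec d → ℝ≥0∞} (hF : Measurable F) :
    ∫⁻ x in V, F x ∂(bdryMeasure Ω)
      ≤ ((1 + L : NNReal) : ℝ≥0∞) ^ ((d : ℝ) - 1) * ∫⁻ y in ((↑) : (ℝ ∙ ν)ᗮ → Vec d) ⁻¹' U,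
          F (graphPoint ν γ y 0) ∂(hyperplaneMeasure ν) := by
  set Γ : (ℝ ∙ ν)ᗮ → Vec d := fun y => graphPoint ν γ y 0 with hΓ
  have hdim : (0 : ℝ) ≤ (d : ℝ) - 1 := by
    have : (1 : ℝ) ≤ d := by exact_mod_cast hd
    linarith
  have hΓL : LipschitzWith (1 + L) Γ := by
    refine LipschitzWith.of_dist_le_mul fun y y' => ?_
    have h1 := hγ.dist_le_mul (y : Vec d) y'
    have e : Γ y - Γ y' = ((y : Vec d) - y') + (γ y - γ y') • ν := by
      simp only [hΓ, graphPoint]; module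
    rw [dist_eq_norm, e]
    refine (norm_add_le _ _).trans ?_
    rw [norm_smul, hν, mul_one, Real.norm_eq_abs, ← Real.dist_eq, ← dist_eq_norm]
    rw [Subtype.dist_eq]
    push_cast
    linarith
  have hU' : MeasurableSet (((↑) : (ℝ ∙ ν)ᗮ → Vec d) ⁻¹' U) := measurable_subtype_coe hU
  have hle : (bdryMeasure Ω).restrict V ≤ ((1 + L : NNReal) : ℝ≥0∞) ^ ((d : ℝ) - 1) •
      ((hyperplaneMeasure ν).restrict (((↑) : (ℝ ∙ ν)ᗮ → Vec d) ⁻¹' U)).map Γ := by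
    refine Measure.le_iff.2 fun T hT => ?_
    rw [Measure.smul_apply, Measure.map_apply hΓL.continuous.measurable hT,
      Measure.restrict_apply (hΓL.continuous.measurable hT), Measure.restrict_apply hT,
      bdryMeasure, Measure.restrict_apply (hT.inter hV), smul_eq_mul]
    refine (measure_mono ?_).trans (hΓL.hausdorffMeasure_image_le hdim _)
    rintro x ⟨⟨hxT, hxV⟩, hxf⟩
    have hx : Γ ⟨base ν x, base_mem hν x⟩ = x := by
      have := graphPoint_base_depth (ν := ν) (γ := γ) x
      rwa [hVd x hxV hxf] at this
    exact ⟨⟨base ν x, base_mem hν x⟩, ⟨by rw [Set.mem_preimage, hx]; exact hxT, hUV x hxV⟩, hx⟩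
  refine (lintegral_mono' hle le_rfl).trans (le_of_eq ?_)
  rw [lintegral_smul_measure, lintegral_map hF hΓL.continuous.measurable, smul_eq_mul]

end Chart

section BoundaryChart

variable {d : ℕ} {ν : Vec d} {γ : Vec d → ℝ}

theorem continuous_graphPoint (hγ : Continuous γ) :
    Continuous fun p : (ℝ ∙ ν)ᗮ × ℝ => graphPoint ν γ (p.1 : Vec d) p.2 := by
  unfold graphPoint
  have : Continuous fun p : (ℝ ∙ ν)ᗮ × ℝ => γ (p.1 : Vec d) := hγ.comp (by fun_prop)
  fun_prop

theorem slab_eq (ν : Vec d) (γ : Vec d → ℝ) (U : Set (Vec d)) (I : Set ℝ) :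
    slab ν γ U I = base ν ⁻¹' U ∩ depth ν γ ⁻¹' I := rfl

theorem isClosed_slab (hγ : Continuous γ) {U : Set (Vec d)} (hU : IsClosed U) {I : Set ℝ}
    (hI : IsClosed I) : IsClosed (slab ν γ U I) := by
  rw [slab_eq]
  exact (hU.preimage continuous_base).inter (hI.preimage (continuous_depth hγ))

theorem isOpen_slab (hγ : Continuous γ) {U : Set (Vec d)} (hU : IsOpen U) {I : Set ℝ}
    (hI : IsOpen I) : IsOpen (slab ν γ U I) := by
  rw [slab_eq]
  exact (hU.preimage continuous_base).inter (hI.preimage (continuous_depth hγ))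

/-- The base point and the depth are coordinates with Lipschitz inverse. -/
theorem dist_le_of_base_depth (hν : ‖ν‖ = 1) {L : NNReal} (hγ : LipschitzWith L γ) (x x₀ : Vec d) :
    dist x x₀ ≤ (1 + L) * ‖base ν x - base ν x₀‖ + |depth ν γ x - depth ν γ x₀| := by
  have e : x - x₀ = (base ν x - base ν x₀) + ((γ (base ν x) - γ (base ν x₀))
      - (depth ν γ x - depth ν γ x₀)) • ν := by
    simp only [depth, base]; module
  have h1 := hγ.dist_le_mul (base ν x) (base ν x₀)
  rw [Real.dist_eq, dist_eq_norm] at h1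
  rw [dist_eq_norm, e]
  refine (norm_add_le _ _).trans ?_
  rw [norm_smul, hν, mul_one, Real.norm_eq_abs]
  have h2 := abs_sub (γ (base ν x) - γ (base ν x₀)) (depth ν γ x - depth ν γ x₀)
  linarith

/-- The `L²` norm of a field near the graph is controlled through a layer away from it. -/
theorem exists_lintegral_slab_le (hd : 1 ≤ d) (hν : ‖ν‖ = 1) {L : NNReal} (hγ : LipschitzWith L γ)
    {h : ℝ} (hh : 0 < h) : ∃ C : ℝ≥0∞, C ≠ ⊤ ∧ ∀ (Ω U V : Set (Vec d)), MeasurableSet U →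
      MeasurableSet V → (∀ x ∈ V, base ν x ∈ U) →
      (∀ x ∈ V, x ∈ frontier Ω → depth ν γ x = 0) →
      ∀ u : Vec d → Vec d, ContDiff ℝ ∞ u →
      ∫⁻ x in slab ν γ U (Set.Ioo 0 h), ‖u x‖ₑ ^ 2
        ≤ C * ((∫⁻ x in slab ν γ U (Set.Icc h (2 * h)), ‖u x‖ₑ ^ 2)
          + ∫⁻ x in slab ν γ U (Set.Ioc 0 (2 * h)), ‖classicalGrad u x‖ₑ ^ 2) ∧
      ∫⁻ x in V, ‖u x‖ₑ ^ 2 ∂(bdryMeasure Ω)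
        ≤ C * ((∫⁻ x in slab ν γ U (Set.Icc h (2 * h)), ‖u x‖ₑ ^ 2)
          + ∫⁻ x in slab ν γ U (Set.Ioc 0 (2 * h)), ‖classicalGrad u x‖ₑ ^ 2) := by
  obtain ⟨c, hc0, hct, hc⟩ := exists_lintegral_eq_graph hν
  have := isAddHaarMeasure_hyperplaneMeasure hν
  set κ : ℝ≥0∞ := 2 * ENNReal.ofReal h⁻¹ + 4 * ENNReal.ofReal h with hκ
  have hκt : κ ≠ ⊤ := ENNReal.add_ne_top.2 ⟨ENNReal.mul_ne_top (by simp) (by simp),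
    ENNReal.mul_ne_top (by simp) (by simp)⟩
  set Λ : ℝ≥0∞ := ((1 + L : NNReal) : ℝ≥0∞) ^ ((d : ℝ) - 1) with hΛ
  have hΛt : Λ ≠ ⊤ := by
    have : (1 : ℝ) ≤ d := by exact_mod_cast hd
    exact ENNReal.rpow_ne_top_of_nonneg (by linarith) ENNReal.coe_ne_top
  have hc1t : c⁻¹ ≠ ⊤ := ENNReal.inv_ne_top.2 hc0
  refine ⟨κ * ENNReal.ofReal h + Λ * κ * c⁻¹, ENNReal.add_ne_top.2
    ⟨ENNReal.mul_ne_top hκt (by simp), ENNReal.mul_ne_top (ENNReal.mul_ne_top hΛt hκt) hc1t⟩, ?_⟩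
  intro Ω U V hU hV hUV hVd u hu
  have hγc := hγ.continuous
  set F : Vec d → ℝ≥0∞ := fun x => ‖u x‖ₑ ^ 2 with hF
  set G : Vec d → ℝ≥0∞ := fun x => ‖classicalGrad u x‖ₑ ^ 2 with hG
  have mF : Measurable F := hu.continuous.enorm.measurable.pow_const 2
  have mG : Measurable G := (continuous_classicalGrad hu).enorm.measurable.pow_const 2
  have hU' : MeasurableSet (((↑) : (ℝ ∙ ν)ᗮ → Vec d) ⁻¹' U) := measurable_subtype_coe hU
  set Φ1 : (ℝ ∙ ν)ᗮ → ℝ≥0∞ := fun y => ∫⁻ t in Set.Icc h (2 * h), F (graphPoint ν γ y t) with hΦ1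
  set Φ2 : (ℝ ∙ ν)ᗮ → ℝ≥0∞ := fun y => ∫⁻ t in Set.Ioc 0 (2 * h), G (graphPoint ν γ y t) with hΦ2
  have mΦ1 : Measurable Φ1 :=
    (mF.comp (continuous_graphPoint (ν := ν) hγc).measurable).lintegral_prod_right'
      (ν := volume.restrict (Set.Icc h (2 * h)))
  set X := (∫⁻ x in slab ν γ U (Set.Icc h (2 * h)), F x)
    + ∫⁻ x in slab ν γ U (Set.Ioc 0 (2 * h)), G x with hX
  have eX : X = c * ∫⁻ y in ((↑) : (ℝ ∙ ν)ᗮ → Vec d) ⁻¹' U, (Φ1 y + Φ2 y)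
      ∂(hyperplaneMeasure ν) := by
    rw [hX, setLIntegral_slab hν hc hγc hU measurableSet_Icc mF,
      setLIntegral_slab hν hc hγc hU measurableSet_Ioc mG, lintegral_add_left mΦ1, mul_add]
  have hpt : ∀ (y : (ℝ ∙ ν)ᗮ), ∀ s ∈ Set.Icc 0 h,
      F (graphPoint ν γ y s) ≤ κ * (Φ1 y + Φ2 y) := fun y s hs =>
    enorm_graphPoint_sq_le hν hu hh y hs
  constructor
  · refine le_trans ?_ (mul_le_mul_left le_self_add _)
    rw [setLIntegral_slab hν hc hγc hU measurableSet_Ioo mF, eX]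
    have : ∀ y : (ℝ ∙ ν)ᗮ, ∫⁻ t in Set.Ioo 0 h, F (graphPoint ν γ y t)
        ≤ κ * ENNReal.ofReal h * (Φ1 y + Φ2 y) := by
      intro y
      refine (setLIntegral_mono' measurableSet_Ioo fun t ht =>
        hpt y t (Set.Ioo_subset_Icc_self ht)).trans (le_of_eq ?_)
      rw [setLIntegral_const, Real.volume_Ioo, sub_zero]
      ring
    calc _ ≤ c * ∫⁻ y in ((↑) : (ℝ ∙ ν)ᗮ → Vec d) ⁻¹' U,
          κ * ENNReal.ofReal h * (Φ1 y + Φ2 y) ∂(hyperplaneMeasure ν) :=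
        mul_le_mul_right (lintegral_mono fun y => this y) _
      _ = _ := by
        rw [lintegral_const_mul' _ _ (ENNReal.mul_ne_top hκt (by simp))]
        ring
  · refine le_trans ?_ (mul_le_mul_left le_add_self _)
    calc ∫⁻ x in V, F x ∂(bdryMeasure Ω)
        ≤ Λ * ∫⁻ y in ((↑) : (ℝ ∙ ν)ᗮ → Vec d) ⁻¹' U, F (graphPoint ν γ y 0)
            ∂(hyperplaneMeasure ν) := setLIntegral_bdryMeasure_le hd hν hγ hV hUV hVd hU mF
      _ ≤ Λ * ∫⁻ y in ((↑) : (ℝ ∙ ν)ᗮ → Vec d) ⁻¹' U, κ * (Φ1 y + Φ2 y)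
            ∂(hyperplaneMeasure ν) :=
          mul_le_mul_right (lintegral_mono fun y => hpt y 0 ⟨le_rfl, hh.le⟩) _
      _ = Λ * κ * c⁻¹ * X := by
          rw [lintegral_const_mul' _ _ hκt, eX, mul_assoc (Λ * κ), ← mul_assoc c⁻¹,
            ENNReal.inv_mul_cancel hc0 hct, one_mul, mul_assoc]

/-- Within a chart, the boundary of the domain lies on the graph. -/
theorem depth_eq_zero_of_mem_frontier (hγ : Continuous γ) {Ω : Set (Vec d)} (hΩ : IsOpen Ω)
    {x₀ : Vec d} {r : ℝ}
    (hsub : ∀ x ∈ Metric.ball x₀ r, (x ∈ Ω ↔ 0 < depth ν γ x)) {x : Vec d}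
    (hx : x ∈ Metric.ball x₀ r) (hxf : x ∈ frontier Ω) : depth ν γ x = 0 := by
  rw [hΩ.frontier_eq] at hxf
  refine le_antisymm (not_lt.1 fun h => hxf.2 ((hsub x hx).2 h)) ?_
  have hcl : x ∈ closure (Metric.ball x₀ r ∩ Ω) := by
    exact Metric.isOpen_ball.inter_closure ⟨hx, hxf.1⟩
  have hclosed : IsClosed {z | 0 ≤ depth ν γ z} :=
    isClosed_le continuous_const (continuous_depth hγ)
  exact hclosed.closure_subset_iff.2 (fun z hz => ((hsub z hz.1).1 hz.2).le) hcl

/-- Near a boundary point of a Lipschitz domain, the full `H¹` norm and the trace of a field are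
controlled by the strain and by the values on a compact subset of the domain. -/
theorem exists_boundary_estimate (hd : 1 ≤ d) {Ω : Set (Vec d)} (hΩ : IsOpen Ω)
    (hlip : HasLipschitzBoundary Ω) {x₀ : Vec d} (hx₀ : x₀ ∈ frontier Ω) :
    ∃ (V T : Set (Vec d)) (C : ℝ≥0∞), IsOpen V ∧ x₀ ∈ V ∧ IsCompact T ∧ T ⊆ Ω ∧ C ≠ ⊤ ∧
      ∀ u : Vec d → Vec d, ContDiff ℝ ∞ u →
        (∫⁻ x in V ∩ Ω, ‖u x‖ₑ ^ 2) + (∫⁻ x in V ∩ Ω, ‖classicalGrad u x‖ₑ ^ 2)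
          + (∫⁻ x in V, ‖u x‖ₑ ^ 2 ∂(bdryMeasure Ω))
        ≤ C * ((∫⁻ x in Ω, ‖strain u x‖ₑ ^ 2)
          + ((∫⁻ x in T, ‖u x‖ₑ ^ 2) + ∫⁻ x in T, ‖classicalGrad u x‖ₑ ^ 2)) := by
  obtain ⟨ν, hν, L, γ, hγ, r, hr, hsub'⟩ := hlip x₀ hx₀
  have hsub : ∀ x ∈ Metric.ball x₀ r, (x ∈ Ω ↔ 0 < depth ν γ x) := fun x hx => by
    rw [hsub' x hx, depth, sub_pos]; rfl
  have hγc := hγ.continuous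
  have hL : (0 : ℝ) ≤ L := L.2
  have hd0 : depth ν γ x₀ = 0 :=
    depth_eq_zero_of_mem_frontier hγc hΩ hsub (Metric.mem_ball_self hr) hx₀
  -- the size of the chart, and the relative size of the Whitney balls
  set h : ℝ := r / (7 + L) with hh
  have hh0 : 0 < h := by positivity
  have hhr : (7 + L) * h = r := by rw [hh]; field_simp
  set a : ℝ := 1 / (8 * (L + 1)) with ha
  have ha0 : 0 < a := by positivity
  have haL : a * (L + 1) = 1 / 8 := by rw [ha]; field_simp
  have ha8 : a ≤ 1 / 8 := by nlinarith
  set U := Metric.ball (base ν x₀) h with hU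
  have mU : MeasurableSet U := Metric.isOpen_ball.measurableSet
  have near : ∀ x, base ν x ∈ Metric.closedBall (base ν x₀) h →
      dist x x₀ ≤ (1 + L) * h + |depth ν γ x| := by
    intro x hx
    have h1 := dist_le_of_base_depth hν hγ x x₀
    rw [hd0, sub_zero] at h1
    rw [Metric.mem_closedBall, dist_eq_norm] at hx
    nlinarith
  have UsubC : ∀ x, base ν x ∈ U → base ν x ∈ Metric.closedBall (base ν x₀) h := fun x hx =>
    Metric.ball_subset_closedBall hx
  set S := slab ν γ U (Set.Ioo 0 h) with hS
  have mS : MeasurableSet S := measurableSet_slab hγc mU measurableSet_Ioo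
  have hSb : Bornology.IsBounded S := by
    refine (Metric.isBounded_ball (x := x₀) (r := r)).subset fun x hx => ?_
    have := near x (UsubC x hx.1)
    rw [abs_of_pos hx.2.1] at this
    rw [Metric.mem_ball]
    nlinarith [hx.2.2]
  set T := slab ν γ (Metric.closedBall (base ν x₀) h) (Set.Icc h (2 * h)) with hT
  have hTr : T ⊆ Metric.ball x₀ r := fun x hx => by
    have := near x hx.1
    rw [abs_of_pos (hh0.trans_le hx.2.1)] at this
    rw [Metric.mem_ball]
    nlinarith [hx.2.2]
  have hTc : IsCompact T := by
    exact Metric.isCompact_of_isClosed_isBounded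
      (isClosed_slab hγc Metric.isClosed_closedBall isClosed_Icc)
      (Metric.isBounded_ball.subset hTr)
  have hTΩ : T ⊆ Ω := fun x hx => (hsub x (hTr hx)).2 (hh0.trans_le hx.2.1)
  obtain ⟨C₁, hC₁, h₁⟩ := exists_lintegral_sub_stretch_le hν hγ ha0 haL.le
  obtain ⟨C₂, hC₂, h₂⟩ := exists_lintegral_slab_le hd hν hγ hh0
  -- Whitney balls centred near the chart stay inside the domain
  have hball : ∀ x ∈ S, ∀ w, dist x w < a * depth ν γ w →
      Metric.ball w (4 * a * depth ν γ w) ⊆ Ω := by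
    intro x hx w hw z hz
    have hw0 : 0 < depth ν γ w := pos_of_mul_pos_right (dist_nonneg.trans_lt hw) ha0.le
    have e1 := abs_depth_sub_le (ν := ν) hν hγ x w
    have e2 : (L + 1 : ℝ) * ‖x - w‖ ≤ depth ν γ w / 8 := by
      rw [dist_eq_norm] at hw
      have := mul_le_mul_of_nonneg_left hw.le (show (0 : ℝ) ≤ L + 1 by linarith)
      nlinarith
    have e3 := abs_le.1 (e1.trans e2)
    have hw2 : depth ν γ w ≤ 2 * h := by linarith [e3.1, hx.2.2]
    have e4 := abs_depth_sub_le (ν := ν) hν hγ z w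
    have e5 : (L + 1 : ℝ) * ‖z - w‖ ≤ depth ν γ w / 2 := by
      rw [Metric.mem_ball, dist_eq_norm] at hz
      have := mul_le_mul_of_nonneg_left hz.le (show (0 : ℝ) ≤ L + 1 by linarith)
      nlinarith
    have e6 := abs_le.1 (e4.trans e5)
    refine (hsub z ?_).2 (by linarith [e6.1])
    have e7 := near x (UsubC x hx.1)
    rw [abs_of_pos hx.2.1] at e7
    have e8 : dist z x₀ ≤ dist z w + dist x w + dist x x₀ := by
      have := dist_triangle4 z w x x₀
      rwa [dist_comm w x] at this
    rw [Metric.mem_ball] at hz ⊢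
    have e9 : a * depth ν γ w ≤ h / 4 := by nlinarith
    nlinarith [hx.2.2]
  set V := slab ν γ U (Set.Ioo (-h) h) with hV
  have hVo : IsOpen V := isOpen_slab hγc Metric.isOpen_ball isOpen_Ioo
  have hVr : V ⊆ Metric.ball x₀ r := fun x hx => by
    have := near x (UsubC x hx.1)
    rw [Metric.mem_ball]
    nlinarith [abs_lt.2 hx.2]
  have hVS : V ∩ Ω ⊆ S := fun x hx =>
    ⟨hx.1.1, (hsub x (hVr hx.1)).1 hx.2, hx.1.2.2⟩
  set k1 := ENNReal.ofReal (1 - (1 + a / 4) * (1 + a / 2)⁻¹)⁻¹ with hk1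
  set k2 := ENNReal.ofReal (1 + (a / 4)⁻¹) with hk2
  set K := k1 * (k2 * C₁ + 1) with hK
  have hKt : K ≠ ⊤ := ENNReal.mul_ne_top (by simp [hk1])
    (ENNReal.add_ne_top.2 ⟨ENNReal.mul_ne_top (by simp [hk2]) hC₁, by simp⟩)
  refine ⟨V, T, K + 2 * (C₂ * (K + 1)), hVo, ⟨Metric.mem_ball_self hh0, ?_, ?_⟩, hTc, hTΩ, ?_, ?_⟩
  · rw [hd0]; linarith
  · rw [hd0]; exact hh0
  · exact ENNReal.add_ne_top.2 ⟨hKt, ENNReal.mul_ne_top (by simp)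
      (ENNReal.mul_ne_top hC₂ (ENNReal.add_ne_top.2 ⟨hKt, by simp⟩))⟩
  intro u hu
  set E := ∫⁻ x in Ω, ‖strain u x‖ₑ ^ 2 with hE
  set T0 := ∫⁻ x in T, ‖u x‖ₑ ^ 2 with hT0
  set T1 := ∫⁻ x in T, ‖classicalGrad u x‖ₑ ^ 2 with hT1
  set X := E + (T0 + T1) with hX
  have hEX : E ≤ X := le_self_add
  have hT0X : T0 ≤ X := le_self_add.trans le_add_self
  have hT1X : T1 ≤ X := le_add_self.trans le_add_self
  have grad : ∫⁻ x in S, ‖classicalGrad u x‖ₑ ^ 2 ≤ K * X := by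
    refine (lintegral_classicalGrad_slab_le hν hγc ha0 mU hSb hu).trans ?_
    have g1 := h₁ Ω S hΩ.measurableSet mS (fun x hx => hx.2.1) hball u hu
    have g2 : ∫⁻ x in slab ν γ U (Set.Ico h ((1 + a / 2) * h)), ‖classicalGrad u x‖ₑ ^ 2
        ≤ T1 := by
      refine lintegral_mono_set fun x hx => ⟨UsubC x hx.1, hx.2.1, hx.2.2.le.trans ?_⟩
      nlinarith
    calc _ ≤ k1 * (k2 * (C₁ * X) + X) :=
          mul_le_mul_right (add_le_add (mul_le_mul_right (g1.trans (mul_le_mul_right hEX _)) _)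
            (g2.trans hT1X)) _
      _ = K * X := by rw [hK]; ring
  obtain ⟨v1, v2⟩ := h₂ Ω U V mU hVo.measurableSet (fun x hx => hx.1)
    (fun x hx hxf => depth_eq_zero_of_mem_frontier hγc hΩ hsub (hVr hx) hxf) u hu
  have layer : (∫⁻ x in slab ν γ U (Set.Icc h (2 * h)), ‖u x‖ₑ ^ 2)
      + (∫⁻ x in slab ν γ U (Set.Ioc 0 (2 * h)), ‖classicalGrad u x‖ₑ ^ 2) ≤ (K + 1) * X := by
    have l1 : ∫⁻ x in slab ν γ U (Set.Icc h (2 * h)), ‖u x‖ₑ ^ 2 ≤ T0 :=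
      lintegral_mono_set fun x hx => ⟨UsubC x hx.1, hx.2⟩
    have l2 : ∫⁻ x in slab ν γ U (Set.Ioc 0 (2 * h)), ‖classicalGrad u x‖ₑ ^ 2
        ≤ K * X + T1 := by
      refine (lintegral_mono_set (t := S ∪ T) fun x hx => ?_).trans
        ((lintegral_union_le _ _ _).trans (add_le_add_left grad _))
      rcases lt_or_ge (depth ν γ x) h with hlt | hge
      · exact Or.inl ⟨hx.1, hx.2.1, hlt⟩
      · exact Or.inr ⟨UsubC x hx.1, hge, hx.2.2⟩
    calc _ ≤ T0 + (K * X + T1) := add_le_add l1 l2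
      _ = K * X + (T0 + T1) := by ring
      _ ≤ K * X + X := add_le_add_right le_add_self _
      _ = (K + 1) * X := by ring
  calc _ ≤ C₂ * ((K + 1) * X) + K * X + C₂ * ((K + 1) * X) := by
        refine add_le_add (add_le_add ?_ ?_) ?_
        · exact (lintegral_mono_set hVS).trans (v1.trans (mul_le_mul_right layer _))
        · exact (lintegral_mono_set hVS).trans grad
        · exact v2.trans (mul_le_mul_right layer _)
    _ = _ := by ring

end BoundaryChart

/-! ### Korn's inequality on Lipschitz domains -/

section KornSets

variable {d : ℕ}

/-- On `S` every field is close in `H¹`, up to its strain on `Ω`, to a rigid displacement. -/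
def IsKornSet (Ω S : Set (Vec d)) : Prop :=
  ∃ C : ℝ≥0∞, C ≠ ⊤ ∧ ∀ u : Vec d → Vec d, ContDiff ℝ ∞ u → ∃ (A : Mat d) (b : Vec d), IsSkew A ∧
    (∫⁻ x in S, ‖u x - rigid A b x‖ₑ ^ 2) + (∫⁻ x in S, ‖classicalGrad u x - A‖ₑ ^ 2)
      ≤ C * ∫⁻ x in Ω, ‖strain u x‖ₑ ^ 2

theorem isKornSet_ball {Ω : Set (Vec d)} {x : Vec d} {r : ℝ} (hr : 0 < r)
    (h : Metric.ball x r ⊆ Ω) : IsKornSet Ω (Metric.ball x (r / 2)) := by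
  obtain ⟨C, hC, hk⟩ := exists_rigid_ball d
  refine ⟨C * ENNReal.ofReal r ^ 2 + C, ENNReal.add_ne_top.2 ⟨ENNReal.mul_ne_top hC (by simp), hC⟩,
    fun u hu => ?_⟩
  obtain ⟨A, b, hA, h1, h2⟩ := hk u hu x r hr
  refine ⟨A, b, hA, (add_le_add h1 h2).trans ?_⟩
  rw [← add_mul]
  exact mul_le_mul_right (lintegral_mono_set h) _

theorem rigid_sub_rigid (A A' : Mat d) (b b' x : Vec d) :
    rigid A b x - rigid A' b' x = rigid (A - A') (b - b') x := by
  ext i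
  simp only [PiLp.sub_apply, rigid_apply, sub_mul, Finset.sum_sub_distrib]
  ring

theorem enorm_rigid_sq_le {M : ℝ} (A : Mat d) (b : Vec d) {x : Vec d} (hx : ‖x‖ ≤ M) :
    ‖rigid A b x‖ₑ ^ 2 ≤ 2 * (ENNReal.ofReal M ^ 2 * ‖A‖ₑ ^ 2) + 2 * ‖b‖ₑ ^ 2 := by
  have e : rigid A b x = rigid A 0 x + b := by
    ext i; simp [rigid_apply]
  rw [e]
  refine (enorm_add_sq_le _ _).trans (add_le_add_left (mul_le_mul_right ?_ _) _)
  rw [← mul_pow]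
  refine pow_le_pow_left' ?_ 2
  have h := norm_rigid_le A 0 x
  rw [norm_zero, add_zero] at h
  have hM : 0 ≤ M := (norm_nonneg x).trans hx
  rw [← ofReal_norm, ← ofReal_norm, ← ENNReal.ofReal_mul hM]
  refine ENNReal.ofReal_le_ofReal (h.trans ?_)
  rw [mul_comm]
  exact mul_le_mul_of_nonneg_right hx (norm_nonneg _)

/-- The `L²` size of a rigid displacement on a bounded set is controlled by its coefficients. -/
theorem exists_lintegral_rigid_le (μ : Measure (Vec d)) {S : Set (Vec d)}
    (hS : Bornology.IsBounded S) (hSm : MeasurableSet S) (hμ : μ S ≠ ⊤) :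
    ∃ K : ℝ≥0∞, K ≠ ⊤ ∧ ∀ (A : Mat d) (b : Vec d),
      (∫⁻ x in S, ‖rigid A b x‖ₑ ^ 2 ∂μ) + (∫⁻ _ in S, ‖A‖ₑ ^ 2 ∂μ)
        ≤ K * (‖A‖ₑ ^ 2 + ‖b‖ₑ ^ 2) := by
  obtain ⟨M, hM⟩ := hS.subset_closedBall (0 : Vec d)
  refine ⟨(2 * ENNReal.ofReal M ^ 2 + 3) * μ S, ENNReal.mul_ne_top
    (ENNReal.add_ne_top.2 ⟨ENNReal.mul_ne_top (by simp) (by simp), by simp⟩) hμ, fun A b => ?_⟩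
  have h1 : ∫⁻ x in S, ‖rigid A b x‖ₑ ^ 2 ∂μ
      ≤ (2 * (ENNReal.ofReal M ^ 2 * ‖A‖ₑ ^ 2) + 2 * ‖b‖ₑ ^ 2) * μ S := by
    rw [← setLIntegral_const]
    exact setLIntegral_mono' hSm fun x hx =>
      enorm_rigid_sq_le A b (mem_closedBall_zero_iff.1 (hM hx))
  rw [setLIntegral_const]
  calc _ ≤ (2 * (ENNReal.ofReal M ^ 2 * ‖A‖ₑ ^ 2) + 2 * ‖b‖ₑ ^ 2) * μ S + ‖A‖ₑ ^ 2 * μ S :=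
        add_le_add_left h1 _
    _ = (((2 * ENNReal.ofReal M ^ 2) * ‖A‖ₑ ^ 2) + (‖A‖ₑ ^ 2 + 2 * ‖b‖ₑ ^ 2)) * μ S := by ring
    _ ≤ (((2 * ENNReal.ofReal M ^ 2) * (‖A‖ₑ ^ 2 + ‖b‖ₑ ^ 2))
          + (3 * ‖A‖ₑ ^ 2 + 3 * ‖b‖ₑ ^ 2)) * μ S := by
        refine mul_le_mul_left (add_le_add (mul_le_mul_right le_self_add _) (add_le_add ?_ ?_)) _
        · exact le_mul_of_one_le_left zero_le (by norm_num)
        · exact mul_le_mul_left (by norm_num) _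
    _ = _ := by ring

/-- The coefficients of a rigid displacement are controlled by its size on any ball. -/
theorem exists_coeff_le_lintegral_rigid (x₀ : Vec d) {r : ℝ} (hr : 0 < r) :
    ∃ K : ℝ≥0∞, K ≠ ⊤ ∧ ∀ (A : Mat d) (b : Vec d), ‖A‖ₑ ^ 2 + ‖b‖ₑ ^ 2
      ≤ K * ((∫⁻ x in Metric.ball x₀ r, ‖rigid A b x‖ₑ ^ 2)
          + (∫⁻ _ in Metric.ball x₀ r, ‖A‖ₑ ^ 2)) := by
  obtain ⟨M, hM⟩ := (Metric.isBounded_ball (x := x₀) (r := r)).subset_closedBall (0 : Vec d)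
  set v := volume (Metric.ball x₀ r) with hv
  have hv0 : v ≠ 0 := (Metric.measure_ball_pos _ _ hr).ne'
  have hvt : v ≠ ⊤ := measure_ball_lt_top.ne
  set Q : ℝ≥0∞ := 1 + 2 * ENNReal.ofReal M ^ 2 with hQ
  have hQt : Q ≠ ⊤ := ENNReal.add_ne_top.2 ⟨by simp, ENNReal.mul_ne_top (by simp) (by simp)⟩
  refine ⟨v⁻¹ * (2 + Q), ENNReal.mul_ne_top (ENNReal.inv_ne_top.2 hv0)
    (ENNReal.add_ne_top.2 ⟨by simp, hQt⟩), fun A b => ?_⟩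
  set I := ∫⁻ x in Metric.ball x₀ r, ‖rigid A b x‖ₑ ^ 2 with hI
  have hb : ‖b‖ₑ ^ 2 * v ≤ 2 * I + 2 * ENNReal.ofReal M ^ 2 * (‖A‖ₑ ^ 2 * v) := by
    have mR : Measurable fun x => ‖rigid A b x‖ₑ ^ 2 :=
      (contDiff_rigid A b).continuous.enorm.measurable.pow_const 2
    calc ‖b‖ₑ ^ 2 * v = ∫⁻ _ in Metric.ball x₀ r, ‖b‖ₑ ^ 2 := by rw [setLIntegral_const]
      _ ≤ ∫⁻ x in Metric.ball x₀ r,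
            (2 * ‖rigid A b x‖ₑ ^ 2 + 2 * (ENNReal.ofReal M ^ 2 * ‖A‖ₑ ^ 2)) := by
          refine setLIntegral_mono' Metric.isOpen_ball.measurableSet fun x hx => ?_
          have e : b = rigid A b x - rigid A 0 x := by
            ext i; simp [rigid_apply]
          conv_lhs => rw [e]
          refine (enorm_sub_sq_le _ _).trans (add_le_add_right (mul_le_mul_right ?_ _) _)
          rw [← mul_pow]
          refine pow_le_pow_left' ?_ 2
          have h := norm_rigid_le A 0 x
          have hx' := mem_closedBall_zero_iff.1 (hM hx)
          rw [norm_zero, add_zero] at h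
          rw [← ofReal_norm, ← ofReal_norm, ← ENNReal.ofReal_mul ((norm_nonneg x).trans hx')]
          refine ENNReal.ofReal_le_ofReal (h.trans ?_)
          rw [mul_comm]
          exact mul_le_mul_of_nonneg_right hx' (norm_nonneg _)
      _ = _ := by
          rw [lintegral_add_right _ measurable_const, lintegral_const_mul _ mR, setLIntegral_const]
          ring
  rw [setLIntegral_const]
  calc ‖A‖ₑ ^ 2 + ‖b‖ₑ ^ 2 = v⁻¹ * (v * (‖A‖ₑ ^ 2 + ‖b‖ₑ ^ 2)) := by
        rw [← mul_assoc, ENNReal.inv_mul_cancel hv0 hvt, one_mul]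
    _ = v⁻¹ * (‖A‖ₑ ^ 2 * v + ‖b‖ₑ ^ 2 * v) := by ring
    _ ≤ v⁻¹ * (‖A‖ₑ ^ 2 * v + (2 * I + 2 * ENNReal.ofReal M ^ 2 * (‖A‖ₑ ^ 2 * v))) :=
        mul_le_mul_right (add_le_add_right hb _) _
    _ = v⁻¹ * (2 * I + Q * (‖A‖ₑ ^ 2 * v)) := by rw [hQ]; ring
    _ ≤ v⁻¹ * ((2 + Q) * I + (2 + Q) * (‖A‖ₑ ^ 2 * v)) :=
        mul_le_mul_right (add_le_add (mul_le_mul_left le_self_add _)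
          (mul_le_mul_left le_add_self _)) _
    _ = _ := by ring

/-- Two Korn sets that share a ball can be glued: on this ball the two rigid displacements are close
to each other, hence so are their coefficients. -/
theorem IsKornSet.union {Ω S T : Set (Vec d)} (hS : IsKornSet Ω S) (hT : IsKornSet Ω T)
    (hTb : Bornology.IsBounded T) (hTm : MeasurableSet T) {x₀ : Vec d} {r : ℝ} (hr : 0 < r)
    (hball : Metric.ball x₀ r ⊆ S ∩ T) : IsKornSet Ω (S ∪ T) := by
  obtain ⟨C₁, hC₁, h₁⟩ := hS
  obtain ⟨C₂, hC₂, h₂⟩ := hT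
  obtain ⟨K₁, hK₁, k₁⟩ := exists_lintegral_rigid_le volume hTb hTm hTb.measure_lt_top.ne
  obtain ⟨K₂, hK₂, k₂⟩ := exists_coeff_le_lintegral_rigid x₀ hr
  refine ⟨C₁ + (2 * C₂ + 2 * (K₁ * (K₂ * (2 * C₁ + 2 * C₂)))), ?_, fun u hu => ?_⟩
  · have := ENNReal.mul_ne_top hK₁ (ENNReal.mul_ne_top hK₂ (ENNReal.add_ne_top.2
      ⟨ENNReal.mul_ne_top (a := 2) (by simp) hC₁, ENNReal.mul_ne_top (a := 2) (by simp) hC₂⟩))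
    exact ENNReal.add_ne_top.2 ⟨hC₁, ENNReal.add_ne_top.2
      ⟨ENNReal.mul_ne_top (by simp) hC₂, ENNReal.mul_ne_top (by simp) this⟩⟩
  obtain ⟨A, b, hA, hAb⟩ := h₁ u hu
  obtain ⟨A', b', hA', hAb'⟩ := h₂ u hu
  refine ⟨A, b, hA, ?_⟩
  set E := ∫⁻ x in Ω, ‖strain u x‖ₑ ^ 2 with hE
  have hcG := continuous_classicalGrad hu
  have mf : ∀ (A : Mat d) (b : Vec d), Measurable fun x => ‖u x - rigid A b x‖ₑ ^ 2 := fun A b =>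
    (hu.continuous.sub (contDiff_rigid A b).continuous).enorm.measurable.pow_const 2
  have mg : ∀ A : Mat d, Measurable fun x => ‖classicalGrad u x - A‖ₑ ^ 2 := fun A =>
    (hcG.sub continuous_const).enorm.measurable.pow_const 2
  have mr : ∀ (A : Mat d) (b : Vec d), Measurable fun x => ‖rigid A b x‖ₑ ^ 2 := fun A b =>
    (contDiff_rigid A b).continuous.enorm.measurable.pow_const 2
  have onball : ‖A' - A‖ₑ ^ 2 + ‖b' - b‖ₑ ^ 2 ≤ K₂ * ((2 * C₁ + 2 * C₂) * E) := by
    refine (k₂ (A' - A) (b' - b)).trans (mul_le_mul_right ?_ _)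
    have p1 : ∀ x, ‖rigid (A' - A) (b' - b) x‖ₑ ^ 2
        ≤ 2 * ‖u x - rigid A b x‖ₑ ^ 2 + 2 * ‖u x - rigid A' b' x‖ₑ ^ 2 := fun x => by
      have := enorm_sub_sq_le (u x - rigid A b x) (u x - rigid A' b' x)
      rwa [sub_sub_sub_cancel_left, rigid_sub_rigid] at this
    have p2 : ∀ x, ‖A' - A‖ₑ ^ 2
        ≤ 2 * ‖classicalGrad u x - A‖ₑ ^ 2 + 2 * ‖classicalGrad u x - A'‖ₑ ^ 2 := fun x => by
      have := enorm_sub_sq_le (classicalGrad u x - A) (classicalGrad u x - A')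
      rwa [sub_sub_sub_cancel_left] at this
    have i1 := lintegral_mono (μ := volume.restrict (Metric.ball x₀ r)) p1
    have i2 := lintegral_mono (μ := volume.restrict (Metric.ball x₀ r)) p2
    rw [lintegral_add_left ((mf A b).const_mul 2), lintegral_const_mul _ (mf A b),
      lintegral_const_mul _ (mf A' b')] at i1
    rw [lintegral_add_left ((mg A).const_mul 2), lintegral_const_mul _ (mg A),
      lintegral_const_mul _ (mg A')] at i2
    have onS := fun f : Vec d → ℝ≥0∞ => lintegral_mono_set (μ := volume) (f := f)
      (hball.trans Set.inter_subset_left)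
    have onT := fun f : Vec d → ℝ≥0∞ => lintegral_mono_set (μ := volume) (f := f)
      (hball.trans Set.inter_subset_right)
    calc _ ≤ (2 * (∫⁻ x in S, ‖u x - rigid A b x‖ₑ ^ 2)
            + 2 * (∫⁻ x in T, ‖u x - rigid A' b' x‖ₑ ^ 2))
          + (2 * (∫⁻ x in S, ‖classicalGrad u x - A‖ₑ ^ 2)
            + 2 * (∫⁻ x in T, ‖classicalGrad u x - A'‖ₑ ^ 2)) :=
          add_le_add (i1.trans (add_le_add (mul_le_mul_right (onS _) _)
            (mul_le_mul_right (onT _) _))) (i2.trans (add_le_add (mul_le_mul_right (onS _) _)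
            (mul_le_mul_right (onT _) _)))
      _ = 2 * ((∫⁻ x in S, ‖u x - rigid A b x‖ₑ ^ 2)
            + (∫⁻ x in S, ‖classicalGrad u x - A‖ₑ ^ 2))
          + 2 * ((∫⁻ x in T, ‖u x - rigid A' b' x‖ₑ ^ 2)
            + (∫⁻ x in T, ‖classicalGrad u x - A'‖ₑ ^ 2)) := by ring
      _ ≤ 2 * (C₁ * E) + 2 * (C₂ * E) :=
          add_le_add (mul_le_mul_right hAb _) (mul_le_mul_right hAb' _)
      _ = _ := by ring
  have onT : (∫⁻ x in T, ‖u x - rigid A b x‖ₑ ^ 2) + (∫⁻ x in T, ‖classicalGrad u x - A‖ₑ ^ 2)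
      ≤ (2 * C₂ + 2 * (K₁ * (K₂ * (2 * C₁ + 2 * C₂)))) * E := by
    have p1 : ∀ x, ‖u x - rigid A b x‖ₑ ^ 2
        ≤ 2 * ‖u x - rigid A' b' x‖ₑ ^ 2 + 2 * ‖rigid (A' - A) (b' - b) x‖ₑ ^ 2 := fun x => by
      have := enorm_add_sq_le (u x - rigid A' b' x) (rigid A' b' x - rigid A b x)
      rwa [sub_add_sub_cancel, rigid_sub_rigid] at this
    have p2 : ∀ x, ‖classicalGrad u x - A‖ₑ ^ 2
        ≤ 2 * ‖classicalGrad u x - A'‖ₑ ^ 2 + 2 * ‖A' - A‖ₑ ^ 2 := fun x => by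
      have := enorm_add_sq_le (classicalGrad u x - A') (A' - A)
      rwa [sub_add_sub_cancel] at this
    have i1 := lintegral_mono (μ := volume.restrict T) p1
    have i2 := lintegral_mono (μ := volume.restrict T) p2
    rw [lintegral_add_left ((mf A' b').const_mul 2), lintegral_const_mul _ (mf A' b'),
      lintegral_const_mul _ (mr _ _)] at i1
    rw [lintegral_add_left ((mg A').const_mul 2), lintegral_const_mul _ (mg A'),
      lintegral_const_mul _ measurable_const] at i2
    calc _ ≤ _ := add_le_add i1 i2
      _ = 2 * ((∫⁻ x in T, ‖u x - rigid A' b' x‖ₑ ^ 2)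
            + (∫⁻ x in T, ‖classicalGrad u x - A'‖ₑ ^ 2))
          + 2 * ((∫⁻ x in T, ‖rigid (A' - A) (b' - b) x‖ₑ ^ 2)
            + (∫⁻ _ in T, ‖A' - A‖ₑ ^ 2)) := by ring
      _ ≤ 2 * (C₂ * E) + 2 * (K₁ * (K₂ * ((2 * C₁ + 2 * C₂) * E))) :=
          add_le_add (mul_le_mul_right hAb' _) (mul_le_mul_right
            ((k₁ _ _).trans (mul_le_mul_right onball _)) _)
      _ = _ := by ring
  calc _ ≤ ((∫⁻ x in S, ‖u x - rigid A b x‖ₑ ^ 2) + (∫⁻ x in T, ‖u x - rigid A b x‖ₑ ^ 2))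
        + ((∫⁻ x in S, ‖classicalGrad u x - A‖ₑ ^ 2)
          + (∫⁻ x in T, ‖classicalGrad u x - A‖ₑ ^ 2)) :=
        add_le_add (lintegral_union_le _ _ _) (lintegral_union_le _ _ _)
    _ = ((∫⁻ x in S, ‖u x - rigid A b x‖ₑ ^ 2) + (∫⁻ x in S, ‖classicalGrad u x - A‖ₑ ^ 2))
        + ((∫⁻ x in T, ‖u x - rigid A b x‖ₑ ^ 2)
          + (∫⁻ x in T, ‖classicalGrad u x - A‖ₑ ^ 2)) := by ring
    _ ≤ _ := add_le_add hAb onT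
    _ = _ := by ring

/-- Every compact subset of a bounded domain lies in a Korn set: Korn sets with an open overlap can
be glued, and the domain is connected. -/
theorem exists_isKornSet_of_isCompact {Ω : Set (Vec d)} (hΩ : IsOpen Ω) (hconn : IsConnected Ω)
    (hb : Bornology.IsBounded Ω) {T : Set (Vec d)} (hT : IsCompact T) (hTΩ : T ⊆ Ω) :
    ∃ S, IsKornSet Ω S ∧ T ⊆ S := by
  have hr : ∀ x, ∃ r : ℝ, 0 < r ∧ (x ∈ Ω → Metric.ball x r ⊆ Ω) := by
    intro x
    by_cases hx : x ∈ Ω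
    · obtain ⟨r, hr, h⟩ := Metric.isOpen_iff.1 hΩ x hx
      exact ⟨r, hr, fun _ => h⟩
    · exact ⟨1, one_pos, fun h => absurd h hx⟩
  choose r hr0 hrΩ using hr
  set B : Vec d → Set (Vec d) := fun x => Metric.ball x (r x / 2) with hB
  have hBo : ∀ x, IsOpen (B x) := fun x => Metric.isOpen_ball
  have hxB : ∀ x, x ∈ B x := fun x => Metric.mem_ball_self (by have := hr0 x; positivity)
  have hBΩ : ∀ x ∈ Ω, B x ⊆ Ω := fun x hx =>
    (Metric.ball_subset_ball (by have := hr0 x; linarith)).trans (hrΩ x hx)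
  have hBK : ∀ x ∈ Ω, IsKornSet Ω (B x) := fun x hx => isKornSet_ball (hr0 x) (hrΩ x hx)
  have glue : ∀ {S S' : Set (Vec d)}, IsKornSet Ω S → IsKornSet Ω S' → IsOpen S → IsOpen S' →
      S' ⊆ Ω → ∀ z ∈ S, z ∈ S' → IsKornSet Ω (S ∪ S') := by
    intro S S' hS hS' hSo hSo' hsub z hz hz'
    obtain ⟨ρ, hρ, hball⟩ := Metric.isOpen_iff.1 (hSo.inter hSo') z ⟨hz, hz'⟩
    exact hS.union hS' (hb.subset hsub) hSo'.measurableSet hρ hball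
  obtain ⟨x₀, hx₀⟩ := hconn.nonempty
  let P : Vec d → Prop := fun y =>
    y ∈ Ω ∧ ∃ S, IsKornSet Ω S ∧ IsOpen S ∧ S ⊆ Ω ∧ B x₀ ⊆ S ∧ B y ⊆ S
  -- a point of `Ω` that shares a point with a Korn set reached so far can be reached as well
  have extend : ∀ y ∈ Ω, ∀ z, P z → (∃ q, q ∈ B z ∧ q ∈ B y) → P y := by
    rintro y hy z ⟨-, S, hS, hSo, hSΩ, h0, hz⟩ ⟨q, hqz, hqy⟩
    exact ⟨hy, S ∪ B y, glue hS (hBK y hy) hSo (hBo y) (hBΩ y hy) q (hz hqz) hqy,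
      hSo.union (hBo y), Set.union_subset hSΩ (hBΩ y hy), h0.trans Set.subset_union_left,
      Set.subset_union_right⟩
  -- the set of points reached is open and relatively closed
  have hall : Ω ⊆ {y | P y} := by
    refine hconn.isPreconnected.subset_of_closure_inter_subset ?_ ⟨x₀, hx₀, hx₀, B x₀, hBK x₀ hx₀,
      hBo x₀, hBΩ x₀ hx₀, subset_rfl, subset_rfl⟩ ?_
    · refine isOpen_iff_mem_nhds.2 fun y hy => ?_
      filter_upwards [(hBo y).mem_nhds (hxB y)] with z hz
      exact extend z (hBΩ y hy.1 hz) y hy ⟨z, hz, hxB z⟩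
    · rintro y ⟨hyc, hyΩ⟩
      obtain ⟨z, hzB, hz⟩ := mem_closure_iff.1 hyc (B y) (hBo y) (hxB y)
      exact extend y hyΩ z hz ⟨z, hxB z, hzB⟩
  obtain ⟨t, htT, htc⟩ := hT.elim_nhds_subcover B fun x _ => (hBo x).mem_nhds (hxB x)
  have fin : ∀ s : Finset (Vec d), (∀ x ∈ s, x ∈ Ω) → ∃ S, IsKornSet Ω S ∧ IsOpen S ∧ S ⊆ Ω ∧
      B x₀ ⊆ S ∧ ∀ x ∈ s, B x ⊆ S := by
    classical
    intro s
    induction s using Finset.induction_on with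
    | empty => exact fun _ => ⟨B x₀, hBK x₀ hx₀, hBo x₀, hBΩ x₀ hx₀, subset_rfl, by simp⟩
    | insert y s _ ih =>
      intro hs
      obtain ⟨S, hS, hSo, hSΩ, h0, hsS⟩ := ih fun x hx => hs x (Finset.mem_insert_of_mem hx)
      obtain ⟨-, S', hS', hSo', hSΩ', h0', hy'⟩ := hall (hs y (Finset.mem_insert_self y s))
      refine ⟨S ∪ S', glue hS hS' hSo hSo' hSΩ' x₀ (h0 (hxB x₀)) (h0' (hxB x₀)), hSo.union hSo',
        Set.union_subset hSΩ hSΩ', h0.trans Set.subset_union_left, fun x hx => ?_⟩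
      rcases Finset.mem_insert.1 hx with rfl | hx
      · exact hy'.trans Set.subset_union_right
      · exact (hsS x hx).trans Set.subset_union_left
  obtain ⟨S, hS, -, -, -, hsS⟩ := fin t fun x hx => hTΩ (htT x hx)
  exact ⟨S, hS, htc.trans (Set.iUnion₂_subset hsS)⟩

end KornSets

/-! ### Rigid displacements on the Dirichlet part -/

section DirichletRigid

variable {d : ℕ}

/-- Finitely many of the local boundary estimates cover the compact boundary. -/
theorem exists_global_boundary_estimate (hd : 1 ≤ d) {Ω : Set (Vec d)} (hΩ : IsOpen Ω)
    (hb : Bornology.IsBounded Ω) (hlip : HasLipschitzBoundary Ω) :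
    ∃ (V T : Set (Vec d)) (C : ℝ≥0∞), IsOpen V ∧ frontier Ω ⊆ V ∧ IsCompact T ∧ T ⊆ Ω ∧ C ≠ ⊤ ∧
      ∀ u : Vec d → Vec d, ContDiff ℝ ∞ u →
        (∫⁻ x in V ∩ Ω, ‖u x‖ₑ ^ 2) + (∫⁻ x in V ∩ Ω, ‖classicalGrad u x‖ₑ ^ 2)
          + (∫⁻ x in V, ‖u x‖ₑ ^ 2 ∂(bdryMeasure Ω))
        ≤ C * ((∫⁻ x in Ω, ‖strain u x‖ₑ ^ 2)
          + ((∫⁻ x in T, ‖u x‖ₑ ^ 2) + ∫⁻ x in T, ‖classicalGrad u x‖ₑ ^ 2)) := by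
  have hc : IsCompact (frontier Ω) := Metric.isCompact_of_isClosed_isBounded isClosed_frontier
    (hb.closure.subset frontier_subset_closure)
  refine hc.induction_on (p := fun F => ∃ (V T : Set (Vec d)) (C : ℝ≥0∞), IsOpen V ∧ F ⊆ V ∧
    IsCompact T ∧ T ⊆ Ω ∧ C ≠ ⊤ ∧ ∀ u : Vec d → Vec d, ContDiff ℝ ∞ u →
        (∫⁻ x in V ∩ Ω, ‖u x‖ₑ ^ 2) + (∫⁻ x in V ∩ Ω, ‖classicalGrad u x‖ₑ ^ 2)
          + (∫⁻ x in V, ‖u x‖ₑ ^ 2 ∂(bdryMeasure Ω))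
        ≤ C * ((∫⁻ x in Ω, ‖strain u x‖ₑ ^ 2)
          + ((∫⁻ x in T, ‖u x‖ₑ ^ 2) + ∫⁻ x in T, ‖classicalGrad u x‖ₑ ^ 2))) ?_ ?_ ?_ ?_
  · exact ⟨∅, ∅, 0, isOpen_empty, subset_rfl, isCompact_empty, Set.empty_subset _, by simp,
      fun u _ => by simp⟩
  · rintro s t hst ⟨V, T, C, h1, h2, h3⟩
    exact ⟨V, T, C, h1, hst.trans h2, h3⟩
  · rintro s t ⟨V, T, C, hV, hs, hT, hTΩ, hC, h⟩ ⟨V', T', C', hV', hs', hT', hTΩ', hC', h'⟩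
    refine ⟨V ∪ V', T ∪ T', C + C', hV.union hV', Set.union_subset_union hs hs', hT.union hT',
      Set.union_subset hTΩ hTΩ', ENNReal.add_ne_top.2 ⟨hC, hC'⟩, fun u hu => ?_⟩
    rw [Set.union_inter_distrib_right, add_mul]
    refine (add_le_add (add_le_add (lintegral_union_le _ _ _) (lintegral_union_le _ _ _))
      (lintegral_union_le _ _ _)).trans (le_trans (le_of_eq ?_) (add_le_add
        ((h u hu).trans (mul_le_mul_right (add_le_add_right (add_le_add
          (lintegral_mono_set Set.subset_union_left)
          (lintegral_mono_set Set.subset_union_left)) _) _))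
        ((h' u hu).trans (mul_le_mul_right (add_le_add_right (add_le_add
          (lintegral_mono_set Set.subset_union_right)
          (lintegral_mono_set Set.subset_union_right)) _) _))))
    ring
  · intro x hx
    obtain ⟨V, T, C, hV, hxV, hT⟩ := exists_boundary_estimate hd hΩ hlip hx
    exact ⟨V, mem_nhdsWithin_of_mem_nhds (hV.mem_nhds hxV), V, T, C, hV, subset_rfl, hT⟩

theorem restrict_bdryMeasure {Ω V : Set (Vec d)} (hV : frontier Ω ⊆ V) :
    (bdryMeasure Ω).restrict V = bdryMeasure Ω := by
  rw [bdryMeasure, Measure.restrict_restrict' isClosed_frontier.measurableSet,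
    Set.inter_eq_self_of_subset_right hV]

/-- The boundary of a bounded Lipschitz set has finite surface measure: the boundary estimate is
applied to a constant field. -/
theorem isFiniteMeasure_bdryMeasure (hd : 1 ≤ d) {Ω : Set (Vec d)} (hΩ : IsOpen Ω)
    (hb : Bornology.IsBounded Ω) (hlip : HasLipschitzBoundary Ω) :
    IsFiniteMeasure (bdryMeasure Ω) := by
  obtain ⟨V, T, C, -, hV, hT, -, hC, h⟩ := exists_global_boundary_estimate hd hΩ hb hlip
  have hu := h (rigid 0 (EuclideanSpace.single ⟨0, hd⟩ 1)) (contDiff_rigid _ _)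
  have e1 : ∀ x : Vec d,
      ‖rigid 0 (EuclideanSpace.single (⟨0, hd⟩ : Fin d) (1 : ℝ)) x‖ₑ ^ 2 = 1 := by
    intro x
    have : rigid 0 (EuclideanSpace.single (⟨0, hd⟩ : Fin d) (1 : ℝ)) x
        = EuclideanSpace.single ⟨0, hd⟩ 1 := by
      ext i; simp [rigid_apply]
    rw [this, ← ofReal_norm]
    simp
  have e2 : ∀ x : Vec d,
      ‖strain (rigid 0 (EuclideanSpace.single (⟨0, hd⟩ : Fin d) (1 : ℝ))) x‖ₑ ^ 2 = 0 := by
    intro x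
    have : strain (rigid 0 (EuclideanSpace.single (⟨0, hd⟩ : Fin d) (1 : ℝ))) x = 0 := by
      ext ij
      rw [← Prod.mk.eta (p := ij), strain_apply, classicalGrad_rigid]
      simp
    rw [this]; simp
  simp only [e1, e2, classicalGrad_rigid, enorm_zero, ne_eq, OfNat.ofNat_ne_zero, not_false_eq_true,
    zero_pow, lintegral_zero, add_zero, zero_add,
    restrict_bdryMeasure hV, lintegral_one] at hu
  exact ⟨(le_add_self.trans hu).trans_lt
    (ENNReal.mul_lt_top hC.lt_top (by
      rw [Measure.restrict_apply_univ]
      exact hT.measure_lt_top))⟩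

/-- Korn's inequality on a bounded Lipschitz domain, up to rigid displacements, with the trace. -/
theorem exists_rigid_domain (hd : 1 ≤ d) {Ω : Set (Vec d)} (hΩ : IsOpen Ω) (hconn : IsConnected Ω)
    (hb : Bornology.IsBounded Ω) (hlip : HasLipschitzBoundary Ω) :
    ∃ C : ℝ≥0∞, C ≠ ⊤ ∧ ∀ u : Vec d → Vec d, ContDiff ℝ ∞ u → ∃ (A : Mat d) (b : Vec d),
      IsSkew A ∧ (∫⁻ x in Ω, ‖u x - rigid A b x‖ₑ ^ 2)
        + (∫⁻ x in Ω, ‖classicalGrad u x - A‖ₑ ^ 2)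
        + (∫⁻ x, ‖u x - rigid A b x‖ₑ ^ 2 ∂(bdryMeasure Ω))
        ≤ C * ∫⁻ x in Ω, ‖strain u x‖ₑ ^ 2 := by
  obtain ⟨V, T, C, hVo, hV, hT, hTΩ, hC, h⟩ := exists_global_boundary_estimate hd hΩ hb hlip
  -- the boundary estimates apply in `V`, the rest of the domain is compact
  have hcl : IsCompact (closure Ω \ V) := Metric.isCompact_of_isClosed_isBounded
    (isClosed_closure.sdiff hVo) (hb.closure.subset Set.sdiff_subset)
  have hclΩ : closure Ω \ V ⊆ Ω := fun x hx => by
    by_contra hxΩ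
    exact hx.2 (hV ⟨hx.1, by rwa [hΩ.interior_eq]⟩)
  obtain ⟨S, ⟨C', hC', hS⟩, hTS⟩ := exists_isKornSet_of_isCompact hΩ hconn hb (hT.union hcl)
    (Set.union_subset hTΩ hclΩ)
  have hΩS : Ω ⊆ (V ∩ Ω) ∪ S := fun x hx => by
    by_cases hxV : x ∈ V
    · exact Or.inl ⟨hxV, hx⟩
    · exact Or.inr (hTS (Or.inr ⟨subset_closure hx, hxV⟩))
  refine ⟨C * (1 + C') + C', ENNReal.add_ne_top.2 ⟨ENNReal.mul_ne_top hC
    (ENNReal.add_ne_top.2 ⟨by simp, hC'⟩), hC'⟩, fun u hu => ?_⟩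
  obtain ⟨A, b, hA, hk⟩ := hS u hu
  refine ⟨A, b, hA, ?_⟩
  -- the boundary estimate for the field minus its rigid displacement, which has the same strain
  have hv := h _ (hu.sub (contDiff_rigid A b))
  simp only [strain_sub_rigid hu hA, classicalGrad_sub hu (contDiff_rigid A b),
    classicalGrad_rigid, restrict_bdryMeasure hV] at hv
  set E := ∫⁻ x in Ω, ‖strain u x‖ₑ ^ 2 with hE
  have onT : (∫⁻ x in T, ‖u x - rigid A b x‖ₑ ^ 2) + (∫⁻ x in T, ‖classicalGrad u x - A‖ₑ ^ 2)
      ≤ C' * E := by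
    have hTS' : T ⊆ S := Set.subset_union_left.trans hTS
    exact (add_le_add (lintegral_mono_set hTS') (lintegral_mono_set hTS')).trans hk
  have split : ∀ f : Vec d → ℝ≥0∞,
      ∫⁻ x in Ω, f x ≤ (∫⁻ x in V ∩ Ω, f x) + ∫⁻ x in S, f x := fun f =>
    (lintegral_mono_set hΩS).trans (lintegral_union_le _ _ _)
  calc _ ≤ ((∫⁻ x in V ∩ Ω, ‖u x - rigid A b x‖ₑ ^ 2) + ∫⁻ x in S, ‖u x - rigid A b x‖ₑ ^ 2)
        + ((∫⁻ x in V ∩ Ω, ‖classicalGrad u x - A‖ₑ ^ 2)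
          + ∫⁻ x in S, ‖classicalGrad u x - A‖ₑ ^ 2)
        + (∫⁻ x, ‖u x - rigid A b x‖ₑ ^ 2 ∂(bdryMeasure Ω)) :=
        add_le_add_left (add_le_add (split _) (split _)) _
    _ = ((∫⁻ x in V ∩ Ω, ‖u x - rigid A b x‖ₑ ^ 2)
          + (∫⁻ x in V ∩ Ω, ‖classicalGrad u x - A‖ₑ ^ 2)
          + (∫⁻ x, ‖u x - rigid A b x‖ₑ ^ 2 ∂(bdryMeasure Ω)))
        + ((∫⁻ x in S, ‖u x - rigid A b x‖ₑ ^ 2)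
          + ∫⁻ x in S, ‖classicalGrad u x - A‖ₑ ^ 2) := by ring
    _ ≤ C * (E + C' * E) + C' * E :=
        add_le_add (hv.trans (mul_le_mul_right (add_le_add_right onT _) _)) hk
    _ = _ := by ring

/-- The linear part of a rigid displacement, as a linear map. -/
def matLin (A : Mat d) : Vec d →ₗ[ℝ] Vec d where
  toFun := rigid A 0
  map_add' x y := by
    ext i; simp [rigid_apply, mul_add, Finset.sum_add_distrib]
  map_smul' c x := by
    ext i; simp [rigid_apply, Finset.mul_sum, mul_left_comm]

/-- A skew matrix is skew-adjoint. -/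
theorem inner_matLin_of_isSkew {A : Mat d} (hA : IsSkew A) (x y : Vec d) :
    inner ℝ (matLin A x) y = - inner ℝ x (matLin A y) := by
  simp only [matLin, LinearMap.coe_mk, AddHom.coe_mk, PiLp.inner_apply, rigid_apply,
    PiLp.zero_apply, add_zero, RCLike.inner_apply, conj_trivial, Finset.mul_sum, Finset.sum_mul,
    ← Finset.sum_neg_distrib]
  rw [Finset.sum_comm]
  refine Finset.sum_congr rfl fun j _ => Finset.sum_congr rfl fun i _ => ?_
  rw [hA i j]; ring

/-- A non-zero skew matrix has rank at least two: if `w = A v ≠ 0` then `A w` is non-zero and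
orthogonal to `w`. -/
theorem finrank_ker_matLin_add_two_le {A : Mat d} (hA : IsSkew A) (hA0 : A ≠ 0) :
    Module.finrank ℝ (LinearMap.ker (matLin A)) + 2 ≤ d := by
  obtain ⟨v, hv⟩ : ∃ v, matLin A v ≠ 0 := by
    by_contra! h
    refine hA0 ?_
    ext ij
    obtain ⟨i, j⟩ := ij
    have := congrArg (fun w : Vec d => w i) (h (EuclideanSpace.single j 1))
    simpa [matLin, rigid_apply] using this
  set w := matLin A v with hw
  have h1 : inner ℝ v (matLin A w) ≠ 0 := by
    have := inner_matLin_of_isSkew hA v w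
    rw [← hw] at this
    intro h0
    rw [h0, neg_zero] at this
    exact hv (inner_self_eq_zero.1 this)
  have h2 : matLin A w ≠ 0 := fun h0 => h1 (by rw [h0, inner_zero_right])
  have h3 : inner ℝ w (matLin A w) = 0 := by
    have := inner_matLin_of_isSkew hA w w
    rw [real_inner_comm] at this
    linarith
  have hli : LinearIndependent ℝ ![(⟨w, v, rfl⟩ : LinearMap.range (matLin A)),
      ⟨matLin A w, w, rfl⟩] := by
    rw [LinearIndependent.pair_iff]
    intro s t hst
    have hst' : s • w + t • matLin A w = 0 := congrArg Subtype.val hst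
    have i1 := congrArg (fun z => inner ℝ w z) hst'
    have i2 := congrArg (fun z => inner ℝ (matLin A w) z) hst'
    simp only [inner_add_right, inner_smul_right, h3, mul_zero, add_zero, inner_zero_right,
      real_inner_comm w, zero_add] at i1 i2
    refine ⟨?_, ?_⟩
    · exact (mul_eq_zero.1 i1).resolve_right fun h => hv (inner_self_eq_zero.1 h)
    · exact (mul_eq_zero.1 i2).resolve_right fun h => h2 (inner_self_eq_zero.1 h)
  have hr := hli.fintype_card_le_finrank
  have hk := (matLin A).finrank_range_add_finrank_ker
  rw [Fintype.card_fin] at hr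
  rw [finrank_euclideanSpace_fin] at hk
  omega

/-- A non-zero infinitesimal rigid displacement vanishes on an affine subspace of codimension at
least two, hence `ℋ^{d-1}`-almost nowhere. -/
theorem hausdorffMeasure_rigid_eq_zero (hd : 1 ≤ d) {A : Mat d} {b : Vec d} (hA : IsSkew A)
    (h : (A, b) ≠ 0) :
    (Measure.hausdorffMeasure ((d : ℝ) - 1) : Measure (Vec d)) {x | rigid A b x = 0} = 0 := by
  have hlin : ∀ x, rigid A b x = matLin A x + b := fun x => by
    ext i; simp [matLin, rigid_apply]
  rcases Set.eq_empty_or_nonempty {x | rigid A b x = 0} with he | ⟨x₀, hx₀⟩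
  · rw [he, measure_empty]
  have hx₀' : matLin A x₀ + b = 0 := by rw [← hlin]; exact hx₀
  have hA0 : A ≠ 0 := by
    rintro rfl
    refine h (Prod.ext rfl ?_)
    have : matLin (0 : Mat d) x₀ = 0 := by ext i; simp [matLin, rigid_apply]
    rwa [this, zero_add] at hx₀'
  have hfin := finrank_ker_matLin_add_two_le hA hA0
  have hiso : Isometry fun y : LinearMap.ker (matLin A) => (y : Vec d) + x₀ :=
    (isometry_add_right x₀).comp isometry_subtype_coe
  have hset : {x | rigid A b x = 0}
      ⊆ (fun y : LinearMap.ker (matLin A) => (y : Vec d) + x₀) '' Set.univ := by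
    intro x hx
    have hx' : matLin A x + b = 0 := by rw [← hlin]; exact hx
    refine ⟨⟨x - x₀, ?_⟩, trivial, sub_add_cancel _ _⟩
    rw [LinearMap.mem_ker, map_sub, sub_eq_zero]
    exact add_right_cancel (hx'.trans hx₀'.symm)
  refine measure_mono_null hset ?_
  have e : ((d : ℝ) - 1) = (((d - 1 : ℕ) : NNReal) : ℝ) := by
    rw [NNReal.coe_natCast, Nat.cast_sub hd, Nat.cast_one]
  rw [e]
  refine hausdorffMeasure_of_dimH_lt ?_
  rw [hiso.dimH_image, Real.dimH_univ_eq_finrank]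
  exact_mod_cast (by omega : Module.finrank ℝ (LinearMap.ker (matLin A)) < d - 1)

/-- On a boundary portion of positive measure, the coefficients of a rigid displacement are
controlled by its size. -/
theorem exists_coeff_le_lintegral_dirichlet (hd : 1 ≤ d) {Ω Γ : Set (Vec d)}
    [IsFiniteMeasure (bdryMeasure Ω)] (hΓ : IsCompact Γ) (hΓΩ : Γ ⊆ frontier Ω)
    (hpos : 0 < (Measure.hausdorffMeasure ((d : ℝ) - 1) : Measure (Vec d)) Γ) :
    ∃ K : ℝ≥0∞, K ≠ ⊤ ∧ ∀ (A : Mat d) (b : Vec d), IsSkew A →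
      ‖A‖ₑ ^ 2 + ‖b‖ₑ ^ 2 ≤ K * ∫⁻ x in Γ, ‖rigid A b x‖ₑ ^ 2 ∂(bdryMeasure Ω) := by
  have hpos' : bdryMeasure Ω Γ ≠ 0 := by
    rw [bdryMeasure, Measure.restrict_apply hΓ.measurableSet, Set.inter_eq_left.2 hΓΩ]
    exact hpos.ne'
  set g : Mat d × Vec d → ℝ := fun q => ∫ x in Γ, ‖rigid q.1 q.2 x‖ ^ 2 ∂(bdryMeasure Ω) with hg
  have hcr : Continuous fun q : (Mat d × Vec d) × Vec d => rigid q.1.1 q.1.2 q.2 := by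
    refine (PiLp.continuous_toLp 2 _).comp (continuous_pi fun i => ?_)
    fun_prop
  have hgc : Continuous g := by
    have : Continuous (Function.uncurry fun (q : Mat d × Vec d) (x : Vec d) =>
        ‖rigid q.1 q.2 x‖ ^ 2) := hcr.norm.pow 2
    exact continuous_parametric_integral_of_continuous this hΓ
  have hgi : ∀ q : Mat d × Vec d, Integrable (fun x => ‖rigid q.1 q.2 x‖ ^ 2)
      ((bdryMeasure Ω).restrict Γ) := fun q =>
    ((contDiff_rigid q.1 q.2).continuous.norm.pow 2).continuousOn.integrableOn_compact hΓ
  have hgpos : ∀ q : Mat d × Vec d, IsSkew q.1 → q ≠ 0 → 0 < g q := by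
    intro q hq hq0
    refine lt_of_le_of_ne (integral_nonneg fun x => by positivity) fun h0 => ?_
    have h1 := (integral_eq_zero_iff_of_nonneg (fun x => by positivity) (hgi q)).1 h0.symm
    have h2 : ∀ᵐ x ∂((bdryMeasure Ω).restrict Γ), x ∈ {x | rigid q.1 q.2 x = 0} := by
      filter_upwards [h1] with x hx
      simpa using hx
    have h3 : (bdryMeasure Ω).restrict Γ {x | rigid q.1 q.2 x = 0} = 0 := by
      refine le_antisymm ?_ zero_le
      calc _ ≤ bdryMeasure Ω {x | rigid q.1 q.2 x = 0} := Measure.restrict_apply_le _ _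
        _ ≤ _ := Measure.restrict_apply_le _ _
        _ = 0 := hausdorffMeasure_rigid_eq_zero hd hq hq0
    have h4 : (bdryMeasure Ω).restrict Γ Set.univ = 0 := by
      rw [← Set.union_compl_self {x | rigid q.1 q.2 x = 0}]
      exact measure_union_null h3 (ae_iff.1 h2)
    rw [Measure.restrict_apply_univ] at h4
    exact hpos' h4
  have hsk : IsClosed {q : Mat d × Vec d | IsSkew q.1} := by
    simp only [IsSkew, Set.ofPred_forall]
    refine isClosed_iInter fun i => isClosed_iInter fun j => isClosed_eq ?_ ?_ <;> fun_prop
  have hcomp : IsCompact ({q : Mat d × Vec d | IsSkew q.1} ∩ Metric.sphere 0 1) :=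
    (isCompact_sphere _ _).inter_left hsk
  -- by homogeneity a positive lower bound on the unit sphere suffices
  obtain ⟨m, hm, hmle⟩ := hcomp.exists_forall_le' hgc.continuousOn (a := 0) fun q hq =>
    hgpos q hq.1 (by
      rintro rfl
      simpa using hq.2)
  refine ⟨ENNReal.ofReal (2 / m), ENNReal.ofReal_ne_top, fun A b hA => ?_⟩
  have key : ‖A‖ ^ 2 + ‖b‖ ^ 2 ≤ 2 / m * g (A, b) := by
    set q : Mat d × Vec d := (A, b) with hq
    have hle : ‖A‖ ^ 2 + ‖b‖ ^ 2 ≤ 2 * ‖q‖ ^ 2 := by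
      have h1 : ‖A‖ ≤ ‖q‖ := norm_fst_le q
      have h2 : ‖b‖ ≤ ‖q‖ := norm_snd_le q
      have := pow_le_pow_left₀ (norm_nonneg _) h1 2
      have := pow_le_pow_left₀ (norm_nonneg _) h2 2
      linarith
    refine hle.trans ?_
    by_cases hq0 : q = 0
    · rw [hq0]
      have : 0 ≤ g 0 := integral_nonneg fun x => by positivity
      simp only [norm_zero, ne_eq, OfNat.ofNat_ne_zero, not_false_eq_true, zero_pow, mul_zero]
      positivity
    have hn : 0 < ‖q‖ := norm_pos_iff.2 hq0
    have h1 := hmle (‖q‖⁻¹ • q) ⟨fun i j => by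
      simp only [hq, Prod.smul_mk, PiLp.smul_apply, smul_eq_mul]; rw [hA i j]; ring, by
      rw [mem_sphere_zero_iff_norm, norm_smul, norm_inv, norm_norm, inv_mul_cancel₀ hn.ne']⟩
    have h2 : g (‖q‖⁻¹ • q) = (‖q‖⁻¹) ^ 2 * g q := by
      simp only [hg]
      rw [← integral_const_mul]
      refine integral_congr_ae (Eventually.of_forall fun x => ?_)
      have : rigid (‖q‖⁻¹ • q).1 (‖q‖⁻¹ • q).2 x = ‖q‖⁻¹ • rigid q.1 q.2 x := by
        ext i
        simp [rigid_apply, mul_add, Finset.mul_sum, mul_assoc]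
      simp only [this]
      rw [norm_smul, mul_pow, norm_inv, norm_norm]
    rw [h2] at h1
    have h3 : m * ‖q‖ ^ 2 ≤ g q := by
      have := mul_le_mul_of_nonneg_right h1 (sq_nonneg ‖q‖)
      rwa [inv_pow, mul_right_comm, inv_mul_cancel₀ (by positivity), one_mul] at this
    rw [div_mul_eq_mul_div, le_div_iff₀ hm]
    linarith
  have hge : ENNReal.ofReal (g (A, b)) = ∫⁻ x in Γ, ‖rigid A b x‖ₑ ^ 2 ∂(bdryMeasure Ω) := by
    rw [hg, ofReal_integral_eq_lintegral_ofReal (hgi (A, b))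
      (Eventually.of_forall fun x => by positivity)]
    simp only [ofReal_norm_sq]
  rw [← hge, ← ENNReal.ofReal_mul (by positivity), ← ofReal_norm_sq, ← ofReal_norm_sq,
    ← ENNReal.ofReal_add (by positivity) (by positivity)]
  exact ENNReal.ofReal_le_ofReal key

/-- Korn's inequality with boundary conditions, including the trace estimate. -/
theorem exists_korn_dirichlet (hd : 1 ≤ d) {Ω Γ : Set (Vec d)} (h : IsReferenceConfiguration Ω Γ) :
    ∃ C : ℝ≥0∞, C ≠ ⊤ ∧ ∀ u : Vec d → Vec d, ContDiff ℝ ∞ u →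
      (∫⁻ x in Ω, ‖u x‖ₑ ^ 2) + (∫⁻ x in Ω, ‖classicalGrad u x‖ₑ ^ 2)
        + (∫⁻ x, ‖u x‖ₑ ^ 2 ∂(bdryMeasure Ω))
      ≤ C * ((∫⁻ x in Ω, ‖strain u x‖ₑ ^ 2) + ∫⁻ x in Γ, ‖u x‖ₑ ^ 2 ∂(bdryMeasure Ω)) := by
  have := isFiniteMeasure_bdryMeasure hd h.isOpen h.isBounded h.lipschitz
  have hfr : Bornology.IsBounded (frontier Ω) := h.isBounded.closure.subset frontier_subset_closure
  obtain ⟨C, hC, hk⟩ := exists_rigid_domain hd h.isOpen h.isConnected h.isBounded h.lipschitz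
  obtain ⟨K, hK, hcoef⟩ := exists_coeff_le_lintegral_dirichlet hd
    (Metric.isCompact_of_isClosed_isBounded h.dirichlet_closed (hfr.subset h.dirichlet_subset))
    h.dirichlet_subset h.dirichlet_pos
  obtain ⟨K₁, hK₁, k₁⟩ := exists_lintegral_rigid_le volume h.isBounded h.isOpen.measurableSet
    h.isBounded.measure_lt_top.ne
  obtain ⟨K₂, hK₂, k₂⟩ := exists_lintegral_rigid_le (bdryMeasure Ω) hfr
    isClosed_frontier.measurableSet (measure_ne_top _ _)
  refine ⟨2 * C + 2 * ((K₁ + K₂) * (K * (2 * C + 2))), ?_, fun u hu => ?_⟩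
  · finiteness
  obtain ⟨A, b, hA, hAb⟩ := hk u hu
  set E := ∫⁻ x in Ω, ‖strain u x‖ₑ ^ 2 with hE
  set G := ∫⁻ x in Γ, ‖u x‖ₑ ^ 2 ∂(bdryMeasure Ω) with hG
  have mu : Measurable fun x => ‖u x‖ₑ ^ 2 := hu.continuous.enorm.measurable.pow_const 2
  have mf : Measurable fun x => ‖u x - rigid A b x‖ₑ ^ 2 :=
    (hu.continuous.sub (contDiff_rigid A b).continuous).enorm.measurable.pow_const 2
  have mg : Measurable fun x => ‖classicalGrad u x - A‖ₑ ^ 2 :=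
    ((continuous_classicalGrad hu).sub continuous_const).enorm.measurable.pow_const 2
  have coef : ‖A‖ₑ ^ 2 + ‖b‖ₑ ^ 2 ≤ K * ((2 * C + 2) * (E + G)) := by
    refine (hcoef A b hA).trans (mul_le_mul_right ?_ _)
    calc ∫⁻ x in Γ, ‖rigid A b x‖ₑ ^ 2 ∂(bdryMeasure Ω)
        ≤ ∫⁻ x in Γ, (2 * ‖u x‖ₑ ^ 2 + 2 * ‖u x - rigid A b x‖ₑ ^ 2) ∂(bdryMeasure Ω) := by
          refine lintegral_mono fun x => ?_
          have := enorm_sub_sq_le (u x) (u x - rigid A b x)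
          rwa [sub_sub_cancel] at this
      _ = 2 * G + 2 * ∫⁻ x in Γ, ‖u x - rigid A b x‖ₑ ^ 2 ∂(bdryMeasure Ω) := by
          rw [lintegral_add_left (mu.const_mul 2), lintegral_const_mul _ mu,
            lintegral_const_mul _ mf]
      _ ≤ 2 * G + 2 * (C * E) := by
          refine add_le_add_right (mul_le_mul_right ?_ _) _
          exact (setLIntegral_le_lintegral _ _).trans (le_add_self.trans hAb)
      _ ≤ (2 * G + 2 * (C * E)) + (2 * E + 2 * (C * G)) := le_self_add
      _ = _ := by ring
  have e1 : ∫⁻ x in Ω, ‖u x‖ₑ ^ 2 ≤ 2 * (∫⁻ x in Ω, ‖u x - rigid A b x‖ₑ ^ 2)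
      + 2 * ∫⁻ x in Ω, ‖rigid A b x‖ₑ ^ 2 := by
    rw [← lintegral_const_mul _ mf, ← lintegral_const_mul' _ _ (by simp),
      ← lintegral_add_left (mf.const_mul 2)]
    refine lintegral_mono fun x => ?_
    have := enorm_add_sq_le (u x - rigid A b x) (rigid A b x)
    rwa [sub_add_cancel] at this
  have e2 : ∫⁻ x in Ω, ‖classicalGrad u x‖ₑ ^ 2 ≤ 2 * (∫⁻ x in Ω, ‖classicalGrad u x - A‖ₑ ^ 2)
      + 2 * ∫⁻ _ in Ω, ‖A‖ₑ ^ 2 := by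
    rw [← lintegral_const_mul _ mg, ← lintegral_const_mul' _ _ (by simp),
      ← lintegral_add_left (mg.const_mul 2)]
    refine lintegral_mono fun x => ?_
    have := enorm_add_sq_le (classicalGrad u x - A) A
    rwa [sub_add_cancel] at this
  have e3 : ∫⁻ x, ‖u x‖ₑ ^ 2 ∂(bdryMeasure Ω)
      ≤ 2 * (∫⁻ x, ‖u x - rigid A b x‖ₑ ^ 2 ∂(bdryMeasure Ω))
      + 2 * ∫⁻ x in frontier Ω, ‖rigid A b x‖ₑ ^ 2 ∂(bdryMeasure Ω) := by
    rw [restrict_bdryMeasure subset_rfl, ← lintegral_const_mul _ mf,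
      ← lintegral_const_mul' _ _ (by simp), ← lintegral_add_left (mf.const_mul 2)]
    refine lintegral_mono fun x => ?_
    have := enorm_add_sq_le (u x - rigid A b x) (rigid A b x)
    rwa [sub_add_cancel] at this
  calc _ ≤ _ := add_le_add (add_le_add e1 e2) e3
    _ = 2 * ((∫⁻ x in Ω, ‖u x - rigid A b x‖ₑ ^ 2) + (∫⁻ x in Ω, ‖classicalGrad u x - A‖ₑ ^ 2)
          + (∫⁻ x, ‖u x - rigid A b x‖ₑ ^ 2 ∂(bdryMeasure Ω)))
        + 2 * (((∫⁻ x in Ω, ‖rigid A b x‖ₑ ^ 2) + ∫⁻ _ in Ω, ‖A‖ₑ ^ 2)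
          + ∫⁻ x in frontier Ω, ‖rigid A b x‖ₑ ^ 2 ∂(bdryMeasure Ω)) := by ring
    _ ≤ 2 * (C * E) + 2 * (K₁ * (K * ((2 * C + 2) * (E + G)))
          + K₂ * (K * ((2 * C + 2) * (E + G)))) :=
        add_le_add (mul_le_mul_right hAb _) (mul_le_mul_right (add_le_add
          ((k₁ A b).trans (mul_le_mul_right coef _))
          ((le_self_add.trans (k₂ A b)).trans (mul_le_mul_right coef _))) _)
    _ ≤ (2 * (C * E) + 2 * (K₁ * (K * ((2 * C + 2) * (E + G)))
          + K₂ * (K * ((2 * C + 2) * (E + G))))) + 2 * (C * G) := le_self_add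
    _ = _ := by ring

end DirichletRigid

/-! ### Weak gradients and traces as closed subspaces -/

section TraceSpace

variable {d : ℕ}

/-- Integration against a test function is an inner product in `L²`. -/
theorem exists_inner_eq_integral_mul {ι : Type} [Fintype ι] [DecidableEq ι] (O : Set (Vec d))
    {ψ : Vec d → ℝ} (hψ : Continuous ψ) (hc : HasCompactSupport ψ) (i : ι) :
    ∃ a : L2 O (EuclideanSpace ℝ ι), ∀ f : L2 O (EuclideanSpace ℝ ι),
      inner ℝ a f = ∫ x in O, f x i * ψ x := by
  have h : MemLp (fun x => EuclideanSpace.single i (ψ x)) 2 (volume.restrict O) := by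
    have h1 : Continuous fun x => EuclideanSpace.single i (ψ x) := by
      have : (fun x => EuclideanSpace.single i (ψ x))
          = fun x => ψ x • (EuclideanSpace.single i 1 : EuclideanSpace ℝ ι) := by
        funext x; ext j; simp [PiLp.single_apply]
      rw [this]
      exact hψ.smul continuous_const
    exact (h1.memLp_of_hasCompactSupport (hc.comp_left (g := EuclideanSpace.single i)
      (by simp))).restrict O
  refine ⟨h.toLp _, fun f => ?_⟩
  rw [L2.inner_def]
  refine integral_congr_ae ?_
  filter_upwards [h.coeFn_toLp] with x hx
  rw [hx, EuclideanSpace.inner_single_left, conj_trivial, mul_comm]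

/-- The pairing that defines the weak gradient, for one test function, is a continuous linear
functional. -/
theorem exists_clm_gradPairing (O : Set (Vec d)) {φ : Vec d → ℝ} (hφ : ContDiff ℝ ∞ φ)
    (hc : HasCompactSupport φ) (i j : Fin d) :
    ∃ L : (L2 O (Vec d) × L2 O (Mat d)) →L[ℝ] ℝ, ∀ t : L2 O (Vec d) × L2 O (Mat d),
      L t = (∫ x in O, t.1 x i * fderiv ℝ φ x (EuclideanSpace.single j 1))
        + ∫ x in O, t.2 x (i, j) * φ x := by
  obtain ⟨a, ha⟩ := exists_inner_eq_integral_mul O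
    (ψ := fun x => fderiv ℝ φ x (EuclideanSpace.single j 1))
    ((hφ.continuous_fderiv (by simp)).clm_apply continuous_const)
    (hc.fderiv_apply ℝ (EuclideanSpace.single j 1)) i
  obtain ⟨b, hb⟩ := exists_inner_eq_integral_mul O hφ.continuous hc (i, j)
  refine ⟨(innerSL ℝ a).coprod (innerSL ℝ b), fun t => ?_⟩
  rw [ContinuousLinearMap.coprod_apply, innerSL_apply_apply, innerSL_apply_apply, ha, hb]

theorem exists_clm_weakGrad (O : Set (Vec d)) {φ : Vec d → ℝ} (hφ : ContDiff ℝ ∞ φ)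
    (hc : HasCompactSupport φ) (i j : Fin d) :
    ∃ L : (L2 O (Vec d) × L2 O (Mat d)) →L[ℝ] ℝ, ∀ t : L2 O (Vec d) × L2 O (Mat d),
      (∫ x in O, t.1 x i * fderiv ℝ φ x (EuclideanSpace.single j 1)
        = - ∫ x in O, t.2 x (i, j) * φ x) ↔ L t = 0 := by
  obtain ⟨L, hL⟩ := exists_clm_gradPairing O hφ hc i j
  exact ⟨L, fun t => by rw [hL, eq_neg_iff_add_eq_zero]⟩

/-- The pairs `(u, ∇u)`, `u ∈ H¹`. -/
def weakGradGraph (O : Set (Vec d)) : Submodule ℝ (L2 O (Vec d) × L2 O (Mat d)) where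
  carrier := {t | HasWeakGrad O t.1 t.2}
  add_mem' := by
    intro s t hs ht φ hφ hc hO i j
    obtain ⟨L, hL⟩ := exists_clm_weakGrad O hφ hc i j
    rw [hL, map_add, (hL s).1 (hs φ hφ hc hO i j), (hL t).1 (ht φ hφ hc hO i j), add_zero]
  zero_mem' := by
    intro φ hφ hc hO i j
    obtain ⟨L, hL⟩ := exists_clm_weakGrad O hφ hc i j
    rw [hL, map_zero]
  smul_mem' := by
    intro c t ht φ hφ hc hO i j
    obtain ⟨L, hL⟩ := exists_clm_weakGrad O hφ hc i j
    rw [hL, map_smul, (hL t).1 (ht φ hφ hc hO i j), smul_zero]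

theorem mem_weakGradGraph {O : Set (Vec d)} {t : L2 O (Vec d) × L2 O (Mat d)} :
    t ∈ weakGradGraph O ↔ HasWeakGrad O t.1 t.2 := Iff.rfl

theorem isClosed_weakGradGraph (O : Set (Vec d)) :
    IsClosed (weakGradGraph O : Set (L2 O (Vec d) × L2 O (Mat d))) := by
  have : (weakGradGraph O : Set (L2 O (Vec d) × L2 O (Mat d)))
      = ⋂ (φ : Vec d → ℝ) (_ : ContDiff ℝ ∞ φ) (_ : HasCompactSupport φ) (_ : tsupport φ ⊆ O)
        (i : Fin d) (j : Fin d), {t | ∫ x in O, t.1 x i * fderiv ℝ φ x (EuclideanSpace.single j 1)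
        = - ∫ x in O, t.2 x (i, j) * φ x} := by
    ext t
    simp only [Set.mem_iInter]
    exact Iff.rfl
  rw [this]
  refine isClosed_iInter fun φ => isClosed_iInter fun hφ => isClosed_iInter fun hc =>
    isClosed_iInter fun _ => isClosed_iInter fun i => isClosed_iInter fun j => ?_
  obtain ⟨L, hL⟩ := exists_clm_weakGrad O hφ hc i j
  simp only [hL]
  exact isClosed_eq L.continuous continuous_const

/-- Weak gradients are unique. -/
theorem weakGrad_unique {O : Set (Vec d)} (hO : IsOpen O) {u : L2 O (Vec d)} {G G' : L2 O (Mat d)}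
    (h : HasWeakGrad O u G) (h' : HasWeakGrad O u G') : G = G' := by
  have hs : ((u, G) - (u, G') : L2 O (Vec d) × L2 O (Mat d)) ∈ weakGradGraph O :=
    Submodule.sub_mem _ (mem_weakGradGraph.2 h) (mem_weakGradGraph.2 h')
  rw [Prod.mk_sub_mk, sub_self] at hs
  have hs' := mem_weakGradGraph.1 hs
  have hz : ∀ i j, ∀ᵐ x ∂(volume : Measure (Vec d)),
      x ∈ O → (G - G' : L2 O (Mat d)) x (i, j) = 0 := by
    intro i j
    refine hO.ae_eq_zero_of_integral_contDiff_smul_eq_zero ?_ fun φ hφ hc hsub => ?_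
    · refine LocallyIntegrableOn.mono_set ?_ subset_rfl
      have hm : MemLp (fun x => (G - G' : L2 O (Mat d)) x (i, j)) 2 (volume.restrict O) :=
        (EuclideanSpace.proj (i, j) : Mat d →L[ℝ] ℝ).comp_memLp' (Lp.memLp (G - G'))
      intro x hx
      obtain ⟨r, hr, hrO⟩ := Metric.isOpen_iff.1 hO x hx
      refine ⟨Metric.ball x r, mem_nhdsWithin_of_mem_nhds (Metric.ball_mem_nhds x hr), ?_⟩
      have : IsFiniteMeasure (volume.restrict (Metric.ball x r)) :=
        isFiniteMeasure_restrict.2 measure_ball_lt_top.ne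
      exact (hm.mono_measure (Measure.restrict_mono hrO le_rfl)).integrable one_le_two
    · have h1 := hs' φ hφ hc hsub i j
      have h0 :
          ∫ x in O, (0 : L2 O (Vec d)) x i * fderiv ℝ φ x (EuclideanSpace.single j 1) = 0 := by
        refine integral_eq_zero_of_ae ?_
        filter_upwards [Lp.coeFn_zero (Vec d) 2 (volume.restrict O)] with x hx
        rw [hx]; simp
      simp only at h1
      rw [h0, eq_comm, neg_eq_zero] at h1
      rw [← setIntegral_eq_integral_of_forall_compl_eq_zero (s := O) fun x hx => by
        rw [image_eq_zero_of_notMem_tsupport fun h => hx (hsub h), zero_smul]]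
      rw [← h1]
      exact integral_congr_ae (Eventually.of_forall fun x => by simp [mul_comm])
  refine sub_eq_zero.1 (Lp.ext ?_)
  refine EventuallyEq.trans ?_ (Lp.coeFn_zero _ _ _).symm
  rw [EventuallyEq, ae_restrict_iff' hO.measurableSet]
  filter_upwards [ae_all_iff.2 fun i => ae_all_iff.2 (hz i)] with x hx hxO
  ext ij
  exact hx ij.1 ij.2 hxO

/-- Displacement, gradient and trace. -/
abbrev TraceSpace (Ω : Set (Vec d)) : Type :=
  L2 Ω (Vec d) × L2 Ω (Mat d) × Lp (Vec d) 2 (bdryMeasure Ω)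

/-- The triples `(φ, ∇φ, φ|_{∂Ω})` of smooth fields `φ` on the whole space. -/
def smoothTriples (Ω : Set (Vec d)) : Submodule ℝ (TraceSpace Ω) where
  carrier := {t | ∃ φ : Vec d → Vec d, ContDiff ℝ ∞ φ ∧ t.1 =ᵐ[volume.restrict Ω] φ ∧
    t.2.1 =ᵐ[volume.restrict Ω] classicalGrad φ ∧ t.2.2 =ᵐ[bdryMeasure Ω] φ}
  add_mem' := by
    rintro s t ⟨φ, hφ, h1, h2, h3⟩ ⟨ψ, hψ, k1, k2, k3⟩
    refine ⟨fun x => φ x + ψ x, hφ.add hψ, (Lp.coeFn_add _ _).trans (h1.add k1),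
      (Lp.coeFn_add _ _).trans ((h2.add k2).trans (.of_eq ?_)),
      (Lp.coeFn_add _ _).trans (h3.add k3)⟩
    funext x
    ext ij
    simp only [Pi.add_apply, classicalGrad]
    rw [fderiv_fun_add (hφ.differentiable (by simp) x) (hψ.differentiable (by simp) x)]
    simp
  zero_mem' := by
    refine ⟨fun _ => 0, contDiff_const, Lp.coeFn_zero _ _ _,
      (Lp.coeFn_zero _ _ _).trans (.of_eq ?_), Lp.coeFn_zero _ _ _⟩
    funext x
    ext ij
    simp [classicalGrad]
  smul_mem' := by
    rintro c t ⟨φ, hφ, h1, h2, h3⟩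
    refine ⟨fun x => c • φ x, hφ.const_smul c, (Lp.coeFn_smul _ _).trans (h1.const_smul c),
      (Lp.coeFn_smul _ _).trans ((h2.const_smul c).trans (.of_eq ?_)),
      (Lp.coeFn_smul _ _).trans (h3.const_smul c)⟩
    funext x
    ext ij
    simp only [Pi.smul_apply, classicalGrad]
    rw [fderiv_fun_const_smul (hφ.differentiable (by simp) x)]
    simp

theorem memLp_of_continuous_of_isBounded {F : Type*} [NormedAddCommGroup F] {f : Vec d → F}
    (hf : Continuous f) {μ : Measure (Vec d)} [IsFiniteMeasure μ] {S : Set (Vec d)}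
    (hS : Bornology.IsBounded S) (hμ : ∀ᵐ x ∂μ, x ∈ S) : MemLp f 2 μ := by
  obtain ⟨C, hC⟩ := hS.isCompact_closure.exists_bound_of_continuousOn hf.continuousOn
  refine MemLp.of_bound hf.aestronglyMeasurable C ?_
  filter_upwards [hμ] with x hx using hC x (subset_closure hx)

/-- The trace relation of `HasTrace` is membership in the closure of the smooth triples. -/
theorem hasTrace_iff {Ω : Set (Vec d)} [IsFiniteMeasure (volume.restrict Ω)]
    [IsFiniteMeasure (bdryMeasure Ω)] (hΩ : IsOpen Ω) (hb : Bornology.IsBounded Ω)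
    (u : L2 Ω (Vec d)) (g : Lp (Vec d) 2 (bdryMeasure Ω)) :
    HasTrace Ω u g ↔ ∃ G : L2 Ω (Mat d), HasWeakGrad Ω u G ∧
      ((u, G, g) : TraceSpace Ω) ∈ (smoothTriples Ω).topologicalClosure := by
  refine exists_congr fun G => and_congr_right fun _ => ?_
  rw [← SetLike.mem_coe, Submodule.topologicalClosure_coe, mem_closure_iff_seq_limit]
  constructor
  · rintro ⟨φ, hφ, h1, h2, h3⟩
    have m1 : ∀ n, MemLp (φ n) 2 (volume.restrict Ω) := fun n =>
      memLp_of_continuous_of_isBounded (hφ n).continuous hb (ae_restrict_mem hΩ.measurableSet)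
    have m2 : ∀ n, MemLp (classicalGrad (φ n)) 2 (volume.restrict Ω) := fun n =>
      memLp_of_continuous_of_isBounded (continuous_classicalGrad (hφ n)) hb
        (ae_restrict_mem hΩ.measurableSet)
    have m3 : ∀ n, MemLp (φ n) 2 (bdryMeasure Ω) := fun n =>
      memLp_of_continuous_of_isBounded (hφ n).continuous
        (hb.closure.subset frontier_subset_closure)
        (ae_restrict_mem isClosed_frontier.measurableSet)
    refine ⟨fun n => ((m1 n).toLp _, (m2 n).toLp _, (m3 n).toLp _), fun n => ⟨φ n, hφ n,
      (m1 n).coeFn_toLp, (m2 n).coeFn_toLp, (m3 n).coeFn_toLp⟩, ?_⟩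
    refine Tendsto.prodMk_nhds ?_ (Tendsto.prodMk_nhds ?_ ?_)
    · refine (Lp.tendsto_Lp_iff_tendsto_eLpNorm' _ _).2 (h1.congr fun n => eLpNorm_congr_ae ?_)
      filter_upwards [(m1 n).coeFn_toLp] with x hx
      simp [hx]
    · refine (Lp.tendsto_Lp_iff_tendsto_eLpNorm' _ _).2 (h2.congr fun n => eLpNorm_congr_ae ?_)
      filter_upwards [(m2 n).coeFn_toLp] with x hx
      simp [hx]
    · refine (Lp.tendsto_Lp_iff_tendsto_eLpNorm' _ _).2 (h3.congr fun n => eLpNorm_congr_ae ?_)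
      filter_upwards [(m3 n).coeFn_toLp] with x hx
      simp [hx]
  · rintro ⟨t, ht, hlim⟩
    choose φ hφ h1 h2 h3 using ht
    have l1 := (continuous_fst.tendsto _).comp hlim
    have l2 := ((continuous_fst.comp continuous_snd).tendsto _).comp hlim
    have l3 := ((continuous_snd.comp continuous_snd).tendsto _).comp hlim
    refine ⟨φ, hφ, ?_, ?_, ?_⟩
    · refine ((Lp.tendsto_Lp_iff_tendsto_eLpNorm' _ _).1 l1).congr fun n => eLpNorm_congr_ae ?_
      filter_upwards [h1 n] with x hx
      simp [hx]
    · refine ((Lp.tendsto_Lp_iff_tendsto_eLpNorm' _ _).1 l2).congr fun n => eLpNorm_congr_ae ?_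
      filter_upwards [h2 n] with x hx
      simp [hx]
    · refine ((Lp.tendsto_Lp_iff_tendsto_eLpNorm' _ _).1 l3).congr fun n => eLpNorm_congr_ae ?_
      filter_upwards [h3 n] with x hx
      simp [hx]

/-- The symmetric part, as a linear map. -/
def symPartL (d : ℕ) : Mat d →L[ℝ] Mat d :=
  LinearMap.toContinuousLinearMap
    { toFun := symPart, map_add' := symPart_add, map_smul' := symPart_smul }

/-- The pointwise symmetric part in `L²`. -/
def symL (Ω : Set (Vec d)) : L2 Ω (Mat d) →L[ℝ] L2 Ω (Mat d) :=
  (symPartL d).compLpL 2 (volume.restrict Ω)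

theorem coeFn_symL {Ω : Set (Vec d)} (G : L2 Ω (Mat d)) :
    symL Ω G =ᵐ[volume.restrict Ω] fun x => symPart (G x) :=
  (symPartL d).coeFn_compLpL G

/-- Restriction of boundary fields to `Γ`. -/
def bdryRestrict (Ω Γ : Set (Vec d)) :
    Lp (Vec d) 2 (bdryMeasure Ω) →L[ℝ] Lp (Vec d) 2 ((bdryMeasure Ω).restrict Γ) :=
  LpToLpRestrictCLM (Vec d) (Vec d) ℝ (bdryMeasure Ω) 2 Γ

theorem eLpNorm_two_sq {α F : Type*} [MeasurableSpace α] [NormedAddCommGroup F] (μ : Measure α)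
    (f : α → F) : eLpNorm f 2 μ ^ 2 = ∫⁻ x, ‖f x‖ₑ ^ 2 ∂μ := by
  have := eLpNorm_nnreal_pow_eq_lintegral (f := f) (μ := μ) (p := 2) (by norm_num)
  simpa using this

theorem enorm_Lp_sq {α F : Type*} [MeasurableSpace α] [NormedAddCommGroup F] {μ : Measure α}
    (f : Lp F 2 μ) : ‖f‖ₑ ^ 2 = ∫⁻ x, ‖f x‖ₑ ^ 2 ∂μ := by
  rw [Lp.enorm_def, eLpNorm_two_sq]

theorem norm_Lp_sq {α F : Type*} [MeasurableSpace α] [NormedAddCommGroup F] {μ : Measure α}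
    (f : Lp F 2 μ) : ENNReal.ofReal (‖f‖ ^ 2) = ∫⁻ x, ‖f x‖ₑ ^ 2 ∂μ := by
  rw [ofReal_norm_sq, enorm_Lp_sq]

/-- Korn's inequality with boundary conditions, extended to all fields with a trace. -/
theorem exists_korn_trace (hd : 1 ≤ d) {Ω Γ : Set (Vec d)} (h : IsReferenceConfiguration Ω Γ) :
    ∃ C : NNReal, ∀ t ∈ (smoothTriples Ω).topologicalClosure,
      ‖t‖ ≤ C * (‖symL Ω t.2.1‖ + ‖bdryRestrict Ω Γ t.2.2‖) := by
  obtain ⟨C, hC, hk⟩ := exists_korn_dirichlet hd h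
  lift C to NNReal using hC
  refine ⟨NNReal.sqrt C, fun t ht => ?_⟩
  refine closure_minimal (s := (smoothTriples Ω : Set (TraceSpace Ω)))
    (t := {t | ‖t‖ ≤ NNReal.sqrt C * (‖symL Ω t.2.1‖ + ‖bdryRestrict Ω Γ t.2.2‖)}) ?_ ?_ ht
  · rintro t ⟨φ, hφ, h1, h2, h3⟩
    have h := hk φ hφ
    have c1 : ∫⁻ x in Ω, ‖φ x‖ₑ ^ 2 = ENNReal.ofReal (‖t.1‖ ^ 2) := by
      rw [norm_Lp_sq]
      refine lintegral_congr_ae ?_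
      filter_upwards [h1] with x hx
      rw [hx]
    have c2 : ∫⁻ x in Ω, ‖classicalGrad φ x‖ₑ ^ 2 = ENNReal.ofReal (‖t.2.1‖ ^ 2) := by
      rw [norm_Lp_sq]
      refine lintegral_congr_ae ?_
      filter_upwards [h2] with x hx
      rw [hx]
    have c3 : ∫⁻ x, ‖φ x‖ₑ ^ 2 ∂(bdryMeasure Ω) = ENNReal.ofReal (‖t.2.2‖ ^ 2) := by
      rw [norm_Lp_sq]
      refine lintegral_congr_ae ?_
      filter_upwards [h3] with x hx
      rw [hx]
    have c4 : ∫⁻ x in Ω, ‖strain φ x‖ₑ ^ 2 = ENNReal.ofReal (‖symL Ω t.2.1‖ ^ 2) := by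
      rw [norm_Lp_sq]
      refine lintegral_congr_ae ?_
      filter_upwards [h2, coeFn_symL t.2.1] with x hx hx'
      rw [hx', hx, strain]
    have c5 : ∫⁻ x in Γ, ‖φ x‖ₑ ^ 2 ∂(bdryMeasure Ω)
        = ENNReal.ofReal (‖bdryRestrict Ω Γ t.2.2‖ ^ 2) := by
      rw [norm_Lp_sq]
      refine lintegral_congr_ae ?_
      filter_upwards [ae_restrict_of_ae h3, LpToLpRestrictCLM_coeFn ℝ Γ t.2.2] with x hx hx'
      rw [bdryRestrict, hx', hx]
    rw [c1, c2, c3, c4, c5, ← ENNReal.ofReal_add (by positivity) (by positivity),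
      ← ENNReal.ofReal_add (by positivity) (by positivity),
      ← ENNReal.ofReal_add (by positivity) (by positivity), ← ENNReal.ofReal_coe_nnreal,
      ← ENNReal.ofReal_mul (by positivity), ENNReal.ofReal_le_ofReal_iff (by positivity)] at h
    have hmax : ‖t‖ ^ 2 ≤ ‖t.1‖ ^ 2 + ‖t.2.1‖ ^ 2 + ‖t.2.2‖ ^ 2 := by
      rw [Prod.norm_def, Prod.norm_def]
      rcases max_cases ‖t.1‖ (max ‖t.2.1‖ ‖t.2.2‖) with ⟨e, -⟩ | ⟨e, -⟩ <;> rw [e]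
      · nlinarith [sq_nonneg ‖t.2.1‖, sq_nonneg ‖t.2.2‖]
      · rcases max_cases ‖t.2.1‖ ‖t.2.2‖ with ⟨e, -⟩ | ⟨e, -⟩ <;> rw [e] <;>
          nlinarith [sq_nonneg ‖t.2.1‖, sq_nonneg ‖t.2.2‖, sq_nonneg ‖t.1‖]
    refine le_of_sq_le_sq (hmax.trans (h.trans ?_)) (by positivity)
    rw [mul_pow, Real.coe_sqrt, Real.sq_sqrt C.coe_nonneg]
    refine mul_le_mul_of_nonneg_left ?_ C.coe_nonneg
    nlinarith [mul_nonneg (norm_nonneg (symL Ω t.2.1)) (norm_nonneg (bdryRestrict Ω Γ t.2.2))]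
  · refine isClosed_le continuous_norm (continuous_const.mul (Continuous.add ?_ ?_))
    · exact ((symL Ω).continuous.comp (continuous_fst.comp continuous_snd)).norm
    · exact ((bdryRestrict Ω Γ).continuous.comp (continuous_snd.comp continuous_snd)).norm

/-- The triples `(u, ∇u, trace of u)` with `u ∈ H¹(Ω)` and zero trace on `Γ`. -/
def zeroTraceGraph (Ω Γ : Set (Vec d)) : Submodule ℝ (TraceSpace Ω) :=
  (smoothTriples Ω).topologicalClosure
    ⊓ (weakGradGraph Ω).comap
      ((LinearMap.fst ℝ _ _).prod ((LinearMap.fst ℝ _ _).comp (LinearMap.snd ℝ _ _)))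
    ⊓ LinearMap.ker ((bdryRestrict Ω Γ).toLinearMap.comp
      ((LinearMap.snd ℝ _ _).comp (LinearMap.snd ℝ _ _)))

theorem mem_zeroTraceGraph {Ω Γ : Set (Vec d)} {t : TraceSpace Ω} : t ∈ zeroTraceGraph Ω Γ ↔
    (t ∈ (smoothTriples Ω).topologicalClosure ∧ HasWeakGrad Ω t.1 t.2.1) ∧
      bdryRestrict Ω Γ t.2.2 = 0 := Iff.rfl

theorem isClosed_zeroTraceGraph (Ω Γ : Set (Vec d)) :
    IsClosed (zeroTraceGraph Ω Γ : Set (TraceSpace Ω)) := by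
  refine ((Submodule.isClosed_topologicalClosure (smoothTriples Ω)).inter ?_).inter ?_
  · exact (isClosed_weakGradGraph Ω).preimage
      (continuous_fst.prodMk (continuous_fst.comp continuous_snd))
  · exact isClosed_eq ((bdryRestrict Ω Γ).continuous.comp (continuous_snd.comp continuous_snd))
      continuous_const

theorem bdryRestrict_eq_zero_iff {Ω Γ : Set (Vec d)} (hΓ : Γ ⊆ frontier Ω)
    (g : Lp (Vec d) 2 (bdryMeasure Ω)) : bdryRestrict Ω Γ g = 0 ↔
      ∀ᵐ x ∂((Measure.hausdorffMeasure ((d : ℝ) - 1) : Measure (Vec d)).restrict Γ), g x = 0 := by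
  have hμ : (bdryMeasure Ω).restrict Γ
      = (Measure.hausdorffMeasure ((d : ℝ) - 1) : Measure (Vec d)).restrict Γ := by
    rw [bdryMeasure, Measure.restrict_restrict_of_subset hΓ]
  have h := LpToLpRestrictCLM_coeFn ℝ (μ := bdryMeasure Ω) (p := 2) Γ g
  rw [Lp.eq_zero_iff_ae_eq_zero, ← hμ]
  constructor <;> intro h0
  · filter_upwards [h, h0] with x hx hx0
    rw [← hx]; exact hx0
  · filter_upwards [h, h0] with x hx hx0
    exact hx.trans hx0

/-- Equality on `Γ` in the sense of traces, expressed by membership of the difference in the closed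
space `zeroTraceGraph`. -/
theorem eqOnBdry_iff {Ω Γ : Set (Vec d)} [IsFiniteMeasure (volume.restrict Ω)]
    [IsFiniteMeasure (bdryMeasure Ω)] (hΩ : IsOpen Ω) (hb : Bornology.IsBounded Ω)
    (hΓ : Γ ⊆ frontier Ω) (u w : L2 Ω (Vec d)) :
    EqOnBdry Ω Γ u w ↔ ∃ t ∈ zeroTraceGraph Ω Γ, t.1 = u - w := by
  constructor
  · rintro ⟨g, hg, h0⟩
    obtain ⟨G, hG, hc⟩ := (hasTrace_iff hΩ hb _ _).1 hg
    exact ⟨(u - w, G, g), mem_zeroTraceGraph.2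
      ⟨⟨hc, hG⟩, (bdryRestrict_eq_zero_iff hΓ g).2 h0⟩, rfl⟩
  · rintro ⟨⟨v, G, g⟩, ht, hv⟩
    obtain ⟨⟨hc, hG⟩, h0⟩ := mem_zeroTraceGraph.1 ht
    simp only at hv hc hG h0
    subst hv
    exact ⟨g, (hasTrace_iff hΩ hb _ _).2 ⟨G, hG, hc⟩, (bdryRestrict_eq_zero_iff hΓ g).1 h0⟩

end TraceSpace

/-! ### The incremental functional -/

section Minimisation

/-- A continuous functional that is strongly midpoint convex and bounded below on a closed midpoint
convex set has exactly one minimiser there: minimising sequences are Cauchy. -/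
theorem existsUnique_isMinOn_of_midpoint {Y : Type*} [NormedAddCommGroup Y] [NormedSpace ℝ Y]
    [CompleteSpace Y] {D : Set Y} (hne : D.Nonempty) (hcl : IsClosed D)
    (hmid : ∀ a ∈ D, ∀ b ∈ D, (1 / 2 : ℝ) • (a + b) ∈ D) {F : Y → ℝ} (hF : Continuous F)
    {m₀ : ℝ} (hbdd : ∀ a, m₀ ≤ F a) {κ : ℝ} (hκ : 0 < κ)
    (hconv : ∀ a b, F ((1 / 2 : ℝ) • (a + b)) ≤ (F a + F b) / 2 - κ * ‖a - b‖ ^ 2) :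
    ∃! y, y ∈ D ∧ IsMinOn F D y := by
  have hb : BddBelow (F '' D) := ⟨m₀, by rintro _ ⟨a, -, rfl⟩; exact hbdd a⟩
  set m := sInf (F '' D) with hm
  have hle : ∀ a ∈ D, m ≤ F a := fun a ha => csInf_le hb ⟨a, ha, rfl⟩
  have hseq : ∀ n : ℕ, ∃ a ∈ D, F a < m + 1 / ((n : ℝ) + 1) := fun n => by
    obtain ⟨_, ⟨a, ha, rfl⟩, h⟩ := exists_lt_of_csInf_lt (hne.image F)
      (show sInf (F '' D) < m + 1 / ((n : ℝ) + 1) by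
        rw [← hm]
        linarith [Nat.one_div_pos_of_nat (α := ℝ) (n := n)])
    exact ⟨a, ha, h⟩
  choose a haD ha using hseq
  have hdist : ∀ k l n : ℕ, n ≤ k → n ≤ l →
      dist (a k) (a l) ≤ Real.sqrt (1 / ((n : ℝ) + 1) / κ) := by
    intro k l n hk hl
    refine Real.le_sqrt_of_sq_le ?_
    rw [le_div_iff₀ hκ, dist_eq_norm, mul_comm]
    have h1 := hle _ (hmid _ (haD k) _ (haD l))
    have h2 := hconv (a k) (a l)
    have h3 : 1 / ((k : ℝ) + 1) ≤ 1 / ((n : ℝ) + 1) := Nat.one_div_le_one_div hk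
    have h4 : 1 / ((l : ℝ) + 1) ≤ 1 / ((n : ℝ) + 1) := Nat.one_div_le_one_div hl
    linarith [ha k, ha l]
  have hlim : Tendsto (fun n : ℕ => Real.sqrt (1 / ((n : ℝ) + 1) / κ)) atTop (𝓝 0) := by
    have := ((tendsto_one_div_add_atTop_nhds_zero_nat (𝕜 := ℝ)).div_const κ).sqrt
    simpa using this
  obtain ⟨y, hy⟩ := cauchySeq_tendsto_of_complete (cauchySeq_of_le_tendsto_0 _ hdist hlim)
  have hyD : y ∈ D := hcl.mem_of_tendsto hy (Eventually.of_forall haD)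
  have hFy : F y ≤ m := by
    have h1 := (hF.tendsto y).comp hy
    have h2 : Tendsto (fun n : ℕ => m + 1 / ((n : ℝ) + 1)) atTop (𝓝 m) := by
      simpa using (tendsto_one_div_add_atTop_nhds_zero_nat (𝕜 := ℝ)).const_add m
    exact le_of_tendsto_of_tendsto' h1 h2 fun n => (ha n).le
  refine ⟨y, ⟨hyD, fun b hb => hFy.trans (hle b hb)⟩, ?_⟩
  rintro y' ⟨hyD', hmin'⟩
  have h1 := hle _ (hmid _ hyD' _ hyD)
  have h2 := hconv y' y
  have h3 : F y' ≤ F y := hmin' hyD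
  have h4 : ‖y' - y‖ ^ 2 ≤ 0 := by
    by_contra! h
    nlinarith
  exact sub_eq_zero.1 (norm_eq_zero.1 (pow_eq_zero_iff two_ne_zero |>.1
    (le_antisymm h4 (sq_nonneg _))))

theorem norm_sq_eq_integral {α E : Type*} [MeasurableSpace α] [NormedAddCommGroup E]
    {μ : Measure α} (u : Lp E 2 μ) : ‖u‖ ^ 2 = ∫ x, ‖u x‖ ^ 2 ∂μ := by
  have h : ∫ x, ‖u x‖ ^ 2 ∂μ = (∫⁻ x, ENNReal.ofReal (‖u x‖ ^ 2) ∂μ).toReal :=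
    integral_eq_lintegral_of_nonneg_ae (Eventually.of_forall fun x => by positivity)
      ((Lp.aestronglyMeasurable u).norm.pow 2)
  rw [h]
  simp only [ofReal_norm_sq]
  rw [← norm_Lp_sq, ENNReal.toReal_ofReal (by positivity)]

/-- Integral functionals with Lipschitz integrand are Lipschitz on `L²` of a finite measure. -/
theorem exists_lipschitzWith_integral_comp {α E : Type*} [MeasurableSpace α]
    [NormedAddCommGroup E] (μ : Measure α) [IsFiniteMeasure μ] {f : E → ℝ} {K : NNReal}
    (hf : LipschitzWith K f) : (∀ u : Lp E 2 μ, Integrable (fun x => f (u x)) μ) ∧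
      ∃ L : NNReal, LipschitzWith L fun u : Lp E 2 μ => ∫ x, f (u x) ∂μ := by
  have hg : LipschitzWith K fun a => f a - f 0 := by
    refine LipschitzWith.of_dist_le_mul fun x y => ?_
    rw [dist_sub_right]
    exact hf.dist_le_mul x y
  have hg0 : (fun a => f a - f 0) 0 = 0 := sub_self _
  have hi : ∀ u : Lp E 2 μ, Integrable (fun x => f (u x) - f 0) μ := fun u =>
    ((Lp.memLp (hg.compLp hg0 u)).integrable one_le_two).congr (hg.coeFn_compLp hg0 u)
  have hi' : ∀ u : Lp E 2 μ, Integrable (fun x => f (u x)) μ := fun u => by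
    have := (hi u).add (integrable_const (f 0))
    refine this.congr (Eventually.of_forall fun x => ?_)
    simp
  refine ⟨hi', ‖Lp.const 2 μ (1 : ℝ)‖₊ * K, LipschitzWith.of_dist_le_mul fun u v => ?_⟩
  have hrep : ∀ u : Lp E 2 μ, ∫ x, f (u x) ∂μ
      = inner ℝ (Lp.const 2 μ (1 : ℝ)) (hg.compLp hg0 u) + ∫ _, f 0 ∂μ := fun u => by
    rw [L2.inner_def]
    have : ∫ x, inner ℝ (Lp.const 2 μ (1 : ℝ) x) (hg.compLp hg0 u x) ∂μ
        = ∫ x, (f (u x) - f 0) ∂μ := by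
      refine integral_congr_ae ?_
      filter_upwards [Lp.coeFn_const 2 μ (1 : ℝ), hg.coeFn_compLp hg0 u] with x h1 h2
      rw [h1, h2]; simp
    rw [this, integral_sub (hi' u) (integrable_const _), sub_add_cancel]
  rw [hrep u, hrep v, dist_add_right, dist_eq_norm, ← inner_sub_right]
  refine (norm_inner_le_norm _ _).trans ?_
  rw [NNReal.coe_mul, coe_nnnorm, mul_assoc, dist_eq_norm]
  exact mul_le_mul_of_nonneg_left (hg.norm_compLp_sub_le hg0 u v) (norm_nonneg _)

/-- A pointwise midpoint inequality for the integrand passes to the integral functional. -/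
theorem integral_comp_midpoint_le {α E : Type*} [MeasurableSpace α] [NormedAddCommGroup E]
    [NormedSpace ℝ E] (μ : Measure α) [IsFiniteMeasure μ] {f : E → ℝ} {K : NNReal}
    (hf : LipschitzWith K f) {k : ℝ}
    (hmid : ∀ a b, f ((1 / 2 : ℝ) • (a + b)) ≤ (f a + f b) / 2 + k * ‖a - b‖ ^ 2)
    (u v : Lp E 2 μ) : ∫ x, f (((1 / 2 : ℝ) • (u + v) : Lp E 2 μ) x) ∂μ
      ≤ ((∫ x, f (u x) ∂μ) + ∫ x, f (v x) ∂μ) / 2 + k * ‖u - v‖ ^ 2 := by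
  have hi := (exists_lipschitzWith_integral_comp μ hf).1
  have hn : Integrable (fun x => ‖(u - v : Lp E 2 μ) x‖ ^ 2) μ :=
    (Lp.memLp (u - v)).norm.integrable_sq
  have h1 : Integrable (fun x => (f (u x) + f (v x)) / 2) μ := ((hi u).add (hi v)).div_const 2
  have h2 : Integrable (fun x => k * ‖(u - v : Lp E 2 μ) x‖ ^ 2) μ := hn.const_mul k
  rw [norm_sq_eq_integral, ← integral_const_mul, ← integral_add (hi u) (hi v), ← integral_div,
    ← integral_add h1 h2]
  refine integral_mono_ae (hi _) (h1.add h2) ?_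
  filter_upwards [Lp.coeFn_smul (1 / 2 : ℝ) (u + v), Lp.coeFn_add u v, Lp.coeFn_sub u v]
    with x e1 e2 e3
  rw [e1, Pi.smul_apply, e2, e3]
  exact hmid _ _

variable {d : ℕ}

/-- A pair of `L²` functions as one `L²` function. -/
def pairL (Ω : Set (Vec d)) (E E' : Type) [NormedAddCommGroup E] [NormedSpace ℝ E]
    [NormedAddCommGroup E'] [NormedSpace ℝ E'] : (L2 Ω E × L2 Ω E') →L[ℝ] L2 Ω (E × E') :=
  ((ContinuousLinearMap.inl ℝ E E').compLpL 2 (volume.restrict Ω)).coprod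
    ((ContinuousLinearMap.inr ℝ E E').compLpL 2 (volume.restrict Ω))

theorem coeFn_pairL {Ω : Set (Vec d)} {E E' : Type} [NormedAddCommGroup E] [NormedSpace ℝ E]
    [NormedAddCommGroup E'] [NormedSpace ℝ E'] (p : L2 Ω E) (z : L2 Ω E') :
    pairL Ω E E' (p, z) =ᵐ[volume.restrict Ω] fun x => (p x, z x) := by
  have e : pairL Ω E E' (p, z)
      = (ContinuousLinearMap.inl ℝ E E').compLpL 2 (volume.restrict Ω) p
        + (ContinuousLinearMap.inr ℝ E E').compLpL 2 (volume.restrict Ω) z := rfl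
  rw [e]
  filter_upwards [Lp.coeFn_add ((ContinuousLinearMap.inl ℝ E E').compLpL 2 (volume.restrict Ω) p)
    ((ContinuousLinearMap.inr ℝ E E').compLpL 2 (volume.restrict Ω) z),
    (ContinuousLinearMap.inl ℝ E E').coeFn_compLpL p,
    (ContinuousLinearMap.inr ℝ E E').coeFn_compLpL z] with x h1 h2 h3
  rw [h1, Pi.add_apply, h2, h3]
  simp

/-! ### Properties of the constitutive functions -/

/-- The support function is non-negative because `0 ∈ K`, Lipschitz because `K` is bounded, and
convex as a supremum of linear functions. -/
theorem exists_supportFn_bounds {K : Set (MDev d × ℝ)} (hK : IsConstraintSet K) :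
    (∀ ξ θ, 0 ≤ supportFn K ξ θ) ∧
    (∃ L : NNReal, LipschitzWith L fun q : MDev d × ℝ => supportFn K q.1 q.2) ∧
    ∀ a b : MDev d × ℝ, supportFn K ((1 / 2 : ℝ) • (a + b)).1 ((1 / 2 : ℝ) • (a + b)).2
      ≤ (supportFn K a.1 a.2 + supportFn K b.1 b.2) / 2 := by
  obtain ⟨A, B, hA, hAB, hin, hout⟩ := hK.bounds
  have h0 : ((0 : MDev d), (0 : ℝ)) ∈ K := hin 0 0 (by simp; positivity)
  have hB : 0 ≤ B := hA.le.trans hAB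
  have hle : ∀ q ∈ K, ∀ a : MDev d × ℝ, inner ℝ q.1 a.1 + q.2 * a.2 ≤ B * 2 * ‖a‖ := by
    rintro ⟨σ, ζ⟩ hq a
    have h := hout σ ζ hq
    have h1 : ‖σ‖ ≤ B := le_of_sq_le_sq (by nlinarith [sq_nonneg |ζ|]) hB
    have h2 : |ζ| ≤ B := le_of_sq_le_sq (by nlinarith [sq_nonneg ‖σ‖]) hB
    have h3 : inner ℝ σ a.1 ≤ B * ‖a‖ := (real_inner_le_norm _ _).trans
      (mul_le_mul h1 (norm_fst_le a) (norm_nonneg _) hB)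
    have h4 : ζ * a.2 ≤ B * ‖a‖ := (le_abs_self _).trans (by
      rw [abs_mul]
      exact mul_le_mul h2 (norm_snd_le a) (abs_nonneg _) hB)
    simp only
    linarith
  have hbd : ∀ a : MDev d × ℝ,
      BddAbove ((fun q : MDev d × ℝ => inner ℝ q.1 a.1 + q.2 * a.2) '' K) := fun a =>
    ⟨B * 2 * ‖a‖, by rintro _ ⟨q, hq, rfl⟩; exact hle q hq a⟩
  have hne : ∀ a : MDev d × ℝ,
      ((fun q : MDev d × ℝ => inner ℝ q.1 a.1 + q.2 * a.2) '' K).Nonempty := fun a =>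
    ⟨_, _, h0, rfl⟩
  have hmem : ∀ a : MDev d × ℝ, ∀ q ∈ K, inner ℝ q.1 a.1 + q.2 * a.2 ≤ supportFn K a.1 a.2 :=
    fun a q hq => le_csSup (hbd a) ⟨q, hq, rfl⟩
  refine ⟨fun ξ θ => ?_, ⟨⟨B * 2, by positivity⟩, ?_⟩, fun a b => ?_⟩
  · simpa using hmem (ξ, θ) _ h0
  · refine LipschitzWith.of_le_add_mul _ fun a b => csSup_le (hne a) ?_
    rintro _ ⟨q, hq, rfl⟩
    have h1 := hle q hq (a - b)
    have h2 := hmem b q hq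
    have e : inner ℝ q.1 (a - b).1 = inner ℝ q.1 a.1 - inner ℝ q.1 b.1 :=
      inner_sub_right q.1 a.1 b.1
    rw [e, Prod.snd_sub, mul_sub] at h1
    rw [dist_eq_norm]
    change inner ℝ q.1 a.1 + q.2 * a.2 ≤ supportFn K b.1 b.2 + B * 2 * ‖a - b‖
    linarith
  · refine csSup_le (hne ((1 / 2 : ℝ) • (a + b))) ?_
    rintro _ ⟨q, hq, rfl⟩
    have h1 := hmem a q hq
    have h2 := hmem b q hq
    have e1 : inner ℝ q.1 ((1 / 2 : ℝ) • (a + b)).1 = 1 / 2 * inner ℝ q.1 (a + b).1 :=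
      real_inner_smul_right q.1 (a + b).1 (1 / 2)
    have e2 : inner ℝ q.1 (a + b).1 = inner ℝ q.1 a.1 + inner ℝ q.1 b.1 :=
      inner_add_right q.1 a.1 b.1
    simp only [e1, e2, Prod.smul_snd, Prod.snd_add, smul_eq_mul]
    linarith

/-- The softening potential is Lipschitz, since `V'` is monotone with finite limits, and its failure
of midpoint convexity is at most quadratic, since `V'' ≥ -M`. -/
theorem exists_softening_bounds {K : Set (MDev d × ℝ)} {V : ℝ → ℝ} {M : ℝ}
    (hV : IsSofteningPotential K V M) : (∃ L : NNReal, LipschitzWith L V) ∧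
    ∀ s t : ℝ, V ((1 / 2 : ℝ) • (s + t)) ≤ (V s + V t) / 2 + M / 8 * ‖s - t‖ ^ 2 := by
  have hd1 : Differentiable ℝ V := hV.contDiff.differentiable (by norm_num)
  have hd2 : Differentiable ℝ (deriv V) := by
    have : ContDiff ℝ 1 (deriv V) := by
      have h := hV.contDiff
      rw [show (2 : WithTop ℕ∞) = 1 + 1 from by norm_num, contDiff_succ_iff_deriv] at h
      exact h.2.2
    exact this.differentiable (by norm_num)
  obtain ⟨vp, vm, hvp, hvm, -⟩ := hV.limits
  -- `V'` is non-increasing, hence lies between its two limits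
  have hanti := antitone_of_deriv_nonpos hd2 fun x => (hV.second_deriv x).2
  refine ⟨⟨Real.toNNReal (|vp| + |vm|), lipschitzWith_of_nnnorm_deriv_le hd1 fun x => ?_⟩,
    fun s t => ?_⟩
  · rw [← NNReal.coe_le_coe, coe_nnnorm, Real.coe_toNNReal _ (by positivity), Real.norm_eq_abs]
    have h1 := hanti.le_of_tendsto hvp x
    have h2 := hanti.ge_of_tendsto hvm x
    rw [abs_le]
    constructor
    · linarith [neg_abs_le vp, abs_nonneg vm]
    · linarith [le_abs_self vm, abs_nonneg vp]
  · -- adding the quadratic term restores convexity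
    have e1 : deriv (fun θ => V θ + M / 2 * θ ^ 2) = fun θ => deriv V θ + M * θ := by
      funext θ
      rw [deriv_fun_add (hd1 θ) (by fun_prop), deriv_const_mul _ (by fun_prop)]
      simp
      ring
    have hc : ConvexOn ℝ Set.univ fun θ => V θ + M / 2 * θ ^ 2 := by
      refine convexOn_univ_of_deriv2_nonneg (hd1.add (by fun_prop)) ?_ fun x => ?_
      · rw [e1]; exact hd2.add (by fun_prop)
      · rw [Function.iterate_succ, Function.iterate_one, Function.comp_apply, e1,
          deriv_fun_add (hd2 x) (by fun_prop), deriv_const_mul _ (by fun_prop)]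
        simp only [deriv_id'', mul_one]
        linarith [(hV.second_deriv x).1]
    have h := hc.2 (Set.mem_univ s) (Set.mem_univ t) (show (0 : ℝ) ≤ 1 / 2 by norm_num)
      (show (0 : ℝ) ≤ 1 / 2 by norm_num) (by norm_num)
    simp only [smul_eq_mul] at h ⊢
    rw [← mul_add] at h
    rw [Real.norm_eq_abs, sq_abs]
    nlinarith

/-- A positive definite operator on a finite-dimensional space is coercive. -/
theorem exists_coercive {H : Type*} [NormedAddCommGroup H] [InnerProductSpace ℝ H]
    [FiniteDimensional ℝ H] (C : H →ₗ[ℝ] H) (hC : ∀ ξ, ξ ≠ 0 → 0 < inner ℝ (C ξ) ξ) :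
    ∃ c : ℝ, 0 < c ∧ ∀ ξ, c * ‖ξ‖ ^ 2 ≤ inner ℝ (C ξ) ξ := by
  have : ProperSpace H := FiniteDimensional.proper ℝ H
  have hcont : Continuous fun ξ : H => inner ℝ (C ξ) ξ :=
    (LinearMap.continuous_of_finiteDimensional C).inner continuous_id
  obtain ⟨c, hc, h⟩ := (isCompact_sphere (0 : H) 1).exists_forall_le' hcont.continuousOn
    (a := 0) fun ξ hξ => hC ξ (by
      rintro rfl
      simp at hξ)
  refine ⟨c, hc, fun ξ => ?_⟩
  by_cases h0 : ξ = 0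
  · simp [h0]
  have hn : 0 < ‖ξ‖ := norm_pos_iff.2 h0
  have h1 := h (‖ξ‖⁻¹ • ξ) (by
    rw [mem_sphere_zero_iff_norm, norm_smul, norm_inv, norm_norm, inv_mul_cancel₀ hn.ne'])
  rw [map_smul, inner_smul_left, inner_smul_right, conj_trivial] at h1
  have h2 := mul_le_mul_of_nonneg_right h1 (sq_nonneg ‖ξ‖)
  refine h2.trans (le_of_eq ?_)
  field_simp

theorem continuous_quadratic {H : Type*} [NormedAddCommGroup H] [InnerProductSpace ℝ H]
    (T : H →L[ℝ] H) : Continuous fun e => inner ℝ (T e) e :=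
  T.continuous.inner continuous_id

theorem quadratic_midpoint {H : Type*} [NormedAddCommGroup H] [InnerProductSpace ℝ H]
    (T : H →L[ℝ] H) (e e' : H) :
    inner ℝ (T ((1 / 2 : ℝ) • (e + e'))) ((1 / 2 : ℝ) • (e + e'))
      = (inner ℝ (T e) e + inner ℝ (T e') e') / 2 - 1 / 4 * inner ℝ (T (e - e')) (e - e') := by
  simp only [map_smul, map_add, map_sub, inner_smul_left, inner_smul_right, inner_add_left,
    inner_add_right, inner_sub_left, inner_sub_right, conj_trivial]
  ring

theorem elasticEnergy_eq_inner {Ω : Set (Vec d)} (C : MSym d →ₗ[ℝ] MSym d) (e : L2 Ω (MSym d)) :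
    elasticEnergy C e = 1 / 2 * inner ℝ
      ((LinearMap.toContinuousLinearMap C).compLpL 2 (volume.restrict Ω) e) e := by
  rw [elasticEnergy, integral_const_mul, L2.inner_def]
  congr 1
  refine integral_congr_ae ?_
  filter_upwards [(LinearMap.toContinuousLinearMap C).coeFn_compLpL e] with x hx
  rw [hx]
  rfl

theorem elasticEnergy_midpoint_le {Ω : Set (Vec d)} {C : MSym d →ₗ[ℝ] MSym d} {c : ℝ}
    (hc : ∀ ξ, c * ‖ξ‖ ^ 2 ≤ inner ℝ (C ξ) ξ) (e e' : L2 Ω (MSym d)) :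
    elasticEnergy C ((1 / 2 : ℝ) • (e + e'))
      ≤ (elasticEnergy C e + elasticEnergy C e') / 2 - c / 8 * ‖e - e'‖ ^ 2 := by
  have hco : c * ‖e - e'‖ ^ 2 ≤ inner ℝ
      ((LinearMap.toContinuousLinearMap C).compLpL 2 (volume.restrict Ω) (e - e')) (e - e') := by
    rw [norm_sq_eq_integral, ← integral_const_mul, L2.inner_def]
    refine integral_mono_ae ((Lp.memLp (e - e')).norm.integrable_sq.const_mul c)
      (L2.integrable_inner _ _) ?_
    filter_upwards [(LinearMap.toContinuousLinearMap C).coeFn_compLpL (e - e')] with x hx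
    rw [hx]
    exact hc _
  have h := quadratic_midpoint
    ((LinearMap.toContinuousLinearMap C).compLpL 2 (volume.restrict Ω)) e e'
  simp only [elasticEnergy_eq_inner, h]
  linarith

theorem norm_midpoint_sub_sq {H : Type*} [NormedAddCommGroup H] [InnerProductSpace ℝ H]
    (p p' p₀ : H) : ‖(1 / 2 : ℝ) • (p + p') - p₀‖ ^ 2
      = (‖p - p₀‖ ^ 2 + ‖p' - p₀‖ ^ 2) / 2 - 1 / 4 * ‖p - p'‖ ^ 2 := by
  have h := parallelogram_law_with_norm ℝ (p - p₀) (p' - p₀)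
  have e1 : p - p₀ + (p' - p₀) = (2 : ℝ) • ((1 / 2 : ℝ) • (p + p') - p₀) := by
    rw [smul_sub, smul_smul, two_smul]; norm_num; abel
  rw [e1, norm_smul, sub_sub_sub_cancel_right] at h
  norm_num at h ⊢
  linarith

/-- The sum of a strongly convex energy, a convex dissipation, a mildly concave softening energy and
quadratic viscous terms is continuous, bounded below and strongly midpoint convex: the viscous terms
dominate the concavity of the softening energy. -/
theorem exists_energy_bounds {E P Z : Type*} [NormedAddCommGroup E] [InnerProductSpace ℝ E]
    [NormedAddCommGroup P] [InnerProductSpace ℝ P] [NormedAddCommGroup Z] [InnerProductSpace ℝ Z]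
    {Q : E → ℝ} {R : P × Z → ℝ} {W : Z → ℝ} (p₀ : P) (z₀ : Z) {c k η : ℝ} {L : NNReal}
    (hQc : Continuous Q) (hQ0 : ∀ e, 0 ≤ Q e)
    (hQ : ∀ e e', Q ((1 / 2 : ℝ) • (e + e')) ≤ (Q e + Q e') / 2 - c * ‖e - e'‖ ^ 2)
    (hRc : Continuous R) (hR0 : ∀ q, 0 ≤ R q)
    (hR : ∀ q q', R ((1 / 2 : ℝ) • (q + q')) ≤ (R q + R q') / 2) (hWc : LipschitzWith L W)
    (hW : ∀ z z', W ((1 / 2 : ℝ) • (z + z')) ≤ (W z + W z') / 2 + k * ‖z - z'‖ ^ 2)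
    (hc : 0 < c) (hη : 0 < η) (hk : k < η / 4) :
    let F : E × P × Z → ℝ := fun y => Q y.1 + R (y.2.1 - p₀, y.2.2 - z₀) + W y.2.2
      + η * ‖y.2.1 - p₀‖ ^ 2 + η * ‖y.2.2 - z₀‖ ^ 2
    Continuous F ∧ (∃ m₀, ∀ y, m₀ ≤ F y) ∧
    ∃ κ : ℝ, 0 < κ ∧ ∀ a b, F ((1 / 2 : ℝ) • (a + b)) ≤ (F a + F b) / 2 - κ * ‖a - b‖ ^ 2 := by
  intro F
  refine ⟨?_, ?_, min c (min (η / 4) (η / 4 - k)), ?_, ?_⟩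
  · have hWc' := hWc.continuous
    fun_prop
  · refine ⟨W z₀ - L ^ 2 / (4 * η), fun y => ?_⟩
    have h3 : W z₀ - L * ‖y.2.2 - z₀‖ ≤ W y.2.2 := by
      have := hWc.dist_le_mul y.2.2 z₀
      rw [Real.dist_eq, dist_eq_norm] at this
      have := (abs_le.1 this).1
      linarith
    have h4 : L * ‖y.2.2 - z₀‖ ≤ L ^ 2 / (4 * η) + η * ‖y.2.2 - z₀‖ ^ 2 := by
      set r := ‖y.2.2 - z₀‖
      have e : L ^ 2 / (4 * η) + η * r ^ 2 - L * r = η * (r - L / (2 * η)) ^ 2 := by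
        field_simp
        ring
      have : 0 ≤ η * (r - L / (2 * η)) ^ 2 := by positivity
      linarith
    have h5 : 0 ≤ η * ‖y.2.1 - p₀‖ ^ 2 := by positivity
    have := hQ0 y.1
    have := hR0 (y.2.1 - p₀, y.2.2 - z₀)
    simp only [F]
    linarith
  · have : 0 < η / 4 - k := by linarith
    positivity
  · intro a b
    set κ := min c (min (η / 4) (η / 4 - k)) with hκ
    have k1 : κ ≤ c := min_le_left _ _
    have k2 : κ ≤ η / 4 := (min_le_right _ _).trans (min_le_left _ _)
    have k3 : κ ≤ η / 4 - k := (min_le_right _ _).trans (min_le_right _ _)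
    have hκ0 : 0 ≤ κ := by
      have : 0 < η / 4 - k := by linarith
      positivity
    have i1 := hQ a.1 b.1
    have i2 := hR (a.2.1 - p₀, a.2.2 - z₀) (b.2.1 - p₀, b.2.2 - z₀)
    have i3 := hW a.2.2 b.2.2
    have i4 := norm_midpoint_sub_sq a.2.1 b.2.1 p₀
    have i5 := norm_midpoint_sub_sq a.2.2 b.2.2 z₀
    have e2 : (1 / 2 : ℝ) • ((a.2.1 - p₀, a.2.2 - z₀) + (b.2.1 - p₀, b.2.2 - z₀))
        = ((1 / 2 : ℝ) • (a.2.1 + b.2.1) - p₀, (1 / 2 : ℝ) • (a.2.2 + b.2.2) - z₀) := by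
      refine Prod.ext ?_ ?_ <;> simp only [Prod.smul_fst, Prod.smul_snd, Prod.fst_add, Prod.snd_add]
        <;> module
    rw [e2] at i2
    have hmax : ‖a - b‖ ^ 2 ≤ ‖a.1 - b.1‖ ^ 2 + ‖a.2.1 - b.2.1‖ ^ 2 + ‖a.2.2 - b.2.2‖ ^ 2 := by
      rw [Prod.norm_def, Prod.norm_def]
      simp only [Prod.fst_sub, Prod.snd_sub]
      rcases max_cases ‖a.1 - b.1‖ (max ‖a.2.1 - b.2.1‖ ‖a.2.2 - b.2.2‖) with ⟨e, -⟩ | ⟨e, -⟩ <;>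
        rw [e]
      · nlinarith [sq_nonneg ‖a.2.1 - b.2.1‖, sq_nonneg ‖a.2.2 - b.2.2‖]
      · rcases max_cases ‖a.2.1 - b.2.1‖ ‖a.2.2 - b.2.2‖ with ⟨e, -⟩ | ⟨e, -⟩ <;> rw [e] <;>
          nlinarith [sq_nonneg ‖a.2.1 - b.2.1‖, sq_nonneg ‖a.2.2 - b.2.2‖,
            sq_nonneg ‖a.1 - b.1‖]
    have j := mul_le_mul_of_nonneg_left hmax hκ0
    have j1 := mul_le_mul_of_nonneg_right k1 (sq_nonneg ‖a.1 - b.1‖)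
    have j2 := mul_le_mul_of_nonneg_right k2 (sq_nonneg ‖a.2.1 - b.2.1‖)
    have j3 := mul_le_mul_of_nonneg_right k3 (sq_nonneg ‖a.2.2 - b.2.2‖)
    simp only [F, Prod.smul_fst, Prod.smul_snd, Prod.fst_add, Prod.snd_add]
    rw [i4, i5]
    linarith

/-- The incremental functional is continuous, bounded below and strongly midpoint convex in
`(e, p, z)`, because `M < ε / τ`. -/
theorem exists_incrementalEnergy_bounds {Ω : Set (Vec d)} [IsFiniteMeasure (volume.restrict Ω)]
    {K : Set (MDev d × ℝ)} (hK : IsConstraintSet K)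
    {C : MSym d →ₗ[ℝ] MSym d} (hC : IsElasticityTensor C)
    {V : ℝ → ℝ} {M : ℝ} (hV : IsSofteningPotential K V M)
    {ε τ : ℝ} (hε : 0 < ε) (hτ : 0 < τ) (hτM : 0 < M → τ < ε / M)
    (p₀ : L2 Ω (MDev d)) (z₀ : L2 Ω ℝ) :
    (Continuous fun y : L2 Ω (MSym d) × L2 Ω (MDev d) × L2 Ω ℝ =>
      incrementalEnergy C K V ε τ p₀ z₀ (0, y)) ∧
    (∃ m₀, ∀ y : L2 Ω (MSym d) × L2 Ω (MDev d) × L2 Ω ℝ,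
      m₀ ≤ incrementalEnergy C K V ε τ p₀ z₀ (0, y)) ∧
    ∃ κ : ℝ, 0 < κ ∧ ∀ a b : L2 Ω (MSym d) × L2 Ω (MDev d) × L2 Ω ℝ,
      incrementalEnergy C K V ε τ p₀ z₀ (0, (1 / 2 : ℝ) • (a + b))
        ≤ (incrementalEnergy C K V ε τ p₀ z₀ (0, a) + incrementalEnergy C K V ε τ p₀ z₀ (0, b)) / 2
          - κ * ‖a - b‖ ^ 2 := by
  obtain ⟨hH0, ⟨LH, hLH⟩, hHmid⟩ := exists_supportFn_bounds hK
  obtain ⟨⟨LV, hLV⟩, hVmid⟩ := exists_softening_bounds hV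
  obtain ⟨c, hc, hcC⟩ := exists_coercive C hC.posDef
  obtain ⟨L₁, hL₁⟩ := (exists_lipschitzWith_integral_comp (volume.restrict Ω) hLH).2
  obtain ⟨L₂, hL₂⟩ := (exists_lipschitzWith_integral_comp (volume.restrict Ω) hLV).2
  have hdiss : (fun q : L2 Ω (MDev d) × L2 Ω ℝ => dissipation K q.1 q.2)
      = (fun u : L2 Ω (MDev d × ℝ) => ∫ x in Ω, (fun q : MDev d × ℝ => supportFn K q.1 q.2) (u x))
        ∘ pairL Ω (MDev d) ℝ := by
    funext q
    refine integral_congr_ae ?_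
    filter_upwards [coeFn_pairL q.1 q.2] with x hx
    rw [hx]
  -- the two modulus constants of `V` and of the viscous term, compared: `M < ε / τ`
  have hεM : M / 8 < ε / (2 * τ) / 4 := by
    have : 0 < ε / τ - M := by
      rcases hV.nonneg.eq_or_lt with h | h
      · rw [← h, sub_zero]; positivity
      · rw [sub_pos, lt_div_iff₀ hτ, mul_comm]
        exact (lt_div_iff₀ h).1 (hτM h)
    have e : ε / (2 * τ) / 4 = ε / τ / 8 := by field_simp; norm_num
    rw [e]
    linarith
  have c1 : Continuous fun e : L2 Ω (MSym d) => elasticEnergy C e := by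
    have := continuous_quadratic (H := L2 Ω (MSym d))
      ((LinearMap.toContinuousLinearMap C).compLpL 2 (volume.restrict Ω))
    simp only [elasticEnergy_eq_inner]
    exact continuous_const.mul this
  have c2 : Continuous fun q : L2 Ω (MDev d) × L2 Ω ℝ => dissipation K q.1 q.2 := by
    rw [hdiss]
    exact hL₁.continuous.comp (pairL Ω (MDev d) ℝ).continuous
  refine exists_energy_bounds (Q := elasticEnergy C)
    (R := fun q : L2 Ω (MDev d) × L2 Ω ℝ => dissipation K q.1 q.2) p₀ z₀ c1 (fun e => ?_)
    (elasticEnergy_midpoint_le hcC) c2 (fun q => integral_nonneg fun x => hH0 _ _) (fun q q' => ?_)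
    hL₂ (integral_comp_midpoint_le (volume.restrict Ω) hLV hVmid) (by positivity) (by positivity)
    hεM
  · refine integral_nonneg fun x => ?_
    have h1 := hcC (e x)
    have h2 : 0 ≤ c * ‖e x‖ ^ 2 := by positivity
    exact mul_nonneg (by norm_num) (h2.trans h1)
  · have h := integral_comp_midpoint_le (volume.restrict Ω) hLH (k := 0)
      (fun q q' => by rw [zero_mul, add_zero]; exact hHmid q q')
      (pairL Ω (MDev d) ℝ q) (pairL Ω (MDev d) ℝ q')
    rw [← map_add, ← map_smul, zero_mul, add_zero] at h
    have hd := congrFun hdiss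
    rw [hd ((1 / 2 : ℝ) • (q + q')), hd q, hd q']
    exact h

/-! ### Minimisers over affine classes of displacements -/

/-- Symmetric-matrix-valued functions as matrix-valued functions. -/
def incSym (Ω : Set (Vec d)) : L2 Ω (MSym d) →L[ℝ] L2 Ω (Mat d) :=
  (symSubmodule d).subtypeL.compLpL 2 (volume.restrict Ω)

/-- Deviatoric-matrix-valued functions as matrix-valued functions. -/
def incDev (Ω : Set (Vec d)) : L2 Ω (MDev d) →L[ℝ] L2 Ω (Mat d) :=
  (devSubmodule d).subtypeL.compLpL 2 (volume.restrict Ω)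

/-- The symmetric part with values in the symmetric matrices. -/
def symPartS (d : ℕ) : Mat d →L[ℝ] MSym d :=
  (symPartL d).codRestrict (symSubmodule d) fun G i j => by
    change symPart G (i, j) = symPart G (j, i)
    rw [symPart_apply, symPart_apply, add_comm]

theorem exists_incSym_eq {Ω : Set (Vec d)} (G : L2 Ω (Mat d)) :
    ∃ e : L2 Ω (MSym d), incSym Ω e = symL Ω G := by
  refine ⟨(symPartS d).compLpL 2 (volume.restrict Ω) G, Lp.ext ?_⟩
  filter_upwards [(symSubmodule d).subtypeL.coeFn_compLpL
    ((symPartS d).compLpL 2 (volume.restrict Ω) G), (symPartS d).coeFn_compLpL G, coeFn_symL G]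
    with x h1 h2 h3
  rw [h3, incSym, h1, h2]
  rfl

theorem symL_eq_iff {Ω : Set (Vec d)} (G : L2 Ω (Mat d)) (e : L2 Ω (MSym d)) (p : L2 Ω (MDev d)) :
    symL Ω G = incSym Ω e + incDev Ω p ↔
      ∀ᵐ x ∂(volume.restrict Ω), symPart (G x) = (e x : Mat d) + (p x : Mat d) := by
  have h1 := coeFn_symL G
  have h2 := (symSubmodule d).subtypeL.coeFn_compLpL e
  have h3 := (devSubmodule d).subtypeL.coeFn_compLpL p
  have h4 := Lp.coeFn_add (incSym Ω e) (incDev Ω p)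
  rw [Lp.ext_iff]
  constructor <;> intro h
  · filter_upwards [h1, h2, h3, h4, h] with x k1 k2 k3 k4 k
    rw [← k1, k, k4, Pi.add_apply, incSym, incDev, k2, k3]
    rfl
  · filter_upwards [h1, h2, h3, h4, h] with x k1 k2 k3 k4 k
    rw [k1, k, k4, Pi.add_apply, incSym, incDev, k2, k3]
    rfl

/-- The triples `(u, e, p)` with `u ∈ w + N` and `Eu = e + p`, where `N` is a space of fields with
their gradients and traces, and `Gw` is the gradient of `w`. -/
def affineClass {Ω : Set (Vec d)} (N : Submodule ℝ (TraceSpace Ω)) (w : L2 Ω (Vec d))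
    (Gw : L2 Ω (Mat d)) : Set (L2 Ω (Vec d) × L2 Ω (MSym d) × L2 Ω (MDev d)) :=
  {a | ∃ t ∈ N, a.1 = w + t.1 ∧ symL Ω (Gw + t.2.1) = incSym Ω a.2.1 + incDev Ω a.2.2}

/-- Minimisation of a strongly midpoint convex functional of `y` under a linear constraint that
couples `y` to an element of a closed subspace `N` through an operator bounded below on `N`. -/
theorem existsUnique_constrained_min {T G U Y : Type*} [NormedAddCommGroup T] [NormedSpace ℝ T]
    [CompleteSpace T] [NormedAddCommGroup G] [NormedSpace ℝ G] [AddGroup U]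
    [NormedAddCommGroup Y] [NormedSpace ℝ Y] [CompleteSpace Y] {N : Submodule ℝ T}
    (hNc : IsClosed (N : Set T)) {S : T →L[ℝ] G} {c : NNReal} (hN : ∀ t ∈ N, ‖t‖ ≤ c * ‖S t‖)
    (π : T → U) (w : U) (B : Y →L[ℝ] G) (g : G) {y₀ : Y} (hy₀ : B y₀ = g) {F : Y → ℝ}
    (hF : Continuous F) {m₀ : ℝ} (hm₀ : ∀ y, m₀ ≤ F y) {κ : ℝ} (hκ : 0 < κ)
    (hconv : ∀ a b, F ((1 / 2 : ℝ) • (a + b)) ≤ (F a + F b) / 2 - κ * ‖a - b‖ ^ 2) :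
    let A : Set (U × Y) := {q | ∃ t ∈ N, q.1 = w + π t ∧ g + S t = B q.2}
    ∃! q : U × Y, q ∈ A ∧ IsMinOn (fun q => F q.2) A q := by
  intro A
  let S' : N →L[ℝ] G := S.comp N.subtypeL
  have : CompleteSpace N := hNc.completeSpace_coe
  have hanti : AntilipschitzWith c S' := S'.antilipschitz_of_bound fun t => hN t t.2
  -- the admissible `y` are those with `B y - g` in the range of the strain on `N`, which is closed
  have hrange : IsClosed (Set.range S') := hanti.isClosed_range S'.uniformContinuous
  have hBc : Continuous fun y => B y - g := by fun_prop
  have hmem : ∀ q : U × Y, q ∈ A ↔ ∃ t : N, S' t = B q.2 - g ∧ q.1 = w + π t := by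
    intro q
    constructor
    · rintro ⟨t, ht, h1, h2⟩
      exact ⟨⟨t, ht⟩, eq_sub_of_add_eq' h2, h1⟩
    · rintro ⟨t, h1, h2⟩
      exact ⟨t, t.2, h2, add_eq_of_eq_sub' h1⟩
  obtain ⟨y, ⟨⟨t, ht⟩, hymin⟩, hyu⟩ := existsUnique_isMinOn_of_midpoint
    (D := (fun y => B y - g) ⁻¹' Set.range S') ⟨y₀, 0, by simp [hy₀]⟩ (hrange.preimage hBc) (by
      rintro a ⟨s, hs⟩ b ⟨t, ht⟩
      refine ⟨(1 / 2 : ℝ) • (s + t), ?_⟩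
      rw [map_smul, map_add, hs, ht]
      simp only [map_smul, map_add]
      module) hF hm₀ hκ hconv
  refine ⟨(w + π t, y), ⟨(hmem _).2 ⟨t, ht, rfl⟩, fun q hq => ?_⟩, ?_⟩
  · obtain ⟨s, hs, -⟩ := (hmem q).1 hq
    exact hymin ⟨s, hs⟩
  · rintro ⟨u', y'⟩ ⟨hq, hqmin⟩
    obtain ⟨s, hs, hu⟩ := (hmem _).1 hq
    have hy' : y' = y := hyu y' ⟨⟨s, hs⟩, fun b ⟨r, hr⟩ =>
      hqmin (show (w + π r, b) ∈ A from (hmem _).2 ⟨r, hr, rfl⟩)⟩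
    subst hy'
    have hst : s = t := hanti.injective (hs.trans ht.symm)
    subst hst
    exact Prod.ext hu rfl

/-- The strain of the field in a triple. -/
def tripleStrain (Ω : Set (Vec d)) : TraceSpace Ω →L[ℝ] L2 Ω (Mat d) :=
  (symL Ω).comp ((ContinuousLinearMap.fst ℝ _ _).comp (ContinuousLinearMap.snd ℝ _ _))

/-- The total strain `e + p`, as a function of `(e, p, z)`. -/
def totalStrain (Ω : Set (Vec d)) :
    (L2 Ω (MSym d) × L2 Ω (MDev d) × L2 Ω ℝ) →L[ℝ] L2 Ω (Mat d) :=
  (incSym Ω).coprod ((incDev Ω).comp (ContinuousLinearMap.fst ℝ _ _))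

theorem totalStrain_apply {Ω : Set (Vec d)} (y : L2 Ω (MSym d) × L2 Ω (MDev d) × L2 Ω ℝ) :
    totalStrain Ω y = incSym Ω y.1 + incDev Ω y.2.1 := rfl

/-- Existence and uniqueness for any affine class on which Korn's inequality holds. -/
theorem existsUnique_minimiser_affineClass {Ω : Set (Vec d)} [IsFiniteMeasure (volume.restrict Ω)]
    {N : Submodule ℝ (TraceSpace Ω)} (hNc : IsClosed (N : Set (TraceSpace Ω))) {c : NNReal}
    (hN : ∀ t ∈ N, ‖t‖ ≤ c * ‖symL Ω t.2.1‖) (w : L2 Ω (Vec d)) (Gw : L2 Ω (Mat d))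
    {K : Set (MDev d × ℝ)} (hK : IsConstraintSet K)
    {C : MSym d →ₗ[ℝ] MSym d} (hC : IsElasticityTensor C)
    {V : ℝ → ℝ} {M : ℝ} (hV : IsSofteningPotential K V M)
    {ε τ : ℝ} (hε : 0 < ε) (hτ : 0 < τ) (hτM : 0 < M → τ < ε / M)
    (p₀ : L2 Ω (MDev d)) (z₀ : L2 Ω ℝ) :
    ∃! q : Config Ω, q ∈ competitors (affineClass N w Gw) ∧
      IsMinOn (incrementalEnergy C K V ε τ p₀ z₀) (competitors (affineClass N w Gw)) q := by
  obtain ⟨hcont, ⟨m₀, hm₀⟩, κ, hκ, hconv⟩ :=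
    exists_incrementalEnergy_bounds hK hC hV hε hτ hτM p₀ z₀
  obtain ⟨e₀, he₀⟩ := exists_incSym_eq Gw
  have hy₀ : totalStrain Ω (e₀, 0, 0) = symL Ω Gw := by
    rw [totalStrain_apply, map_zero, add_zero, he₀]
  have h := existsUnique_constrained_min (T := TraceSpace Ω) (G := L2 Ω (Mat d)) (U := L2 Ω (Vec d))
    (Y := L2 Ω (MSym d) × L2 Ω (MDev d) × L2 Ω ℝ) hNc (S := tripleStrain Ω) (c := c) hN
    (fun t => t.1) w (totalStrain Ω) (symL Ω Gw) hy₀ hcont hm₀ hκ hconv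
  have hset : competitors (affineClass N w Gw) = {q : Config Ω | ∃ t ∈ N, q.1 = w + t.1 ∧
      symL Ω Gw + tripleStrain Ω t = totalStrain Ω q.2} := by
    ext q
    refine exists_congr fun t => and_congr_right fun _ => and_congr_right fun _ => ?_
    rw [map_add, totalStrain_apply]
    rfl
  rw [hset]
  exact h

/-- The Dirichlet–Neumann class is affine over the fields with zero trace on `Γ`. -/
theorem admissible_eq_affineClass {Ω Γ : Set (Vec d)} [IsFiniteMeasure (volume.restrict Ω)]
    [IsFiniteMeasure (bdryMeasure Ω)] (hΩ : IsOpen Ω) (hb : Bornology.IsBounded Ω)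
    (hΓ : Γ ⊆ frontier Ω) {w : L2 Ω (Vec d)} {Gw : L2 Ω (Mat d)} (hw : HasWeakGrad Ω w Gw) :
    admissible Ω Γ w = affineClass (zeroTraceGraph Ω Γ) w Gw := by
  ext a
  constructor
  · rintro ⟨⟨G, hG, hs⟩, hbd⟩
    obtain ⟨t, ht, hta⟩ := (eqOnBdry_iff hΩ hb hΓ _ _).1 hbd
    refine ⟨t, ht, by rw [hta, add_sub_cancel], ?_⟩
    have h1 : HasWeakGrad Ω a.1 (Gw + t.2.1 : L2 Ω (Mat d)) := by
      have := (weakGradGraph Ω).add_mem (mem_weakGradGraph.2 hw : (w, Gw) ∈ weakGradGraph Ω)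
        (mem_weakGradGraph.2 (mem_zeroTraceGraph.1 ht).1.2 : (t.1, t.2.1) ∈ weakGradGraph Ω)
      rw [Prod.mk_add_mk, hta, add_sub_cancel] at this
      exact mem_weakGradGraph.1 this
    rw [← weakGrad_unique hΩ hG h1]
    exact (symL_eq_iff _ _ _).2 hs
  · rintro ⟨t, ht, h1, h2⟩
    refine ⟨⟨Gw + t.2.1, ?_, (symL_eq_iff _ _ _).1 h2⟩, (eqOnBdry_iff hΩ hb hΓ _ _).2
      ⟨t, ht, by rw [h1, add_sub_cancel_left]⟩⟩
    have := (weakGradGraph Ω).add_mem (mem_weakGradGraph.2 hw : (w, Gw) ∈ weakGradGraph Ω)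
      (mem_weakGradGraph.2 (mem_zeroTraceGraph.1 ht).1.2 : (t.1, t.2.1) ∈ weakGradGraph Ω)
    rw [Prod.mk_add_mk, ← h1] at this
    exact mem_weakGradGraph.1 this

/-- Korn's inequality on the fields with zero trace on `Γ`. -/
theorem exists_korn_zeroTraceGraph (hd : 1 ≤ d) {Ω Γ : Set (Vec d)}
    (h : IsReferenceConfiguration Ω Γ) :
    ∃ C : NNReal, ∀ t ∈ zeroTraceGraph Ω Γ, ‖t‖ ≤ C * ‖symL Ω t.2.1‖ := by
  obtain ⟨C, hC⟩ := exists_korn_trace hd h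
  refine ⟨C, fun t ht => ?_⟩
  obtain ⟨⟨h1, -⟩, h2⟩ := mem_zeroTraceGraph.1 ht
  simpa [h2] using hC t h1

end Minimisation

/-! ### The cube -/

section Cube

theorem isOpen_cube (d : ℕ) : IsOpen (cube d) := by
  have : cube d = ⋂ i, {x : Vec d | |x i| < 1 / 2} := by ext; simp [cube]
  rw [this]
  exact isOpen_iInter_of_finite fun i => isOpen_lt (by fun_prop) continuous_const

theorem isBounded_setOf_forall_abs_le {d : ℕ} (M : ℝ) :
    Bornology.IsBounded {x : Vec d | ∀ i, |x i| ≤ M} := by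
  have hc : IsCompact ((WithLp.toLp 2 : (Fin d → ℝ) → Vec d) ''
      (Set.univ.pi fun _ => Set.Icc (-M) M)) :=
    (isCompact_univ_pi fun _ => isCompact_Icc).image (PiLp.continuous_toLp 2 _)
  exact hc.isBounded.subset fun x hx => ⟨WithLp.ofLp x, fun i _ => abs_le.1 (hx i), rfl⟩

theorem isBounded_cube (d : ℕ) : Bornology.IsBounded (cube d) :=
  (isBounded_setOf_forall_abs_le (1 / 2)).subset fun _ hx i => (hx i).le

theorem convex_cube (d : ℕ) : Convex ℝ (cube d) := by
  intro x hx y hy a b ha hb hab i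
  have h1 := abs_lt.1 (hx i)
  have h2 := abs_lt.1 (hy i)
  simp only [PiLp.add_apply, PiLp.smul_apply, smul_eq_mul]
  have hb' : b = 1 - a := by linarith
  subst hb'
  rw [abs_lt]
  rcases ha.eq_or_lt with rfl | ha'
  · constructor <;> linarith
  · constructor <;> nlinarith

theorem mem_frontier_cube {d : ℕ} {x : Vec d} :
    x ∈ frontier (cube d) ↔ (∀ i, |x i| ≤ 1 / 2) ∧ ∃ i, |x i| = 1 / 2 := by
  rw [(isOpen_cube d).frontier_eq]
  constructor
  · rintro ⟨hcl, hx⟩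
    have h1 : ∀ i, |x i| ≤ 1 / 2 := fun i =>
      closure_minimal (s := cube d) (t := {x : Vec d | |x i| ≤ 1 / 2}) (fun y hy => (hy i).le)
        (isClosed_le (by fun_prop) continuous_const) hcl
    refine ⟨h1, ?_⟩
    by_contra! h
    exact hx fun i => lt_of_le_of_ne (h1 i) (h i)
  · rintro ⟨h1, i, hi⟩
    refine ⟨?_, fun hx => (hx i).ne hi⟩
    have h2 : (fun t : ℝ => t • x) '' Set.Ico 0 1 ⊆ cube d := by
      rintro _ ⟨t, ht, rfl⟩ j
      simp only [PiLp.smul_apply, smul_eq_mul]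
      rw [abs_mul, abs_of_nonneg ht.1]
      nlinarith [h1 j, abs_nonneg (x j), ht.1, ht.2]
    have h3 : (1 : ℝ) ∈ closure (Set.Ico (0 : ℝ) 1) := by
      rw [closure_Ico zero_ne_one]; exact ⟨zero_le_one, le_rfl⟩
    have h4 := image_closure_subset_closure_image (f := fun t : ℝ => t • x) (by fun_prop)
      ⟨1, h3, one_smul ℝ x⟩
    exact closure_mono h2 h4

/-- The cube is the subgraph of a minimum of affine functions of the active coordinates, in the
direction of the boundary point. -/
theorem hasLipschitzBoundary_cube (d : ℕ) : HasLipschitzBoundary (cube d) := by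
  intro x₀ hx₀
  obtain ⟨hle, i₀, hi₀⟩ := mem_frontier_cube.1 hx₀
  have hx0 : x₀ ≠ 0 := by
    rintro rfl
    simp at hi₀
  have hn : 0 < ‖x₀‖ := norm_pos_iff.2 hx0
  classical
  set I : Finset (Fin d) := Finset.univ.filter fun i => |x₀ i| = 1 / 2 with hI
  have hIne : I.Nonempty := ⟨i₀, by simp [hI, hi₀]⟩
  have hsq : ∀ i ∈ I, x₀ i * x₀ i = 1 / 4 := by
    intro i hi
    have : |x₀ i| = 1 / 2 := (Finset.mem_filter.1 hi).2
    rw [← abs_mul_abs_self, this]; norm_num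
  -- the face `x i = ± 1/2` through `x₀` is `4 x₀ i x i = 1`, the graph of `f i` in direction `x₀`
  let f : Fin d → Vec d → ℝ := fun i y => ‖x₀‖ * (1 - 4 * x₀ i * y i)
  let γ : Vec d → ℝ := fun y => I.inf' hIne fun i => f i y
  have hlip : LipschitzWith (2 * ‖x₀‖₊) γ := by
    refine LipschitzWith.of_le_add_mul _ fun y z => ?_
    rw [← sub_le_iff_le_add]
    refine Finset.le_inf' _ _ fun i hi => ?_
    have h1 : γ y ≤ f i y := Finset.inf'_le _ hi
    have h2 : f i y - f i z ≤ 2 * ‖x₀‖ * dist y z := by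
      have e : f i y - f i z = ‖x₀‖ * (4 * x₀ i * (z - y) i) := by
        simp only [f, PiLp.sub_apply]; ring
      have h3 : 4 * x₀ i * (z - y) i ≤ 2 * dist y z := by
        have h4 := abs_apply_le_norm (z - y) i
        rw [← dist_eq_norm, dist_comm] at h4
        calc _ ≤ |4 * x₀ i * (z - y) i| := le_abs_self _
          _ = 4 * |x₀ i| * |(z - y) i| := by rw [abs_mul, abs_mul]; norm_num
          _ ≤ 4 * (1 / 2) * dist y z := by
              gcongr
              exact hle i
          _ = _ := by ring
      rw [e]
      nlinarith
    have h5 : ((2 * ‖x₀‖₊ : NNReal) : ℝ) = 2 * ‖x₀‖ := by simp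
    rw [h5]
    linarith
  refine ⟨‖x₀‖⁻¹ • x₀, by rw [norm_smul, norm_inv, norm_norm, inv_mul_cancel₀ hn.ne'], _, γ,
    hlip, ?_⟩
  -- near `x₀` only the active constraints matter, each on its own side
  have hopen : ∀ᶠ x in 𝓝 x₀, ∀ i, (i ∈ I → -1 < 4 * x₀ i * x i) ∧ (i ∉ I → |x i| < 1 / 2) := by
    refine eventually_all.2 fun i => ?_
    by_cases hi : i ∈ I
    · have : ∀ᶠ x : Vec d in 𝓝 x₀, -1 < 4 * x₀ i * x i := by
        refine (isOpen_lt (by fun_prop) (by fun_prop)).mem_nhds ?_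
        change -1 < 4 * x₀ i * x₀ i
        rw [mul_assoc, hsq i hi]; norm_num
      filter_upwards [this] with x hx
      exact ⟨fun _ => hx, fun h => absurd hi h⟩
    · have : ∀ᶠ x : Vec d in 𝓝 x₀, |x i| < 1 / 2 := by
        refine (isOpen_lt (by fun_prop) (by fun_prop)).mem_nhds ?_
        exact lt_of_le_of_ne (hle i) fun h => hi (by simp [hI, h])
      filter_upwards [this] with x hx
      exact ⟨fun h => absurd h hi, fun _ => hx⟩
  obtain ⟨r, hr, hball⟩ := Metric.eventually_nhds_iff_ball.1 hopen
  refine ⟨r, hr, fun x hx => ?_⟩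
  have hx' := hball x hx
  set t := inner ℝ (‖x₀‖⁻¹ • x₀) x with ht
  have key : ∀ i ∈ I, (|x i| < 1 / 2 ↔ t < f i (x - t • ‖x₀‖⁻¹ • x₀)) := by
    intro i hi
    have e : f i (x - t • ‖x₀‖⁻¹ • x₀) - t = ‖x₀‖ * (1 - 4 * x₀ i * x i) := by
      simp only [f, PiLp.sub_apply, PiLp.smul_apply, smul_eq_mul]
      have := hsq i hi
      field_simp
      linear_combination (4 * t) * this
    have h1 := (hx' i).1 hi
    rw [← sub_pos (b := t), e, mul_pos_iff_of_pos_left hn, sub_pos]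
    have h2 : |4 * x₀ i * x i| = 2 * |x i| := by
      rw [abs_mul, abs_mul, (Finset.mem_filter.1 hi).2]; norm_num
    constructor
    · intro h
      have := (le_abs_self (4 * x₀ i * x i))
      linarith
    · intro h
      have := abs_lt.2 ⟨h1, h⟩
      linarith
  rw [Finset.lt_inf'_iff]
  constructor
  · exact fun h i hi => (key i hi).1 (h i)
  · intro h i
    by_cases hi : i ∈ I
    · exact (key i hi).2 (h i hi)
    · exact (hx' i).2 hi

variable {n : ℕ}

/-- The closed unit cube of dimension one less, which parametrises the faces. -/
def faceBox (n : ℕ) : Set (Fin n → ℝ) := Set.Icc (fun _ => -(1 / 2)) (fun _ => 1 / 2)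

/-- Parametrisation of the slice where the first coordinate is `s` by the remaining coordinates. -/
def faceMap (s : ℝ) (y : Fin n → ℝ) : Vec (n + 1) := WithLp.toLp 2 (Fin.cons s y)

theorem continuous_faceMap (s : ℝ) : Continuous (faceMap s : (Fin n → ℝ) → Vec (n + 1)) := by
  refine (PiLp.continuous_toLp 2 _).comp (continuous_pi fun i => ?_)
  refine Fin.cases ?_ (fun j => ?_) i
  · simpa using continuous_const
  · simpa using continuous_apply j

theorem faceMap_mem {s : ℝ} (hs : |s| = 1 / 2) {y : Fin n → ℝ} (hy : y ∈ faceBox n) :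
    faceMap s y ∈ cubeFaces (n + 1) := by
  have h0 : faceMap s y 0 = s := rfl
  refine ⟨mem_frontier_cube.2 ⟨fun i => ?_, 0, by rw [h0, hs]⟩, fun i hi => ?_⟩
  · refine Fin.cases ?_ (fun j => ?_) i
    · rw [h0, hs]
    · exact abs_le.2 ⟨hy.1 j, hy.2 j⟩
  · have : i = 0 := Fin.ext hi
    rw [this, h0, hs]

theorem isClosed_cubeFaces (d : ℕ) : IsClosed (cubeFaces d) := by
  have : cubeFaces d = frontier (cube d) ∩ ⋂ (i : Fin d) (_ : i.val = 0), {x | |x i| = 1 / 2} := by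
    ext x; simp [cubeFaces]
  rw [this]
  exact isClosed_frontier.inter (isClosed_iInter fun i => isClosed_iInter fun _ =>
    isClosed_eq (by fun_prop) continuous_const)

/-- The Lebesgue measure of a face is dominated by its Hausdorff measure, since dropping a
coordinate is a contraction. -/
theorem setLIntegral_faceMap_le {s : ℝ} (hs : |s| = 1 / 2) {F : Vec (n + 1) → ℝ≥0∞}
    (hF : Measurable F) : ∫⁻ y in faceBox n, F (faceMap s y)
      ≤ ∫⁻ x in cubeFaces (n + 1), F x ∂(Measure.hausdorffMeasure (((n + 1 : ℕ) : ℝ) - 1)) := by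
  set μ : Measure (Vec (n + 1)) := Measure.hausdorffMeasure (((n + 1 : ℕ) : ℝ) - 1) with hμ
  let P : Vec (n + 1) → (Fin n → ℝ) := fun x i => x i.succ
  have hP : LipschitzWith 1 P := by
    refine LipschitzWith.of_dist_le_mul fun x y => ?_
    rw [NNReal.coe_one, one_mul]
    refine (dist_pi_le_iff dist_nonneg).2 fun i => ?_
    rw [dist_eq_norm, dist_eq_norm, Real.norm_eq_abs]
    exact abs_apply_le_norm (x - y) i.succ
  set face : Set (Vec (n + 1)) := cubeFaces (n + 1) ∩ {x | x 0 = s} with hface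
  have mface : MeasurableSet face := ((isClosed_cubeFaces _).inter
    (isClosed_eq (by fun_prop) continuous_const)).measurableSet
  have hd : ((n + 1 : ℕ) : ℝ) - 1 = (Fintype.card (Fin n) : ℝ) := by simp
  have hle : (volume.restrict (faceBox n) : Measure (Fin n → ℝ)) ≤ (μ.restrict face).map P := by
    refine Measure.le_iff.2 fun A hA => ?_
    rw [Measure.restrict_apply hA, Measure.map_apply hP.continuous.measurable hA,
      Measure.restrict_apply (hP.continuous.measurable hA), ← hausdorffMeasure_pi_real, ← hd]
    have hsub : A ∩ faceBox n ⊆ P '' (P ⁻¹' A ∩ face) := fun y hy =>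
      ⟨faceMap s y, ⟨hy.1, faceMap_mem hs hy.2, rfl⟩, rfl⟩
    refine (measure_mono hsub).trans ?_
    have := hP.hausdorffMeasure_image_le (d := ((n + 1 : ℕ) : ℝ) - 1) (by simp) (P ⁻¹' A ∩ face)
    rw [ENNReal.coe_one, ENNReal.one_rpow, one_mul] at this
    exact this
  have hFs : Measurable fun y => F (faceMap s y) := hF.comp (continuous_faceMap s).measurable
  calc ∫⁻ y in faceBox n, F (faceMap s y) ≤ ∫⁻ y, F (faceMap s y) ∂((μ.restrict face).map P) :=
        lintegral_mono' hle le_rfl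
    _ = ∫⁻ x in face, F (faceMap s (P x)) ∂μ := lintegral_map hFs hP.continuous.measurable
    _ = ∫⁻ x in face, F x ∂μ := by
        refine setLIntegral_congr_fun mface fun x hx => ?_
        have : faceMap s (P x) = x := by
          ext i
          refine Fin.cases ?_ (fun j => rfl) i
          exact (hx.2 : x 0 = s).symm
        simp only [this]
    _ ≤ _ := lintegral_mono_set Set.inter_subset_left

theorem volume_faceBox (n : ℕ) : volume (faceBox n) = 1 := by
  rw [faceBox, Real.volume_Icc_pi]
  norm_num

/-- The periodic cube is a particular reference configuration. -/
theorem isReferenceConfiguration_cube (n : ℕ) :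
    IsReferenceConfiguration (cube (n + 1)) (cubeFaces (n + 1)) where
  isOpen := isOpen_cube _
  isConnected := (convex_cube _).isConnected ⟨0, fun i => by simp⟩
  isBounded := isBounded_cube _
  lipschitz := hasLipschitzBoundary_cube _
  dirichlet_subset := fun _ hx => hx.1
  dirichlet_closed := isClosed_cubeFaces _
  dirichlet_pos := by
    have h := setLIntegral_faceMap_le (n := n) (s := 1 / 2) (by norm_num) (F := fun _ => 1)
      measurable_const
    rw [setLIntegral_const, setLIntegral_const, volume_faceBox, one_mul, one_mul] at h
    exact zero_lt_one.trans_le h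

theorem cube_ae_eq (n : ℕ) :
    (WithLp.ofLp : Vec n → Fin n → ℝ) ⁻¹' faceBox n =ᵐ[volume] cube n := by
  have h := (PiLp.volume_preserving_ofLp (Fin n)).quasiMeasurePreserving.preimage_ae_eq
    (Measure.univ_pi_Ioo_ae_eq_Icc (μ := fun _ : Fin n => (volume : Measure ℝ))
      (f := fun _ => -(1 / 2 : ℝ)) (g := fun _ => (1 / 2 : ℝ)))
  have hset : (WithLp.ofLp : Vec n → Fin n → ℝ) ⁻¹'
      (Set.univ.pi fun _ => Set.Ioo (-(1 / 2 : ℝ)) (1 / 2)) = cube n := by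
    ext x
    exact ⟨fun h i => abs_lt.2 (h i trivial), fun h i _ => abs_lt.1 (h i)⟩
  exact h.symm.trans (.of_eq hset)

/-- The fundamental theorem of calculus in the first coordinate, integrated over the cube. -/
theorem integral_cube_fderiv {g : Vec (n + 1) → ℝ} (hg : ContDiff ℝ ∞ g) :
    ∫ x in cube (n + 1), fderiv ℝ g x (EuclideanSpace.single 0 1)
      = (∫ y in faceBox n, g (faceMap (1 / 2) y)) - ∫ y in faceBox n, g (faceMap (-(1 / 2)) y) := by
  let T : (Fin (n + 1) → ℝ) →L[ℝ] Vec (n + 1) :=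
    (EuclideanSpace.equiv (Fin (n + 1)) ℝ).symm.toContinuousLinearMap
  have hT : ∀ y, T y = WithLp.toLp 2 y := fun y => rfl
  let a : Fin (n + 1) → ℝ := fun _ => -(1 / 2)
  let b : Fin (n + 1) → ℝ := fun _ => 1 / 2
  have hab : a ≤ b := fun i => by simp only [a, b]; norm_num
  let f : Fin (n + 1) → (Fin (n + 1) → ℝ) → ℝ := fun i y => if i = 0 then g (T y) else 0
  let f' : Fin (n + 1) → (Fin (n + 1) → ℝ) → (Fin (n + 1) → ℝ) →L[ℝ] ℝ := fun i y =>
    if i = 0 then (fderiv ℝ g (T y)).comp T else 0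
  have hgT : Continuous fun y => g (T y) := hg.continuous.comp T.continuous
  have hgT' : Continuous fun y => fderiv ℝ g (T y) (EuclideanSpace.single 0 1) :=
    ((hg.continuous_fderiv (by simp)).comp T.continuous).clm_apply continuous_const
  have hsum : ∀ y, ∑ i, f' i y (Pi.single i 1) = fderiv ℝ g (T y) (EuclideanSpace.single 0 1) := by
    intro y
    rw [Finset.sum_eq_single 0 (fun i _ hi => by simp [f', hi]) (by simp)]
    simp only [f', if_true, ContinuousLinearMap.comp_apply]
    rfl
  have h := integral_divergence_of_hasFDerivAt_off_countable' a b hab f f' ∅ Set.countable_empty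
    (fun i => by
      by_cases hi : i = 0
      · simp only [f, hi, if_true]; exact hgT.continuousOn
      · simp only [f, hi, if_false]; exact continuousOn_const)
    (fun y _ i => by
      by_cases hi : i = 0
      · simp only [f, f', hi, if_true]
        exact (hg.differentiable (by simp) (T y)).hasFDerivAt.comp y T.hasFDerivAt
      · simp only [f, f', hi, if_false]; exact hasFDerivAt_const _ _)
    (by
      simp only [hsum]
      exact hgT'.continuousOn.integrableOn_compact isCompact_Icc)
  simp only [hsum] at h
  rw [Finset.sum_eq_single 0 (fun i _ hi => by simp [f, hi]) (by simp)] at h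
  have hL : ∫ x in cube (n + 1), fderiv ℝ g x (EuclideanSpace.single 0 1)
      = ∫ y in Set.Icc a b, fderiv ℝ g (T y) (EuclideanSpace.single 0 1) := by
    rw [← setIntegral_congr_set (cube_ae_eq (n + 1))]
    exact (PiLp.volume_preserving_ofLp (Fin (n + 1))).setIntegral_preimage_emb
      (MeasurableEquiv.toLp 2 (Fin (n + 1) → ℝ)).symm.measurableEmbedding
      (fun y => fderiv ℝ g (T y) (EuclideanSpace.single 0 1)) (Set.Icc a b)
  rw [hL, h]
  simp only [f, if_true]
  congr 1 <;>
  · refine setIntegral_congr_fun measurableSet_Icc fun y _ => ?_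
    simp only [hT, faceMap]
    congr 2
    exact Fin.insertNth_zero' _ _

end Cube

/-! ### Integration by parts across the Dirichlet faces -/

section Faces

variable {n : ℕ}

theorem integrableOn_of_continuous {d : ℕ} {f : Vec d → ℝ} (hf : Continuous f) {S : Set (Vec d)}
    (hS : Bornology.IsBounded S) : IntegrableOn f S :=
  (hf.continuousOn.integrableOn_compact hS.isCompact_closure).mono_set subset_closure

/-- The boundary term on one face is controlled by the `L²` norm of the trace on the faces. -/
theorem enorm_integral_faceMap_sq_le {f : Vec (n + 1) → Vec (n + 1)} (hf : Continuous f)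
    {ψ : Vec (n + 1) → ℝ} {C : ℝ} (hC : ∀ x, ‖ψ x‖ ≤ C) {s : ℝ} (hs : |s| = 1 / 2)
    (i : Fin (n + 1)) :
    ‖∫ y in faceBox n, f (faceMap s y) i * ψ (faceMap s y)‖ₑ ^ 2
      ≤ ENNReal.ofReal C ^ 2 * ∫⁻ x in cubeFaces (n + 1), ‖f x‖ₑ ^ 2
          ∂(Measure.hausdorffMeasure (((n + 1 : ℕ) : ℝ) - 1)) := by
  have hm : Measurable fun y : Fin n → ℝ => ENNReal.ofReal C * ‖f (faceMap s y)‖ₑ :=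
    ((hf.comp (continuous_faceMap s)).enorm.measurable).const_mul _
  have h1 : ‖∫ y in faceBox n, f (faceMap s y) i * ψ (faceMap s y)‖ₑ
      ≤ ∫⁻ y in faceBox n, ENNReal.ofReal C * ‖f (faceMap s y)‖ₑ := by
    refine (enorm_integral_le_lintegral_enorm _).trans (lintegral_mono fun y => ?_)
    rw [enorm_mul, mul_comm]
    refine mul_le_mul' ?_ (enorm_apply_le_enorm _ _)
    rw [← ofReal_norm]
    exact ENNReal.ofReal_le_ofReal (hC _)
  have h2 := lintegral_sq_le (μ := (volume : Measure (Fin n → ℝ)).restrict (faceBox n))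
    hm.aemeasurable
  have h3 := setLIntegral_faceMap_le (n := n) hs (F := fun x => ‖f x‖ₑ ^ 2)
    (hf.enorm.measurable.pow_const 2)
  calc _ ≤ (∫⁻ y in faceBox n, ENNReal.ofReal C * ‖f (faceMap s y)‖ₑ) ^ 2 :=
        pow_le_pow_left' h1 2
    _ ≤ ∫⁻ y in faceBox n, (ENNReal.ofReal C * ‖f (faceMap s y)‖ₑ) ^ 2 := by
        refine h2.trans (le_of_eq ?_)
        rw [Measure.restrict_apply_univ, volume_faceBox, one_mul]
    _ = ENNReal.ofReal C ^ 2 * ∫⁻ y in faceBox n, ‖f (faceMap s y)‖ₑ ^ 2 := by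
        rw [← lintegral_const_mul' _ _ (by simp)]
        exact lintegral_congr fun y => mul_pow _ _ _
    _ ≤ _ := mul_le_mul_right h3 _

/-- A field with zero trace on the two faces can be integrated by parts in the first coordinate
against any test function, whether or not it vanishes on the boundary of the cube. -/
theorem integral_mul_fderiv_zero_of_zeroTrace {t : TraceSpace (cube (n + 1))}
    (ht : t ∈ zeroTraceGraph (cube (n + 1)) (cubeFaces (n + 1))) {φ : Vec (n + 1) → ℝ}
    (hφ : ContDiff ℝ ∞ φ) (hc : HasCompactSupport φ) (i : Fin (n + 1)) :
    (∫ x in cube (n + 1), t.1 x i * fderiv ℝ φ x (EuclideanSpace.single 0 1))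
      + ∫ x in cube (n + 1), t.2.1 x (i, 0) * φ x = 0 := by
  obtain ⟨L, hL⟩ := exists_clm_gradPairing (cube (n + 1)) hφ hc i 0
  obtain ⟨C, hC⟩ := hφ.continuous.bounded_above_of_compact_support hc
  have hC0 : 0 ≤ C := (norm_nonneg _).trans (hC 0)
  obtain ⟨⟨hcl, -⟩, h0⟩ := mem_zeroTraceGraph.1 ht
  -- for smooth fields the left-hand side is a boundary integral over the two faces, which is
  -- continuous in the trace
  have hle : ∀ t ∈ (smoothTriples (cube (n + 1))).topologicalClosure,
      |L (t.1, t.2.1)| ≤ 2 * C * ‖bdryRestrict (cube (n + 1)) (cubeFaces (n + 1)) t.2.2‖ := by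
    intro t ht
    refine closure_minimal (s := (smoothTriples (cube (n + 1)) : Set (TraceSpace (cube (n + 1)))))
      (t := {t | |L (t.1, t.2.1)|
        ≤ 2 * C * ‖bdryRestrict (cube (n + 1)) (cubeFaces (n + 1)) t.2.2‖}) ?_ ?_ ht
    · rintro t ⟨f, hf, h1, h2, h3⟩
      have hR : ∫⁻ x in cubeFaces (n + 1), ‖f x‖ₑ ^ 2
          ∂(Measure.hausdorffMeasure (((n + 1 : ℕ) : ℝ) - 1))
          = ‖bdryRestrict (cube (n + 1)) (cubeFaces (n + 1)) t.2.2‖ₑ ^ 2 := by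
        rw [enorm_Lp_sq]
        have hμ : (bdryMeasure (cube (n + 1))).restrict (cubeFaces (n + 1))
            = (Measure.hausdorffMeasure (((n + 1 : ℕ) : ℝ) - 1)).restrict (cubeFaces (n + 1)) :=
          Measure.restrict_restrict_of_subset fun _ hx => hx.1
        rw [← hμ]
        refine lintegral_congr_ae ?_
        filter_upwards [ae_restrict_of_ae h3, LpToLpRestrictCLM_coeFn ℝ (cubeFaces (n + 1)) t.2.2]
          with x hx hx'
        rw [bdryRestrict, hx', hx]
      have face : ∀ s : ℝ, |s| = 1 / 2 →
          |∫ y in faceBox n, f (faceMap s y) i * φ (faceMap s y)|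
            ≤ C * ‖bdryRestrict (cube (n + 1)) (cubeFaces (n + 1)) t.2.2‖ := by
        intro s hs
        have h := enorm_integral_faceMap_sq_le hf.continuous hC hs i
        rw [hR, ← mul_pow] at h
        have h' := (ENNReal.pow_le_pow_left_iff two_ne_zero).1 h
        rw [← ofReal_norm, ← ofReal_norm, ← ENNReal.ofReal_mul hC0,
          ENNReal.ofReal_le_ofReal_iff (by positivity)] at h'
        exact h'
      have hfi : ContDiff ℝ ∞ fun x => f x i := contDiff_coord hf i
      have hg := integral_cube_fderiv (hfi.mul hφ)
      have e1 : ∫ x in cube (n + 1), t.1 x i * fderiv ℝ φ x (EuclideanSpace.single 0 1)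
          = ∫ x in cube (n + 1), f x i * fderiv ℝ φ x (EuclideanSpace.single 0 1) := by
        refine integral_congr_ae ?_
        filter_upwards [h1] with x hx
        rw [hx]
      have e2 : ∫ x in cube (n + 1), t.2.1 x (i, 0) * φ x
          = ∫ x in cube (n + 1), classicalGrad f x (i, 0) * φ x := by
        refine integral_congr_ae ?_
        filter_upwards [h2] with x hx
        rw [hx]
      have c1 : Continuous fun x => f x i * fderiv ℝ φ x (EuclideanSpace.single 0 1) :=
        hfi.continuous.mul ((hφ.continuous_fderiv (by simp)).clm_apply continuous_const)
      have c2 : Continuous fun x => classicalGrad f x (i, 0) * φ x :=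
        (continuous_classicalGrad_coord hf i 0).mul hφ.continuous
      have e3 : L (t.1, t.2.1) = ∫ x in cube (n + 1),
          fderiv ℝ (fun x => f x i * φ x) x (EuclideanSpace.single 0 1) := by
        rw [hL, e1, e2, ← integral_add (integrableOn_of_continuous c1 (isBounded_cube _))
          (integrableOn_of_continuous c2 (isBounded_cube _))]
        refine integral_congr_ae (Eventually.of_forall fun x => ?_)
        simp only
        rw [fderiv_fun_mul (hfi.differentiable (by simp) x) (hφ.differentiable (by simp) x)]
        simp only [_root_.add_apply, _root_.smul_apply, smul_eq_mul]
        rw [fderiv_coord hf, classicalGrad_apply]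
        ring
      have f1 := face (1 / 2) (by norm_num)
      have f2 := face (-(1 / 2)) (by norm_num)
      change |L (t.1, t.2.1)| ≤ _
      rw [e3, hg]
      refine (abs_sub _ _).trans ?_
      linarith
    · exact isClosed_le (L.continuous.comp
        (continuous_fst.prodMk (continuous_fst.comp continuous_snd))).abs
        (continuous_const.mul ((bdryRestrict _ _).continuous.comp
          (continuous_snd.comp continuous_snd)).norm)
  have h := hle t hcl
  rw [h0, norm_zero, mul_zero] at h
  have := abs_nonpos_iff.1 h
  rwa [hL] at this

end Faces

/-! ### Tiling the strip by translated cubes -/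

section Tiling

variable {n : ℕ}

/-- The strip `|x₁| < 1/2`, the union of the lattice translates of the cube up to a null set. -/
def strip (n : ℕ) : Set (Vec (n + 1)) := {x | |x 0| < 1 / 2}

/-- The lattice vector `(0, k)`. -/
def latVec (k : Fin n → ℤ) : Vec (n + 1) :=
  WithLp.toLp 2 (Fin.cons 0 fun i => (k i : ℝ))

/-- The translate of the cube by a lattice vector. -/
def cell (k : Fin n → ℤ) : Set (Vec (n + 1)) := {x | x - latVec k ∈ cube (n + 1)}

/-- The index `k` of the cell containing `x`, for `x` in the strip off the cell boundaries. -/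
def cellIndex (x : Vec (n + 1)) : Fin n → ℤ := fun i => ⌊x i.succ + 1 / 2⌋

/-- The indices `k` with `|k_i| ≤ N`. -/
def latBox (n N : ℕ) : Finset (Fin n → ℤ) :=
  Fintype.piFinset fun _ => Finset.Icc (-(N : ℤ)) N

/-- The union, up to a null set, of the cells with index in `latBox n N`, extended to all values
of the first coordinate. -/
def slabBox (n N : ℕ) : Set (Vec (n + 1)) := {x | ∀ i : Fin n, |x i.succ| < N + 1 / 2}

@[simp] theorem latVec_zero_coord (k : Fin n → ℤ) : latVec k 0 = 0 := rfl

@[simp] theorem latVec_succ (k : Fin n → ℤ) (i : Fin n) : latVec k i.succ = k i := rfl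

theorem latVec_zero : latVec (0 : Fin n → ℤ) = 0 := by
  ext i
  refine Fin.cases ?_ (fun i => ?_) i <;> simp

theorem measurableSet_cell (k : Fin n → ℤ) : MeasurableSet (cell k) :=
  (isOpen_cube _).measurableSet.preimage (measurable_id.sub_const _)

theorem measurableSet_strip : MeasurableSet (strip n) :=
  (isOpen_lt (by fun_prop) continuous_const).measurableSet

theorem mem_cell {k : Fin n → ℤ} {x : Vec (n + 1)} :
    x ∈ cell k ↔ |x 0| < 1 / 2 ∧ ∀ i : Fin n, |x i.succ - k i| < 1 / 2 := by
  change (∀ i, |(x - latVec k) i| < 1 / 2) ↔ _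
  rw [Fin.forall_fin_succ]
  simp

theorem add_latVec_mem_cell {k : Fin n → ℤ} {x : Vec (n + 1)} :
    x + latVec k ∈ cell k ↔ x ∈ cube (n + 1) := by
  rw [cell, Set.mem_ofPred_eq, add_sub_cancel_right]

theorem cellIndex_eq_of_mem_cell {k : Fin n → ℤ} {x : Vec (n + 1)} (hx : x ∈ cell k) :
    cellIndex x = k := by
  funext i
  have := abs_lt.1 ((mem_cell.1 hx).2 i)
  rw [cellIndex, Int.floor_eq_iff]
  constructor <;> linarith

theorem cellIndex_add_latVec (x : Vec (n + 1)) (k : Fin n → ℤ) :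
    cellIndex (x + latVec k) = cellIndex x + k := by
  funext i
  simp only [cellIndex, PiLp.add_apply, latVec_succ, Pi.add_apply]
  rw [add_right_comm, Int.floor_add_intCast]

theorem latVec_add (k l : Fin n → ℤ) : latVec (k + l) = latVec k + latVec l := by
  ext i
  refine Fin.cases ?_ (fun i => ?_) i <;> simp

theorem pairwise_disjoint_cell : Pairwise (Function.onFun Disjoint (cell (n := n))) := by
  intro k l hkl
  refine Set.disjoint_left.2 fun x hk hl => hkl ?_
  rw [← cellIndex_eq_of_mem_cell hk, ← cellIndex_eq_of_mem_cell hl]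

theorem mem_latBox {N : ℕ} {k : Fin n → ℤ} : k ∈ latBox n N ↔ ∀ i, -(N : ℤ) ≤ k i ∧ k i ≤ N := by
  simp [latBox]

theorem cell_subset {N : ℕ} {k : Fin n → ℤ} (hk : k ∈ latBox n N) :
    cell k ⊆ strip n ∩ slabBox n N := by
  intro x hx
  refine ⟨(mem_cell.1 hx).1, fun i => ?_⟩
  have h1 := abs_lt.1 ((mem_cell.1 hx).2 i)
  have h2 := mem_latBox.1 hk i
  have h3 : -(N : ℝ) ≤ k i := by exact_mod_cast h2.1
  have h4 : (k i : ℝ) ≤ N := by exact_mod_cast h2.2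
  rw [abs_lt]
  constructor <;> linarith

/-- Coordinate hyperplanes are null sets. -/
theorem ae_coord_ne {d : ℕ} (i : Fin d) (c : ℝ) : ∀ᵐ x : Vec d, x i ≠ c :=
  (PiLp.volume_preserving_ofLp (Fin d)).quasiMeasurePreserving.ae
    (p := fun y : Fin d → ℝ => y i ≠ c)
    (Measure.ae_eval_ne (fun _ : Fin d => (volume : Measure ℝ)) i c)

/-- Almost every point of the strip lies in an open cell: the exceptions have a coordinate in
`ℤ + 1/2`. -/
theorem ae_mem_cell_cellIndex :
    ∀ᵐ x : Vec (n + 1), x ∈ strip n → x ∈ cell (cellIndex x) := by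
  have h : ∀ᵐ x : Vec (n + 1), ∀ (i : Fin n) (m : ℤ), x i.succ ≠ m - 1 / 2 :=
    ae_all_iff.2 fun i => ae_all_iff.2 fun m => ae_coord_ne _ _
  filter_upwards [h] with x hx hs
  refine mem_cell.2 ⟨hs, fun i => ?_⟩
  have h1 := Int.floor_le (x i.succ + 1 / 2)
  have h2 := Int.lt_floor_add_one (x i.succ + 1 / 2)
  have h3 : (⌊x i.succ + 1 / 2⌋ : ℝ) ≠ x i.succ + 1 / 2 := by
    intro h
    apply hx i ⌊x i.succ + 1 / 2⌋
    rw [h]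
    ring
  have h4 := lt_of_le_of_ne h1 h3
  rw [abs_lt, cellIndex]
  constructor <;> linarith

theorem cellIndex_mem_latBox {N : ℕ} {x : Vec (n + 1)} (hx : x ∈ slabBox n N) :
    cellIndex x ∈ latBox n N := by
  refine mem_latBox.2 fun i => ?_
  have h := abs_lt.1 (hx i)
  constructor
  · rw [cellIndex, Int.le_floor]
    push_cast
    linarith
  · rw [cellIndex, ← Int.lt_add_one_iff, Int.floor_lt]
    push_cast
    linarith

theorem iUnion_cell_ae_eq (N : ℕ) :
    (⋃ k ∈ latBox n N, cell k) =ᵐ[volume] (strip n ∩ slabBox n N : Set (Vec (n + 1))) := by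
  filter_upwards [ae_mem_cell_cellIndex (n := n)] with x hx
  refine propext ⟨fun h => ?_, fun h => ?_⟩
  · obtain ⟨k, hk, hxk⟩ := Set.mem_iUnion₂.1 h
    exact cell_subset hk hxk
  · exact Set.mem_iUnion₂.2 ⟨_, cellIndex_mem_latBox h.2, hx h.1⟩

theorem measurePreserving_add_latVec (k : Fin n → ℤ) :
    MeasurePreserving (fun x : Vec (n + 1) => x + latVec k) (volume.restrict (cube (n + 1)))
      (volume.restrict (cell k)) := by
  have h := (measurePreserving_add_right (volume : Measure (Vec (n + 1)))
    (latVec k)).restrict_preimage (measurableSet_cell k)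
  have hs : (fun x : Vec (n + 1) => x + latVec k) ⁻¹' cell k = cube (n + 1) := by
    ext x
    exact add_latVec_mem_cell
  rwa [hs] at h

theorem measurePreserving_sub_latVec (k : Fin n → ℤ) :
    MeasurePreserving (fun x : Vec (n + 1) => x - latVec k) (volume.restrict (cell k))
      (volume.restrict (cube (n + 1))) :=
  (measurePreserving_sub_right (volume : Measure (Vec (n + 1)))
    (latVec k)).restrict_preimage (isOpen_cube _).measurableSet

theorem setIntegral_cell (k : Fin n → ℤ) (F : Vec (n + 1) → ℝ) :
    ∫ x in cell k, F x = ∫ x in cube (n + 1), F (x + latVec k) :=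
  ((measurePreserving_add_latVec k).integral_comp (measurableEmbedding_addRight _) F).symm

/-- Integration over the strip cell by cell. -/
theorem integral_strip_eq_sum {N : ℕ} {F : Vec (n + 1) → ℝ} (hF : Integrable F)
    (h0 : ∀ x ∉ slabBox n N, F x = 0) :
    ∫ x in strip n, F x = ∑ k ∈ latBox n N, ∫ x in cube (n + 1), F (x + latVec k) := by
  rw [setIntegral_eq_of_subset_of_forall_sdiff_eq_zero (s := strip n ∩ slabBox n N)
      measurableSet_strip Set.inter_subset_left fun x hx => h0 x fun h => hx.2 ⟨hx.1, h⟩,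
    ← setIntegral_congr_set (iUnion_cell_ae_eq N),
    integral_biUnion_finset _ (fun k _ => measurableSet_cell k)
      (fun k _ l _ h => pairwise_disjoint_cell h) (fun k _ => hF.integrableOn)]
  exact Finset.sum_congr rfl fun k _ => setIntegral_cell k F

/-- Every bounded set is contained in a slab box. -/
theorem exists_subset_slabBox {S : Set (Vec (n + 1))} (hS : Bornology.IsBounded S) :
    ∃ N, S ⊆ slabBox n N := by
  obtain ⟨R, hR⟩ := hS.exists_norm_le
  obtain ⟨N, hN⟩ := exists_nat_ge R
  refine ⟨N, fun x hx i => ?_⟩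
  have := (abs_apply_le_norm x i.succ).trans (hR x hx)
  linarith

/-! ### Periodic extension -/

/-- The extension of a function on the cube to the strip, periodic in all coordinates but the
first, and by zero outside the strip. -/
def periodicExt {E : Type*} [Zero E] (v : Vec (n + 1) → E) : Vec (n + 1) → E :=
  (strip n).indicator fun x => v (x - latVec (cellIndex x))

theorem periodicExt_add_latVec {E : Type*} [Zero E] (v : Vec (n + 1) → E) (k : Fin n → ℤ)
    (x : Vec (n + 1)) : periodicExt v (x + latVec k) = periodicExt v x := by
  have hs : x + latVec k ∈ strip n ↔ x ∈ strip n := by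
    simp [strip]
  by_cases h : x ∈ strip n
  · rw [periodicExt, Set.indicator_of_mem h, Set.indicator_of_mem (hs.2 h), cellIndex_add_latVec,
      latVec_add, add_sub_add_right_eq_sub]
  · rw [periodicExt, Set.indicator_of_notMem h, Set.indicator_of_notMem (mt hs.1 h)]

theorem periodicExt_of_mem_cube {E : Type*} [Zero E] (v : Vec (n + 1) → E) {x : Vec (n + 1)}
    (hx : x ∈ cube (n + 1)) : periodicExt v x = v x := by
  have hc : x ∈ cell (0 : Fin n → ℤ) := by rwa [← add_zero x, ← latVec_zero, add_latVec_mem_cell]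
  have hs : x ∈ strip n := (mem_cell.1 hc).1
  rw [periodicExt, Set.indicator_of_mem hs, cellIndex_eq_of_mem_cell hc,
    latVec_zero, sub_zero]

/-- The periodic extension of a square integrable function is locally square integrable. -/
theorem memLp_periodicExt {E : Type*} [NormedAddCommGroup E] {v : Vec (n + 1) → E}
    (hv : MemLp v 2 (volume.restrict (cube (n + 1)))) {S : Set (Vec (n + 1))}
    (hS : Bornology.IsBounded S) : MemLp (periodicExt v) 2 (volume.restrict S) := by
  obtain ⟨N, hN⟩ := exists_subset_slabBox hS
  have hsum : MemLp (fun x => ∑ k ∈ latBox n N, (cell k).indicator (fun y => v (y - latVec k)) x)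
      2 volume :=
    memLp_finsetSum _ fun k _ => (memLp_indicator_iff_restrict (measurableSet_cell k)).2
      (hv.comp_measurePreserving (measurePreserving_sub_latVec k))
  have hm : MeasurableSet (slabBox n N) := by
    rw [slabBox, Set.ofPred_forall]
    exact MeasurableSet.iInter fun i => (isOpen_lt (by fun_prop) continuous_const).measurableSet
  refine MemLp.mono_measure (Measure.restrict_mono hN le_rfl) ?_
  refine MemLp.ae_eq ?_ (hsum.restrict (slabBox n N))
  filter_upwards [ae_restrict_of_ae (ae_mem_cell_cellIndex (n := n)), ae_restrict_mem hm]
    with x hx hxN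
  by_cases hs : x ∈ strip n
  · rw [periodicExt, Set.indicator_of_mem hs, Finset.sum_eq_single (cellIndex x),
      Set.indicator_of_mem (hx hs)]
    · exact fun k _ hk => Set.indicator_of_notMem
        (fun h => hk (cellIndex_eq_of_mem_cell h).symm) _
    · exact fun h => absurd (cellIndex_mem_latBox hxN) h
  · rw [periodicExt, Set.indicator_of_notMem hs]
    exact Finset.sum_eq_zero fun k _ => Set.indicator_of_notMem (fun h => hs (mem_cell.1 h).1) _

end Tiling

/-! ### Restrictions of periodic Sobolev fields -/

section Periodic

variable {n : ℕ}

theorem integrable_mul_of_memLp_isCompact {d : ℕ} {f ψ : Vec d → ℝ}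
    (hf : ∀ S : Set (Vec d), IsCompact S → MemLp f 2 (volume.restrict S)) (hψ : Continuous ψ)
    (hc : HasCompactSupport ψ) : Integrable fun x => f x * ψ x := by
  refine (integrableOn_iff_integrable_of_support_subset (s := tsupport ψ) ?_).1 ?_
  · exact (Function.support_mul_subset_right f ψ).trans (subset_tsupport ψ)
  · have h2 : MemLp ψ 2 (volume.restrict (tsupport ψ)) :=
      (hψ.memLp_of_hasCompactSupport hc).restrict _
    exact (hf _ hc).integrable_mul h2

theorem integrable_coord_mul_fderiv {d : ℕ} {U : Vec d → Vec d}
    (hU : ∀ S : Set (Vec d), IsCompact S → MemLp U 2 (volume.restrict S)) {φ : Vec d → ℝ}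
    (hφ : ContDiff ℝ ∞ φ) (hc : HasCompactSupport φ) (i : Fin d) (a : Vec d) :
    Integrable fun x => U x i * fderiv ℝ φ x a :=
  integrable_mul_of_memLp_isCompact
    (fun S hS => (EuclideanSpace.proj i : Vec d →L[ℝ] ℝ).comp_memLp' (hU S hS))
    ((hφ.continuous_fderiv (by simp)).clm_apply continuous_const) (hc.fderiv_apply ℝ a)

theorem integrable_entry_mul {d : ℕ} {G : Vec d → Mat d}
    (hG : ∀ S : Set (Vec d), IsCompact S → MemLp G 2 (volume.restrict S)) {φ : Vec d → ℝ}
    (hφ : ContDiff ℝ ∞ φ) (hc : HasCompactSupport φ) (i j : Fin d) :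
    Integrable fun x => G x (i, j) * φ x :=
  integrable_mul_of_memLp_isCompact
    (fun S hS => (EuclideanSpace.proj (i, j) : Mat d →L[ℝ] ℝ).comp_memLp' (hG S hS))
    hφ.continuous hc

/-- The vectors which are periods of `U` up to null sets. -/
def aePeriods {E F : Type*} [AddCommGroup E] [MeasurableSpace E] [MeasurableAdd E]
    (μ : Measure E) [μ.IsAddRightInvariant] (U : E → F) : AddSubgroup E where
  carrier := {a | ∀ᵐ x ∂μ, U (x + a) = U x}
  add_mem' := by
    intro a b ha hb
    filter_upwards [hb, (measurePreserving_add_right μ b).quasiMeasurePreserving.ae ha]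
      with x h1 h2
    rw [← h1, ← h2, add_assoc, add_comm b]
  zero_mem' := by simp
  neg_mem' := by
    intro a ha
    filter_upwards [(measurePreserving_add_right μ (-a)).quasiMeasurePreserving.ae ha] with x hx
    rw [← hx, neg_add_cancel_right]

theorem ae_periodic_latVec {F : Type*} {U : Vec (n + 1) → F}
    (hU : ∀ i : Fin (n + 1), i.val ≠ 0 → ∀ᵐ x : Vec (n + 1),
      U (x + EuclideanSpace.single i 1) = U x) (k : Fin n → ℤ) :
    ∀ᵐ x : Vec (n + 1), U (x + latVec k) = U x := by
  have hk : latVec k = ∑ i : Fin n, k i • (EuclideanSpace.single i.succ 1 : Vec (n + 1)) := by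
    ext j
    refine Fin.cases ?_ (fun j => ?_) j
    · simp
    · simp [Pi.single_apply]
  have : latVec k ∈ aePeriods volume U := by
    rw [hk]
    exact AddSubgroup.sum_mem _ fun i _ => AddSubgroup.zsmul_mem _ (hU i.succ (by simp)) _
  exact this

theorem hasCompactSupport_comp_add_right {d : ℕ} (φ : Vec d → ℝ)
    (hc : HasCompactSupport φ) (a : Vec d) :
    HasCompactSupport fun x => φ (x + a) :=
  hc.comp_homeomorph (Homeomorph.addRight a)

/-- Translation of a weak gradient by a lattice period. -/
theorem hasWeakGrad_cube_translate {U : Vec (n + 1) → Vec (n + 1)} {G : Vec (n + 1) → Mat (n + 1)}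
    (hG : HasWeakGrad Set.univ U G) {a : Vec (n + 1)}
    (ha : ∀ᵐ x : Vec (n + 1), U (x + a) = U x) {v : Vec (n + 1) → Vec (n + 1)}
    (hv : ∀ᵐ x ∂(volume.restrict (cube (n + 1))), v x = U x) :
    HasWeakGrad (cube (n + 1)) v fun x => G (x + a) := by
  intro φ hφ hc hs i j
  have hψ := hG (fun x => φ (x + -a)) (hφ.comp (contDiff_id.add contDiff_const))
    (hasCompactSupport_comp_add_right φ hc _) (Set.subset_univ _) i j
  simp only [fderiv_comp_add_right, Measure.restrict_univ] at hψ
  rw [← integral_add_right_eq_self _ a, ← integral_add_right_eq_self (fun x => G x _ * _) a] at hψ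
  simp only [add_neg_cancel_right] at hψ
  rw [setIntegral_eq_integral_of_forall_compl_eq_zero (s := cube (n + 1))
    (f := fun x => G (x + a) (i, j) * φ x) fun x hx => by
      rw [image_eq_zero_of_notMem_tsupport fun h => hx (hs h), mul_zero], ← hψ,
    ← setIntegral_eq_integral_of_forall_compl_eq_zero (s := cube (n + 1))
      (f := fun x => U (x + a) i * fderiv ℝ φ x (EuclideanSpace.single j 1)) fun x hx => by
      rw [image_eq_zero_of_notMem_tsupport fun h => hx (hs (tsupport_fderiv_subset ℝ h)),
        zero_apply, mul_zero]]
  refine integral_congr_ae ?_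
  filter_upwards [hv, ae_restrict_of_ae ha] with x h1 h2
  rw [h1, h2]

theorem HasWeakGrad.congr_grad {d : ℕ} {O : Set (Vec d)} {u : Vec d → Vec d} {G G' : Vec d → Mat d}
    (h : HasWeakGrad O u G) (hG : G' =ᵐ[volume.restrict O] G) : HasWeakGrad O u G' := by
  intro φ hφ hc hs i j
  rw [h φ hφ hc hs i j, neg_inj]
  refine integral_congr_ae ?_
  filter_upwards [hG] with x hx
  rw [hx]

theorem isBounded_cell (k : Fin n → ℤ) : Bornology.IsBounded (cell k) := by
  have h : cell k = (fun x => x + latVec k) '' cube (n + 1) := by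
    ext x
    refine ⟨fun h => ⟨x - latVec k, h, sub_add_cancel _ _⟩, ?_⟩
    rintro ⟨y, hy, rfl⟩
    exact add_latVec_mem_cell.2 hy
  rw [h]
  exact (IsometryEquiv.addRight (latVec k)).isometry.lipschitz.isBounded_image (isBounded_cube _)

theorem memLp_translate {E : Type*} [NormedAddCommGroup E] {G : Vec (n + 1) → E}
    (hG : ∀ S : Set (Vec (n + 1)), IsCompact S → MemLp G 2 (volume.restrict S)) (k : Fin n → ℤ) :
    MemLp (fun x => G (x + latVec k)) 2 (volume.restrict (cube (n + 1))) :=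
  ((hG _ (isBounded_cell k).isCompact_closure).mono_measure
    (Measure.restrict_mono subset_closure le_rfl)).comp_measurePreserving
    (measurePreserving_add_latVec k)

theorem IsPeriodicRestriction.memH1 {v : L2 (cube (n + 1)) (Vec (n + 1))}
    (h : IsPeriodicRestriction v) : MemH1 (cube (n + 1)) v := by
  obtain ⟨U, ⟨G, hloc, hG⟩, -, hv⟩ := h
  have hm := memLp_translate (fun S hS => (hloc S hS).2) (0 : Fin n → ℤ)
  refine ⟨hm.toLp _, ?_⟩
  refine HasWeakGrad.congr_grad ?_ hm.coeFn_toLp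
  exact hasWeakGrad_cube_translate hG (by simp [latVec_zero]) hv

/-- In the directions parallel to the strip, an `H¹_loc` field can be integrated by parts over the
strip against any test function, whether or not it vanishes on the boundary of the strip. -/
theorem integral_strip_mul_fderiv {U : Vec (n + 1) → Vec (n + 1)} {G : Vec (n + 1) → Mat (n + 1)}
    (hloc : ∀ S : Set (Vec (n + 1)), IsCompact S →
      MemLp U 2 (volume.restrict S) ∧ MemLp G 2 (volume.restrict S))
    (hG : HasWeakGrad Set.univ U G) {φ : Vec (n + 1) → ℝ} (hφ : ContDiff ℝ ∞ φ)
    (hc : HasCompactSupport φ) (i : Fin (n + 1)) {j : Fin (n + 1)} (hj : j ≠ 0) :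
    (∫ x in strip n, U x i * fderiv ℝ φ x (EuclideanSpace.single j 1))
      + ∫ x in strip n, G x (i, j) * φ x = 0 := by
  have hf := integrable_coord_mul_fderiv (fun S hS => (hloc S hS).1) hφ hc i
    (EuclideanSpace.single j 1)
  have hg := integrable_entry_mul (fun S hS => (hloc S hS).2) hφ hc i j
  set F : Vec (n + 1) → ℝ := fun x =>
    U x i * fderiv ℝ φ x (EuclideanSpace.single j 1) + G x (i, j) * φ x with hF
  have hFi : Integrable F := hf.add hg
  -- smooth cutoffs in the first coordinate, increasing to the indicator of the strip
  have hr : ∀ m : ℕ, (0 : ℝ) < 1 / 2 - 1 / (m + 3) ∧ (1 / 2 - 1 / (m + 3) : ℝ) < 1 / 2 := by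
    intro m
    have h1 : (1 : ℝ) / (m + 3) < 1 / 2 :=
      one_div_lt_one_div_of_lt two_pos (by have := m.cast_nonneg (α := ℝ); linarith)
    have h2 : (0 : ℝ) < 1 / (m + 3) := by positivity
    constructor <;> linarith
  let θ : ℕ → ContDiffBump (0 : ℝ) := fun m => ⟨_, 1 / 2, (hr m).1, (hr m).2⟩
  have hzero : ∀ m, ∫ x, θ m (x 0) * F x = 0 := by
    intro m
    have hθ : ContDiff ℝ ∞ fun x : Vec (n + 1) => θ m (x 0) :=
      (θ m).contDiff.comp (EuclideanSpace.proj (0 : Fin (n + 1)) : Vec (n + 1) →L[ℝ] ℝ).contDiff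
    have hθd : ∀ x : Vec (n + 1), fderiv ℝ (fun x : Vec (n + 1) => θ m (x 0)) x
        (EuclideanSpace.single j 1) = 0 := by
      intro x
      have h1 : HasFDerivAt (fun x : Vec (n + 1) => θ m (x 0)) _ x :=
        HasFDerivAt.comp (g := θ m) x
          (((θ m).contDiff (n := 1)).differentiable one_ne_zero (x 0)).hasFDerivAt
          (EuclideanSpace.proj (0 : Fin (n + 1)) : Vec (n + 1) →L[ℝ] ℝ).hasFDerivAt
      rw [h1.fderiv, ContinuousLinearMap.comp_apply]
      have : (EuclideanSpace.proj (0 : Fin (n + 1)) : Vec (n + 1) →L[ℝ] ℝ)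
          (EuclideanSpace.single j 1) = 0 := by simp [hj.symm]
      rw [this, map_zero]
    have h := hG (fun x => θ m (x 0) * φ x) (hθ.mul hφ) hc.mul_left (Set.subset_univ _) i j
    rw [Measure.restrict_univ, eq_neg_iff_add_eq_zero, ← integral_add] at h
    · refine Eq.trans ?_ h
      refine integral_congr_ae (Eventually.of_forall fun x => ?_)
      simp only [hF]
      rw [fderiv_fun_mul (hθ.differentiable (by simp) x) (hφ.differentiable (by simp) x)]
      simp only [_root_.add_apply, _root_.smul_apply, smul_eq_mul, hθd]
      ring
    · exact integrable_coord_mul_fderiv (fun S hS => (hloc S hS).1) (hθ.mul hφ) hc.mul_left i _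
    · exact integrable_entry_mul (fun S hS => (hloc S hS).2) (hθ.mul hφ) hc.mul_left i j
  have hlim : Tendsto (fun m => ∫ x, θ m (x 0) * F x) atTop
      (𝓝 (∫ x, (strip n).indicator F x)) := by
    refine tendsto_integral_of_dominated_convergence (fun x => ‖F x‖) (fun m => ?_) hFi.norm
      (fun m => Eventually.of_forall fun x => ?_) (Eventually.of_forall fun x => ?_)
    · exact (((θ m).continuous.comp
        (by fun_prop : Continuous fun x : Vec (n + 1) => x 0)).aestronglyMeasurable).mul
        hFi.aestronglyMeasurable
    · rw [norm_mul, Real.norm_of_nonneg (θ m).nonneg]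
      exact mul_le_of_le_one_left (norm_nonneg _) (θ m).le_one
    · by_cases hx : x ∈ strip n
      · rw [Set.indicator_of_mem hx]
        have hev : ∀ᶠ m : ℕ in atTop, (1 : ℝ) / ((m : ℝ) + 3) < 1 / 2 - |x 0| := by
          have ht : Tendsto (fun m : ℕ => (1 : ℝ) / ((m : ℝ) + 3)) atTop (𝓝 0) :=
            tendsto_const_nhds.div_atTop
              (tendsto_atTop_add_const_right _ _ tendsto_natCast_atTop_atTop)
          exact ht.eventually_lt_const (sub_pos.2 hx)
        refine tendsto_const_nhds.congr' ?_
        filter_upwards [hev] with m hm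
        rw [(θ m).one_of_mem_closedBall, one_mul]
        rw [Metric.mem_closedBall, dist_zero_right, Real.norm_eq_abs]
        change |x 0| ≤ 1 / 2 - 1 / ((m : ℝ) + 3)
        linarith
      · rw [Set.indicator_of_notMem hx]
        refine tendsto_const_nhds.congr fun m => ?_
        rw [(θ m).zero_of_le_dist, zero_mul]
        rw [dist_zero_right, Real.norm_eq_abs]
        exact not_lt.1 hx
  simp only [hzero] at hlim
  rw [← integral_add hf.integrableOn hg.integrableOn, ← integral_indicator measurableSet_strip]
  exact (tendsto_nhds_unique hlim tendsto_const_nhds)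

/-- The pair `(v, G)` on the cube satisfies, after unfolding to the strip, the weak formulation of
`G = ∇v` for the extension periodic in all coordinates but the first, and by zero outside the
strip. -/
def IsUnfoldedGrad (v : L2 (cube (n + 1)) (Vec (n + 1))) (G : L2 (cube (n + 1)) (Mat (n + 1))) :
    Prop :=
  ∀ φ : Vec (n + 1) → ℝ, ContDiff ℝ ∞ φ → HasCompactSupport φ →
    ∀ N : ℕ, tsupport φ ⊆ slabBox n N → ∀ i j : Fin (n + 1),
      ∑ k ∈ latBox n N,
        ((∫ x in cube (n + 1), v x i * fderiv ℝ φ (x + latVec k) (EuclideanSpace.single j 1))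
          + ∫ x in cube (n + 1), G x (i, j) * φ (x + latVec k)) = 0

/-- Being an unfolded gradient is a closed condition. -/
theorem isClosed_setOf_isUnfoldedGrad :
    IsClosed {t : L2 (cube (n + 1)) (Vec (n + 1)) × L2 (cube (n + 1)) (Mat (n + 1)) |
      IsUnfoldedGrad t.1 t.2} := by
  simp only [IsUnfoldedGrad, Set.ofPred_forall]
  refine isClosed_iInter fun φ => isClosed_iInter fun hφ => isClosed_iInter fun hc =>
    isClosed_iInter fun N => isClosed_iInter fun _ => isClosed_iInter fun i =>
    isClosed_iInter fun j => ?_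
  refine isClosed_eq (continuous_finsetSum _ fun k _ => ?_) continuous_const
  obtain ⟨L, hL⟩ := exists_clm_gradPairing (cube (n + 1)) (φ := fun x => φ (x + latVec k))
    (hφ.comp (contDiff_id.add contDiff_const)) (hasCompactSupport_comp_add_right φ hc _) i j
  simp only [fderiv_comp_add_right] at hL
  simp only [← hL]
  exact L.continuous

theorem fderiv_eq_zero_of_notMem {d : ℕ} {φ : Vec d → ℝ} {S : Set (Vec d)} (hs : tsupport φ ⊆ S)
    {x : Vec d} (hx : x ∉ S) (a : Vec d) : fderiv ℝ φ x a = 0 := by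
  rw [image_eq_zero_of_notMem_tsupport fun h => hx (hs (tsupport_fderiv_subset ℝ h)), zero_apply]

/-- Unfolding of the weak formulation on the strip. -/
theorem sum_cube_eq_integral_strip {U : Vec (n + 1) → Vec (n + 1)}
    {G : Vec (n + 1) → Mat (n + 1)}
    (hloc : ∀ S : Set (Vec (n + 1)), IsCompact S →
      MemLp U 2 (volume.restrict S) ∧ MemLp G 2 (volume.restrict S))
    {v : L2 (cube (n + 1)) (Vec (n + 1))} {Gv : L2 (cube (n + 1)) (Mat (n + 1))}
    (hv : ∀ k, ∀ᵐ x ∂(volume.restrict (cube (n + 1))), v x = U (x + latVec k))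
    (hGv : ∀ k, ∀ᵐ x ∂(volume.restrict (cube (n + 1))), Gv x = G (x + latVec k))
    {φ : Vec (n + 1) → ℝ} (hφ : ContDiff ℝ ∞ φ) (hc : HasCompactSupport φ) {N : ℕ}
    (hs : tsupport φ ⊆ slabBox n N) (i j : Fin (n + 1)) :
    ∑ k ∈ latBox n N,
        ((∫ x in cube (n + 1), v x i * fderiv ℝ φ (x + latVec k) (EuclideanSpace.single j 1))
          + ∫ x in cube (n + 1), Gv x (i, j) * φ (x + latVec k))
      = (∫ x in strip n, U x i * fderiv ℝ φ x (EuclideanSpace.single j 1))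
        + ∫ x in strip n, G x (i, j) * φ x := by
  rw [integral_strip_eq_sum (integrable_coord_mul_fderiv (fun S hS => (hloc S hS).1) hφ hc i _)
      (N := N) fun x hx => by rw [fderiv_eq_zero_of_notMem hs hx, mul_zero],
    integral_strip_eq_sum (integrable_entry_mul (fun S hS => (hloc S hS).2) hφ hc i j)
      (N := N) fun x hx => by
        rw [image_eq_zero_of_notMem_tsupport fun h => hx (hs h), mul_zero],
    ← Finset.sum_add_distrib]
  refine Finset.sum_congr rfl fun k _ => ?_
  congr 1
  · refine integral_congr_ae ?_
    filter_upwards [hv k] with x hx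
    rw [hx]
  · refine integral_congr_ae ?_
    filter_upwards [hGv k] with x hx
    rw [hx]

/-- For fields with zero trace on the two faces of the cube, being the restriction of a periodic
field amounts to the unfolded weak formulation. -/
theorem isPeriodicRestriction_iff_isUnfoldedGrad {t : TraceSpace (cube (n + 1))}
    (ht : t ∈ zeroTraceGraph (cube (n + 1)) (cubeFaces (n + 1))) :
    IsPeriodicRestriction t.1 ↔ IsUnfoldedGrad t.1 t.2.1 := by
  constructor
  · rintro ⟨U, ⟨G, hloc, hG⟩, hper, hv⟩ φ hφ hc N hs i j
    by_cases hj : j = 0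
    · subst hj
      refine Finset.sum_eq_zero fun k _ => ?_
      have := integral_mul_fderiv_zero_of_zeroTrace ht (φ := fun x => φ (x + latVec k))
        (hφ.comp (contDiff_id.add contDiff_const)) (hasCompactSupport_comp_add_right φ hc _) i
      simpa only [fderiv_comp_add_right] using this
    · have hvk : ∀ k : Fin n → ℤ, ∀ᵐ x ∂(volume.restrict (cube (n + 1))),
          t.1 x = U (x + latVec k) := by
        intro k
        filter_upwards [hv, ae_restrict_of_ae (ae_periodic_latVec hper k)] with x h1 h2
        rw [h1, h2]
      have hGk : ∀ k : Fin n → ℤ, ∀ᵐ x ∂(volume.restrict (cube (n + 1))),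
          t.2.1 x = G (x + latVec k) := by
        intro k
        have hm := memLp_translate (fun S hS => (hloc S hS).2) k
        have h1 : HasWeakGrad (cube (n + 1)) t.1 (hm.toLp _) :=
          (hasWeakGrad_cube_translate hG (ae_periodic_latVec hper k) hv).congr_grad hm.coeFn_toLp
        rw [weakGrad_unique (isOpen_cube _) (mem_zeroTraceGraph.1 ht).1.2 h1]
        exact hm.coeFn_toLp
      rw [sum_cube_eq_integral_strip hloc hvk hGk hφ hc hs]
      exact integral_strip_mul_fderiv hloc hG hφ hc i hj
  · intro h
    have hcube : ∀ᵐ x ∂(volume.restrict (cube (n + 1))), x ∈ cube (n + 1) :=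
      ae_restrict_mem (isOpen_cube _).measurableSet
    have hloc : ∀ S : Set (Vec (n + 1)), IsCompact S →
        MemLp (periodicExt t.1) 2 (volume.restrict S)
          ∧ MemLp (periodicExt t.2.1) 2 (volume.restrict S) := fun S hS =>
      ⟨memLp_periodicExt (Lp.memLp t.1) hS.isBounded,
        memLp_periodicExt (Lp.memLp t.2.1) hS.isBounded⟩
    refine ⟨periodicExt t.1, ⟨periodicExt t.2.1, hloc, ?_⟩, ?_, ?_⟩
    · intro φ hφ hc _ i j
      obtain ⟨N, hN⟩ := exists_subset_slabBox hc.isBounded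
      rw [Measure.restrict_univ, eq_neg_iff_add_eq_zero, ← h φ hφ hc N hN i j,
        sum_cube_eq_integral_strip hloc (fun k => ?_) (fun k => ?_) hφ hc hN i j,
        setIntegral_eq_integral_of_forall_compl_eq_zero fun x hx => ?_,
        setIntegral_eq_integral_of_forall_compl_eq_zero fun x hx => ?_]
      · rw [periodicExt, Set.indicator_of_notMem hx, PiLp.zero_apply, zero_mul]
      · rw [periodicExt, Set.indicator_of_notMem hx, PiLp.zero_apply, zero_mul]
      · filter_upwards [hcube] with x hx
        rw [periodicExt_add_latVec, periodicExt_of_mem_cube _ hx]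
      · filter_upwards [hcube] with x hx
        rw [periodicExt_add_latVec, periodicExt_of_mem_cube _ hx]
    · intro i hi
      obtain ⟨j, rfl⟩ := Fin.exists_succ_eq.2 (fun h => hi (by rw [h]; rfl) : i ≠ 0)
      have hl : (EuclideanSpace.single j.succ 1 : Vec (n + 1)) = latVec (Pi.single j 1) := by
        ext l
        refine Fin.cases ?_ (fun l => ?_) l
        · simp
        · simp [Pi.single_apply]
      rw [hl]
      exact Eventually.of_forall fun x => periodicExt_add_latVec _ _ _
    · filter_upwards [hcube] with x hx
      rw [periodicExt_of_mem_cube _ hx]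

/-- The restrictions of periodic fields. -/
def periodicSubmodule (n : ℕ) : Submodule ℝ (L2 (cube (n + 1)) (Vec (n + 1))) where
  carrier := {v | IsPeriodicRestriction v}
  add_mem' := by
    rintro v v' ⟨U, ⟨G, hl, hG⟩, hp, hv⟩ ⟨U', ⟨G', hl', hG'⟩, hp', hv'⟩
    refine ⟨U + U', ⟨G + G', fun S hS => ⟨(hl S hS).1.add (hl' S hS).1,
      (hl S hS).2.add (hl' S hS).2⟩, fun φ hφ hc hs i j => ?_⟩, fun i hi => ?_, ?_⟩
    · have h1 := hG φ hφ hc hs i j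
      have h2 := hG' φ hφ hc hs i j
      simp only [Measure.restrict_univ, Pi.add_apply, PiLp.add_apply, add_mul] at h1 h2 ⊢
      rw [integral_add, integral_add, h1, h2, neg_add]
      · exact integrable_entry_mul (fun S hS => (hl S hS).2) hφ hc i j
      · exact integrable_entry_mul (fun S hS => (hl' S hS).2) hφ hc i j
      · exact integrable_coord_mul_fderiv (fun S hS => (hl S hS).1) hφ hc i _
      · exact integrable_coord_mul_fderiv (fun S hS => (hl' S hS).1) hφ hc i _
    · filter_upwards [hp i hi, hp' i hi] with x h1 h2
      rw [Pi.add_apply, Pi.add_apply, h1, h2]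
    · filter_upwards [hv, hv', Lp.coeFn_add v v'] with x h1 h2 h3
      rw [h3, Pi.add_apply, Pi.add_apply, h1, h2]
  zero_mem' := by
    refine ⟨0, ⟨0, fun S hS => ⟨MemLp.zero, MemLp.zero⟩, fun φ hφ hc hs i j => by simp⟩,
      fun i hi => by simp, Lp.coeFn_zero _ _ _⟩
  smul_mem' := by
    rintro c v ⟨U, ⟨G, hl, hG⟩, hp, hv⟩
    refine ⟨c • U, ⟨c • G, fun S hS => ⟨(hl S hS).1.const_smul c, (hl S hS).2.const_smul c⟩,
      fun φ hφ hc hs i j => ?_⟩, fun i hi => ?_, ?_⟩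
    · have h1 := hG φ hφ hc hs i j
      simp only [Pi.smul_apply, PiLp.smul_apply, smul_eq_mul, mul_assoc]
      rw [integral_const_mul, integral_const_mul, h1, mul_neg]
    · filter_upwards [hp i hi] with x h1
      rw [Pi.smul_apply, Pi.smul_apply, h1]
    · filter_upwards [hv, Lp.coeFn_smul c v] with x h1 h3
      rw [h3, Pi.smul_apply, Pi.smul_apply, h1]

/-- The fields with zero trace on the two faces, their gradients and their traces, which are
restrictions of periodic fields. -/
def periodicGraph (n : ℕ) : Submodule ℝ (TraceSpace (cube (n + 1))) :=
  zeroTraceGraph (cube (n + 1)) (cubeFaces (n + 1)) ⊓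
    (periodicSubmodule n).comap (LinearMap.fst ℝ _ _)

theorem mem_periodicGraph {t : TraceSpace (cube (n + 1))} :
    t ∈ periodicGraph n ↔ t ∈ zeroTraceGraph (cube (n + 1)) (cubeFaces (n + 1))
      ∧ IsPeriodicRestriction t.1 := Iff.rfl

theorem isClosed_periodicGraph :
    IsClosed (periodicGraph n : Set (TraceSpace (cube (n + 1)))) := by
  have h : (periodicGraph n : Set (TraceSpace (cube (n + 1))))
      = (zeroTraceGraph (cube (n + 1)) (cubeFaces (n + 1)) : Set (TraceSpace (cube (n + 1))))
        ∩ (fun t : TraceSpace (cube (n + 1)) => (t.1, t.2.1)) ⁻¹'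
          {t | IsUnfoldedGrad t.1 t.2} := by
    ext t
    exact and_congr_right fun ht => isPeriodicRestriction_iff_isUnfoldedGrad ht
  rw [h]
  exact (isClosed_zeroTraceGraph _ _).inter (isClosed_setOf_isUnfoldedGrad.preimage
    (continuous_fst.prodMk (continuous_fst.comp continuous_snd)))

/-- The Dirichlet–Periodic class is affine over the periodic fields with zero trace on the two
faces. -/
theorem admissiblePer_eq_affineClass {w : L2 (cube (n + 1)) (Vec (n + 1))}
    {Gw : L2 (cube (n + 1)) (Mat (n + 1))} [IsFiniteMeasure (volume.restrict (cube (n + 1)))]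
    [IsFiniteMeasure (bdryMeasure (cube (n + 1)))] (hG : HasWeakGrad (cube (n + 1)) w Gw)
    (hw : IsPeriodicRestriction w) :
    admissiblePer w = affineClass (periodicGraph n) w Gw := by
  ext a
  have hper : ∀ v, a.1 = w + v → (IsPeriodicRestriction a.1 ↔ IsPeriodicRestriction v) := by
    intro v hv
    rw [hv]
    exact (periodicSubmodule n).add_mem_iff_right hw
  change a ∈ admissible _ _ w ∧ _ ↔ _
  rw [admissible_eq_affineClass (isOpen_cube _) (isBounded_cube _) (fun x hx => hx.1) hG]
  constructor
  · rintro ⟨⟨t, ht, h1, h2⟩, h3⟩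
    exact ⟨t, mem_periodicGraph.2 ⟨ht, (hper _ h1).1 h3⟩, h1, h2⟩
  · rintro ⟨t, ht, h1, h2⟩
    exact ⟨⟨t, (mem_periodicGraph.1 ht).1, h1, h2⟩, (hper _ h1).2 (mem_periodicGraph.1 ht).2⟩

end Periodic

end

end SofteningPlasticity

theorem mainTheorem11 {d : ℕ} (hd : 1 ≤ d)
    (K : Set (MDev d × ℝ)) (hK : IsConstraintSet K)
    (C : MSym d →ₗ[ℝ] MSym d) (hC : IsElasticityTensor C)
    (V : ℝ → ℝ) (M : ℝ) (hV : IsSofteningPotential K V M)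
    (ε τ : ℝ) (hε : 0 < ε) (hτ : 0 < τ) (hτM : 0 < M → τ < ε / M) :
    (∀ Ω Γ₀ : Set (Vec d), IsReferenceConfiguration Ω Γ₀ →
      ∀ w₁ : L2 Ω (Vec d), MemH1 Ω w₁ → ∀ (p₀ : L2 Ω (MDev d)) (z₀ : L2 Ω ℝ),
        ∃! c : Config Ω, c ∈ competitors (admissible Ω Γ₀ w₁) ∧
          IsMinOn (incrementalEnergy C K V ε τ p₀ z₀) (competitors (admissible Ω Γ₀ w₁)) c) ∧
    (2 ≤ d →
      ∀ w₁ : L2 (cube d) (Vec d), IsPeriodicRestriction w₁ →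
        ∀ (p₀ : L2 (cube d) (MDev d)) (z₀ : L2 (cube d) ℝ),
          ∃! c : Config (cube d), c ∈ competitors (admissiblePer w₁) ∧
            IsMinOn (incrementalEnergy C K V ε τ p₀ z₀) (competitors (admissiblePer w₁)) c) := by
  refine ⟨fun Ω Γ₀ h w₁ hw p₀ z₀ => ?_, fun hd2 w₁ hw p₀ z₀ => ?_⟩
  · have : IsFiniteMeasure (volume.restrict Ω) :=
      isFiniteMeasure_restrict.2 h.isBounded.measure_lt_top.ne
    have := isFiniteMeasure_bdryMeasure hd h.isOpen h.isBounded h.lipschitz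
    obtain ⟨Gw, hGw⟩ := hw
    obtain ⟨c, hc⟩ := exists_korn_zeroTraceGraph hd h
    rw [admissible_eq_affineClass h.isOpen h.isBounded h.dirichlet_subset hGw]
    exact existsUnique_minimiser_affineClass (isClosed_zeroTraceGraph Ω Γ₀) hc w₁ Gw hK hC hV
      hε hτ hτM p₀ z₀
  · obtain ⟨n, rfl⟩ : ∃ n, d = n + 1 := ⟨d - 1, by omega⟩
    have h := isReferenceConfiguration_cube n
    have : IsFiniteMeasure (volume.restrict (cube (n + 1))) :=
      isFiniteMeasure_restrict.2 h.isBounded.measure_lt_top.ne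
    have := isFiniteMeasure_bdryMeasure hd h.isOpen h.isBounded h.lipschitz
    obtain ⟨Gw, hGw⟩ := hw.memH1
    obtain ⟨c, hc⟩ := exists_korn_zeroTraceGraph hd h
    rw [admissiblePer_eq_affineClass hGw hw]
    exact existsUnique_minimiser_affineClass isClosed_periodicGraph
      (fun t ht => hc t (mem_periodicGraph.1 ht).1) w₁ Gw hK hC hV hε hτ hτM p₀ z₀
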